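/- Let $d\ge 1$, let $r_i,s_i>0$ $(i=1,\dots,d)$ be known, and let $\lambda=(\lambda_1,\dots,\lambda_d)\in(0,\infty)^d$ be unknown. Let $x_i\sim\mathrm{Poisson}(r_i\lambda_i)$ and $y_i\sim\mathrm{Poisson}(s_i\lambda_i)$, all independent; $x$ is observed and $y$ is to be predicted. A predictive distribution $q(y\mid x)$ assigns to each $x\in\mathbb N^d$ a probability mass function on $\mathbb N^d$, and its Kullback--Leibler risk is $$R(\lambda,q)=\sum_x p(x\mid\lambda)\sum_y p(y\mid\lambda)\log\frac{p(y\mid\lambda)}{q(y\mid x)}\in[0,\infty].$$ We say that $q$ dominates $q'$ if $R(\lambda,q)\le R(\lambda,q')$ for all $\lambda$, with strict inequality for some $\lambda$. For a (possibly improper) prior density $\pi$ on $(0,\infty)^d$ the Bayesian predictive distribution is $$p_\pi(y\mid x)=\frac{\int p(x\mid\lambda)p(y\mid\lambda)\pi(\lambda)\,d\lambda}{\int p(x\mid\lambda)\pi(\lambda)\,d\lambda},$$ and $p_{\mathrm J}$ is the one for the Jeffreys prior $\pi_{\mathrm J}(\lambda)=\prod_i\lambda_i^{-1/2}$. Let $V\subset\mathbb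 R^d$ be a linear subspace of dimension $k$, let $s_V(\theta)$ be the squared Euclidean distance from $\theta$ to $V$, let $0<\alpha\le (d-k-2)/2$, and put $$f(\theta)=\sum_{a\in\{1,-1\}^d}s_V(a_1\theta_1,\dots,a_d\theta_d)^{-\alpha}.$$ Consider the prior $\pi_{f,\mathrm J}(\lambda)=f(\theta)\prod_i\lambda_i^{-1/2}$ in either of the following settings: (i) same durations: $r_1=\dots=r_d$, $s_1=\dots=s_d$ and $\theta_i=\sqrt{\lambda_i}$; (ii) possibly different durations: $\theta_i=\sqrt{\lambda_i/\gamma_i}$ with $\gamma_i=\frac1{r_i}-\frac1{r_i+s_i}$. Then in both settings $p_{f,\mathrm J}:=p_{\pi_{f,\mathrm J}}$ and $p_{\mathrm J}$ are well-defined predictive distributions, and $p_{f,\mathrm J}$ dominates $p_{\mathrm J}$. Moreover $p_{f,\mathrm J}$ is nearly minimax: the number $L=\frac12\sum_{i=1}^d\log\frac{r_i+s_i}{r_i}$ is a lower bound for the minimax risk, $L\le\inf_q\sup_\lambda R(\lambda,q)$, where the infimum is over all predictive distributions $q$, and $R(\lambda,p_{f,\mathrm J})<1.04\,L$ for every $\lambda\in(0,\infty)^d$.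 -/

import Mathlib

open scoped ENNReal

noncomputable section

/-- Joint mass function of independent counts `x i`, Poisson with mean `t i * lam i`
(duration `t i`, intensity `lam i`). -/
def poissonLik {d : ℕ} (t lam : Fin d → ℝ) (x : Fin d → ℕ) : ℝ :=
  ∏ i, Real.exp (-(t i * lam i)) * (t i * lam i) ^ (x i) / ((x i).factorial : ℝ)

/-- The measure on `ℕ^d` with mass function `p`. -/
def massMeasure {d : ℕ} (p : (Fin d → ℕ) → ℝ≥0∞) : MeasureTheory.Measure (Fin d → ℕ) :=
  MeasureTheory.Measure.count.withDensity p

/-- `q x y` stands for `q(y ∣ x)`; for each observation `x` it is a probability mass function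
in `y`. -/
def IsPredictive {d : ℕ} (q : (Fin d → ℕ) → (Fin d → ℕ) → ℝ≥0∞) : Prop :=
  ∀ x, ∑' y, q x y = 1

/-- Kullback–Leibler loss `D(p(· ∣ lam), q(· ∣ x))`, where `p(· ∣ lam)` is the law of the target
`y` with durations `s`. -/
def klLoss {d : ℕ} (s : Fin d → ℝ) (q : (Fin d → ℕ) → (Fin d → ℕ) → ℝ≥0∞)
    (lam : Fin d → ℝ) (x : Fin d → ℕ) : ℝ≥0∞ :=
  InformationTheory.klDiv (massMeasure fun y => ENNReal.ofReal (poissonLik s lam y))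
    (massMeasure (q x))

/-- Kullback–Leibler risk: the expected loss when `x` is observed with durations `r`. -/
def klRisk {d : ℕ} (r s : Fin d → ℝ) (q : (Fin d → ℕ) → (Fin d → ℕ) → ℝ≥0∞)
    (lam : Fin d → ℝ) : ℝ≥0∞ :=
  ∑' x, ENNReal.ofReal (poissonLik r lam x) * klLoss s q lam x

/-- Bayesian predictive distribution
`∫ p(x ∣ lam) p(y ∣ lam) π(lam) dlam / ∫ p(x ∣ lam) π(lam) dlam`
for a (possibly improper) prior density on the parameter space `(0, ∞)^d`. -/
def bayesPredictive {d : ℕ} (r s : Fin d → ℝ) (prior : (Fin d → ℝ) → ℝ≥0∞)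
    (x y : Fin d → ℕ) : ℝ≥0∞ :=
  (∫⁻ lam in {lam : Fin d → ℝ | ∀ i, 0 < lam i},
      ENNReal.ofReal (poissonLik r lam x) * ENNReal.ofReal (poissonLik s lam y) * prior lam) /
    (∫⁻ lam in {lam : Fin d → ℝ | ∀ i, 0 < lam i},
      ENNReal.ofReal (poissonLik r lam x) * prior lam)

/-- Jeffreys prior density `∏ lam_i ^ (-1/2)`. -/
def jeffreysPrior {d : ℕ} (lam : Fin d → ℝ) : ℝ≥0∞ :=
  ENNReal.ofReal (∏ i, (lam i) ^ (-(1 / 2) : ℝ))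

/-- The prior `f(θ) ∏ lam_i ^ (-1/2)` with `θ_i = √(lam_i / c_i)`. -/
def weightedJeffreysPrior {d : ℕ} (c : Fin d → ℝ) (f : EuclideanSpace ℝ (Fin d) → ℝ≥0∞)
    (lam : Fin d → ℝ) : ℝ≥0∞ :=
  f (WithLp.toLp 2 fun i => Real.sqrt (lam i / c i)) * jeffreysPrior lam

/-- Squared Euclidean distance from `θ` to the subspace `V`. -/
def sqDist {d : ℕ} (V : Submodule ℝ (EuclideanSpace ℝ (Fin d)))
    (θ : EuclideanSpace ℝ (Fin d)) : ℝ :=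
  Metric.infDist θ (V : Set (EuclideanSpace ℝ (Fin d))) ^ 2

/-- `(a_1 θ_1, …, a_d θ_d)` for a vector of signs `a`. -/
def signFlip {d : ℕ} (a : Fin d → ℤˣ) (θ : EuclideanSpace ℝ (Fin d)) :
    EuclideanSpace ℝ (Fin d) :=
  WithLp.toLp 2 fun i => ((a i : ℤ) : ℝ) * θ i

/-- `f(θ) = ∑_{a ∈ {±1}^d} s_V(aθ)^{-α}`, with value `∞` where some `aθ` lies in `V`. -/
def subspaceShrinkage {d : ℕ} (V : Submodule ℝ (EuclideanSpace ℝ (Fin d))) (α : ℝ)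
    (θ : EuclideanSpace ℝ (Fin d)) : ℝ≥0∞ :=
  ∑ a : Fin d → ℤˣ, (ENNReal.ofReal (sqDist V (signFlip a θ))) ^ (-α)

/-- `γ_i = 1 / r_i - 1 / (r_i + s_i)`. -/
def durationScale {d : ℕ} (r s : Fin d → ℝ) (i : Fin d) : ℝ :=
  1 / r i - 1 / (r i + s i)

/-- `q` dominates `q'`: its risk is nowhere larger and somewhere strictly smaller. -/
def Dominates {d : ℕ} (r s : Fin d → ℝ)
    (q q' : (Fin d → ℕ) → (Fin d → ℕ) → ℝ≥0∞) : Prop :=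
  (∀ lam : Fin d → ℝ, (∀ i, 0 < lam i) → klRisk r s q lam ≤ klRisk r s q' lam) ∧
    ∃ lam : Fin d → ℝ, (∀ i, 0 < lam i) ∧ klRisk r s q lam < klRisk r s q' lam

/-- Minimax risk: infimum over all predictive distributions of the supremum of the risk. -/
def minimaxRisk {d : ℕ} (r s : Fin d → ℝ) : ℝ≥0∞ :=
  ⨅ (q : (Fin d → ℕ) → (Fin d → ℕ) → ℝ≥0∞) (_ : IsPredictive q),
    ⨆ (lam : Fin d → ℝ) (_ : ∀ i, 0 < lam i), klRisk r s q lam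

/-- The quantity `(1/2) ∑ log ((r_i + s_i) / r_i)`. -/
def minimaxLowerBound {d : ℕ} (r s : Fin d → ℝ) : ℝ :=
  (1 / 2) * ∑ i, Real.log ((r i + s i) / r i)

/-- `q` is nearly minimax: `minimaxLowerBound` really is a lower bound for the minimax risk, and
the risk of `q` is everywhere less than `1.04` times it. -/
def IsNearlyMinimax {d : ℕ} (r s : Fin d → ℝ)
    (q : (Fin d → ℕ) → (Fin d → ℕ) → ℝ≥0∞) : Prop :=
  ENNReal.ofReal (minimaxLowerBound r s) ≤ minimaxRisk r s ∧
    ∀ lam : Fin d → ℝ, (∀ i, 0 < lam i) →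
      klRisk r s q lam < ENNReal.ofReal (1.04 * minimaxLowerBound r s)

/-- `q` improves on `q'` (both being predictive distributions) and is nearly minimax. -/
def DominatesNearlyMinimax {d : ℕ} (r s : Fin d → ℝ)
    (q q' : (Fin d → ℕ) → (Fin d → ℕ) → ℝ≥0∞) : Prop :=
  IsPredictive q ∧ IsPredictive q' ∧ Dominates r s q q' ∧ IsNearlyMinimax r s q

end

/-! Domination. Since `log u ≤ u - 1`, the risks satisfy R(p_f) + 1 ≤ R(p_J) + E[p_J(y∣x) /
p_f(y∣x)] (`klRisk_add_le`), so it suffices that the expected ratio is below 1. By Gamma conjugacy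
this ratio equals A(x) / B(x+y), where A and B are the means of f under the Jeffreys posteriors
given x and given (x, y). Because f is even in every coordinate, both can be computed in signed
coordinates λ_i = γ_i θ_i², where the posteriors have densities proportional to ∏ θ_i^(2 z_i)
exp(-τ_i θ_i²).

Given w = x + y, the count x_i is binomial with w_i trials and success probability r_i / (r_i +
s_i), so the claim reduces to ∑_x P(x∣w) A(x) < B(w) for every w. The scale γ_i is chosen so that
adding N(0, 1/2) noise to θ, drawn from the posterior given w, produces exactly the binomial mixture
of the posteriors given x (`lintegral_signedGammaDensity_mul_gaussian`). The left side is therefore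
B(w) with f replaced by its Gaussian average, and superharmonicity makes that average strictly
smaller than f (`heatAverage_lt_and_le`). Superharmonicity holds because s_V is a sum of d - k
squares in adapted coordinates and 2α ≤ d - k - 2; the proof writes s_V^(-α) as a Laplace integral
(`heatAverage_inv_quadratic`). With equal durations γ is constant and f is homogeneous, so the two
settings give the same predictive distribution.

Upper bound. The Jeffreys risk is a sum over coordinates of ½ log((r+s)/r) + h((r+s)λ) - h(rλ), with
h = `jeffreysPotential`. Its derivative `logGap` is below 0.02/μ, so each coordinate is below 0.52
log((r+s)/r), that is 1.04 times its share of L.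

Lower bound. The supremum of the risk is at least the Bayes risk of any proper prior. For Gamma
priors of shape 1/2 and rate tending to 0, pointwise lower bounds of the risk converge to L, and
Fatou's lemma passes to the limit (`minimaxLowerBound_le_minimaxRisk`). -/

namespace PoissonShrinkage
open MeasureTheory ProbabilityTheory Filter Topology

noncomputable section

variable {d : ℕ}

/-! ### Poisson means of functions of exponential growth -/

/-- At most exponential growth with base `2`. -/
def ExpBounded (g : ℕ → ℝ) : Prop := ∃ C : ℝ, ∀ n, |g n| ≤ C * 2 ^ n

/-- Mean of `g` under the Poisson law with mean `μ`. -/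
def poissonMean (μ : ℝ) (g : ℕ → ℝ) : ℝ :=
  ∑' n : ℕ, Real.exp (-μ) * μ ^ n / (n.factorial : ℝ) * g n

lemma ExpBounded.nonneg_const {g : ℕ → ℝ} {C : ℝ} (h : ∀ n, |g n| ≤ C * 2 ^ n) : 0 ≤ C := by
  have := h 0
  simp only [pow_zero, mul_one] at this
  exact (abs_nonneg _).trans this

lemma ExpBounded.add {g h : ℕ → ℝ} (hg : ExpBounded g) (hh : ExpBounded h) :
    ExpBounded (fun n => g n + h n) := by
  obtain ⟨C, hC⟩ := hg
  obtain ⟨D, hD⟩ := hh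
  refine ⟨C + D, fun n => (abs_add_le _ _).trans ?_⟩
  rw [add_mul]
  exact add_le_add (hC n) (hD n)

lemma ExpBounded.const_mul {g : ℕ → ℝ} (c : ℝ) (hg : ExpBounded g) :
    ExpBounded (fun n => c * g n) := by
  obtain ⟨C, hC⟩ := hg
  refine ⟨|c| * C, fun n => ?_⟩
  rw [abs_mul, mul_assoc]
  exact mul_le_mul_of_nonneg_left (hC n) (abs_nonneg c)

lemma ExpBounded.sub {g h : ℕ → ℝ} (hg : ExpBounded g) (hh : ExpBounded h) :
    ExpBounded (fun n => g n - h n) := by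
  simpa [sub_eq_add_neg] using hg.add (hh.const_mul (-1))

lemma ExpBounded.comp_add {g : ℕ → ℝ} (hg : ExpBounded g) (m : ℕ) :
    ExpBounded (fun n => g (n + m)) := by
  obtain ⟨C, hC⟩ := hg
  refine ⟨C * 2 ^ m, fun n => (hC _).trans (le_of_eq ?_)⟩
  ring

lemma ExpBounded.of_bounded {g : ℕ → ℝ} (C : ℝ) (hg : ∀ n, |g n| ≤ C) : ExpBounded g := by
  refine ⟨C, fun n => (hg n).trans ?_⟩
  have : 0 ≤ C := (abs_nonneg _).trans (hg 0)
  exact le_mul_of_one_le_right this (one_le_pow₀ (by norm_num))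

lemma expBounded_const (c : ℝ) : ExpBounded (fun _ => c) := .of_bounded |c| fun _ => le_rfl

lemma expBounded_natCast : ExpBounded (fun n => (n : ℝ)) := by
  refine ⟨1, fun n => ?_⟩
  rw [abs_of_nonneg (by positivity), one_mul]
  have : n ≤ 2 ^ n := Nat.lt_two_pow_self.le
  change (n : ℝ) ≤ 2 ^ n
  exact_mod_cast this

lemma summable_expBounded {g : ℕ → ℝ} (hg : ExpBounded g) (μ : ℝ) :
    Summable fun n : ℕ => μ ^ n / (n.factorial : ℝ) * g n := by
  obtain ⟨C, hC⟩ := hg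
  refine Summable.of_norm_bounded ((Real.summable_pow_div_factorial (2 * |μ|)).mul_left C)
    fun n => ?_
  rw [Real.norm_eq_abs, abs_mul, abs_div, abs_pow, Nat.abs_cast]
  calc |μ| ^ n / (n.factorial : ℝ) * |g n| ≤ |μ| ^ n / (n.factorial : ℝ) * (C * 2 ^ n) :=
        mul_le_mul_of_nonneg_left (hC n) (by positivity)
    _ = C * ((2 * |μ|) ^ n / (n.factorial : ℝ)) := by rw [mul_pow]; ring

lemma summable_poissonMean {g : ℕ → ℝ} (hg : ExpBounded g) (μ : ℝ) :
    Summable fun n : ℕ => Real.exp (-μ) * μ ^ n / (n.factorial : ℝ) * g n := by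
  exact ((summable_expBounded hg μ).mul_left (Real.exp (-μ))).congr fun n => by ring_nf

lemma poissonMean_eq_exp_mul (g : ℕ → ℝ) (μ : ℝ) :
    poissonMean μ g = Real.exp (-μ) * ∑' n : ℕ, μ ^ n / (n.factorial : ℝ) * g n := by
  rw [poissonMean, ← tsum_mul_left]
  congr 1
  ext n
  ring

lemma hasSum_pow_div_factorial (μ : ℝ) :
    HasSum (fun n : ℕ => μ ^ n / (n.factorial : ℝ)) (Real.exp μ) := by
  rw [Real.exp_eq_exp_ℝ]
  exact NormedSpace.expSeries_div_hasSum_exp μ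

lemma poissonMean_const (μ c : ℝ) : poissonMean μ (fun _ => c) = c := by
  rw [poissonMean_eq_exp_mul, tsum_mul_right, (hasSum_pow_div_factorial μ).tsum_eq, ← mul_assoc,
    ← Real.exp_add]
  simp

lemma poissonMean_add {g h : ℕ → ℝ} (hg : ExpBounded g) (hh : ExpBounded h) (μ : ℝ) :
    poissonMean μ (fun n => g n + h n) = poissonMean μ g + poissonMean μ h := by
  simp only [poissonMean, mul_add]
  exact (summable_poissonMean hg μ).tsum_add (summable_poissonMean hh μ)

lemma poissonMean_const_mul (g : ℕ → ℝ) (c μ : ℝ) :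
    poissonMean μ (fun n => c * g n) = c * poissonMean μ g := by
  rw [poissonMean, poissonMean, ← tsum_mul_left]
  congr 1
  ext n
  ring

lemma poissonMean_sub {g h : ℕ → ℝ} (hg : ExpBounded g) (hh : ExpBounded h) (μ : ℝ) :
    poissonMean μ (fun n => g n - h n) = poissonMean μ g - poissonMean μ h := by
  simp only [poissonMean, mul_sub]
  exact (summable_poissonMean hg μ).tsum_sub (summable_poissonMean hh μ)

lemma poissonMean_mono {g h : ℕ → ℝ} (hg : ExpBounded g) (hh : ExpBounded h) {μ : ℝ} (hμ : 0 ≤ μ)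
    (hgh : ∀ n, g n ≤ h n) : poissonMean μ g ≤ poissonMean μ h :=
  (summable_poissonMean hg μ).tsum_le_tsum
    (fun n => mul_le_mul_of_nonneg_left (hgh n) (by positivity)) (summable_poissonMean hh μ)

lemma poissonMean_nonneg {g : ℕ → ℝ} {μ : ℝ} (hμ : 0 ≤ μ) (hg : ∀ n, 0 ≤ g n) :
    0 ≤ poissonMean μ g :=
  tsum_nonneg fun n => mul_nonneg (by positivity) (hg n)

/-- `E[z h(z - 1)] = μ E[h(z)]`. -/
lemma poissonMean_shift {g h : ℕ → ℝ} (hg : ExpBounded g) (μ : ℝ) (h0 : g 0 = 0)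
    (hgh : ∀ n : ℕ, g (n + 1) = (n + 1) * h n) :
    poissonMean μ g = μ * poissonMean μ h := by
  rw [poissonMean, (summable_poissonMean hg μ).tsum_eq_zero_add, h0, mul_zero, zero_add,
    poissonMean, ← tsum_mul_left]
  congr 1
  ext n
  rw [hgh, Nat.factorial_succ]
  push_cast
  have : (n.factorial : ℝ) ≠ 0 := by positivity
  have : (n : ℝ) + 1 ≠ 0 := by positivity
  field_simp
  ring

lemma poissonMean_natCast (μ : ℝ) : poissonMean μ (fun n => (n : ℝ)) = μ := by
  rw [poissonMean_shift (h := fun _ => 1) expBounded_natCast μ (by simp) (by simp),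
    poissonMean_const, mul_one]

/-- The Poisson weights satisfy dp_μ(n)/dμ = p_μ(n-1) - p_μ(n), so differentiating in μ becomes a
forward difference of `g`. Applied to log Γ(n + 1/2) and then to log(n + 1/2), this yields the
derivatives of `jeffreysPotential` and `logGap`. -/
lemma hasDerivAt_poissonMean {g : ℕ → ℝ} (hg : ExpBounded g) (μ : ℝ) :
    HasDerivAt (fun μ => poissonMean μ g) (poissonMean μ fun n => g (n + 1) - g n) μ := by
  have hs : ExpBounded fun n => g (n + 1) := hg.comp_add 1
  have key : HasDerivAt (fun μ : ℝ => ∑' n : ℕ, μ ^ n / (n.factorial : ℝ) * g n)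
      (∑' n : ℕ, ((n : ℝ) * μ ^ (n - 1)) / (n.factorial : ℝ) * g n) μ := by
    obtain ⟨C, hC⟩ := hg
    have hC0 := ExpBounded.nonneg_const hC
    -- Termwise differentiation is carried out on a ball containing μ, where the differentiated
    -- series is dominated by its value at the radius.
    set R := |μ| + 1 with hR
    have hR0 : 0 < R := by positivity
    have hμ : μ ∈ Metric.ball (0 : ℝ) R := by
      rw [mem_ball_zero_iff, Real.norm_eq_abs, hR]
      linarith
    refine hasDerivAt_tsum_of_isPreconnected
      (g := fun (n : ℕ) (y : ℝ) => y ^ n / (n.factorial : ℝ) * g n)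
      (g' := fun (n : ℕ) (y : ℝ) => ((n : ℝ) * y ^ (n - 1)) / (n.factorial : ℝ) * g n)
      (u := fun n : ℕ => ((n : ℝ) * R ^ (n - 1)) / (n.factorial : ℝ) * (C * 2 ^ n))
      (t := Metric.ball 0 R) (y₀ := μ) ?_ Metric.isOpen_ball
      (convex_ball _ _).isPreconnected (fun n y _ => ?_) (fun n y hy => ?_) hμ
      (summable_expBounded ⟨C, hC⟩ μ) hμ
    · rw [← summable_nat_add_iff 1]
      refine ((Real.summable_pow_div_factorial (2 * R)).mul_left (2 * C)).congr fun n => ?_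
      rw [Nat.factorial_succ, Nat.add_sub_cancel]
      push_cast
      have : (n.factorial : ℝ) ≠ 0 := by positivity
      have : (n : ℝ) + 1 ≠ 0 := by positivity
      field_simp
      ring_nf
    · exact ((hasDerivAt_pow n y).div_const _).mul_const _
    · rw [mem_ball_zero_iff, Real.norm_eq_abs] at hy
      rw [Real.norm_eq_abs, abs_mul, abs_div, abs_mul, abs_pow, Nat.abs_cast, Nat.abs_cast]
      gcongr
      exact hC n
  have hre : ∑' n : ℕ, ((n : ℝ) * μ ^ (n - 1)) / (n.factorial : ℝ) * g n
      = ∑' n : ℕ, μ ^ n / (n.factorial : ℝ) * g (n + 1) := by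
    have hterm : ∀ n : ℕ, (((n + 1 : ℕ) : ℝ) * μ ^ (n + 1 - 1)) / ((n + 1).factorial : ℝ) * g (n + 1)
        = μ ^ n / (n.factorial : ℝ) * g (n + 1) := by
      intro n
      rw [Nat.factorial_succ, Nat.add_sub_cancel]
      push_cast
      have : (n.factorial : ℝ) ≠ 0 := by positivity
      have : (n : ℝ) + 1 ≠ 0 := by positivity
      field_simp
    have hsum : Summable fun n : ℕ => ((n : ℝ) * μ ^ (n - 1)) / (n.factorial : ℝ) * g n := by
      rw [← summable_nat_add_iff 1]
      exact (summable_expBounded hs μ).congr fun n => (hterm n).symm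
    rw [hsum.tsum_eq_zero_add]
    simp only [hterm]
    simp
  rw [hre] at key
  have hexp : HasDerivAt (fun μ : ℝ => Real.exp (-μ)) (-Real.exp (-μ)) μ := by
    simpa using (hasDerivAt_neg μ).exp
  have hfun : (fun μ => poissonMean μ g)
      = fun μ => Real.exp (-μ) * ∑' n : ℕ, μ ^ n / (n.factorial : ℝ) * g n :=
    funext (poissonMean_eq_exp_mul g)
  rw [hfun]
  refine (hexp.fun_mul key).congr_deriv ?_
  rw [poissonMean_sub hs hg, poissonMean_eq_exp_mul, poissonMean_eq_exp_mul]
  ring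

/-! ### The entropy-type function of the Jeffreys prior -/

/-- `log Γ(n + 1/2)`. -/
def logGammaHalf (n : ℕ) : ℝ := Real.log (Real.Gamma (n + 1 / 2))

lemma logGammaHalf_succ (n : ℕ) :
    logGammaHalf (n + 1) = logGammaHalf n + Real.log (n + 1 / 2) := by
  have h : ((n + 1 : ℕ) : ℝ) + 1 / 2 = ((n : ℝ) + 1 / 2) + 1 := by push_cast; ring
  rw [logGammaHalf, h, Real.Gamma_add_one (by positivity),
    Real.log_mul (by positivity) (Real.Gamma_pos_of_pos (by positivity)).ne', add_comm]
  rfl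

lemma abs_log_nat_add_half_le (n : ℕ) : |Real.log ((n : ℝ) + 1 / 2)| ≤ 2 ^ n := by
  rcases Nat.eq_zero_or_pos n with rfl | hn
  · have : Real.log ((0 : ℕ) + 1 / 2 : ℝ) = -Real.log 2 := by
      rw [← Real.log_inv]; norm_num
    rw [this, abs_neg, abs_of_nonneg (Real.log_nonneg (by norm_num))]
    have := Real.log_two_lt_d9
    norm_num
    linarith
  · have h1 : (1 : ℝ) ≤ n := by exact_mod_cast hn
    have h2 : (n : ℝ) < 2 ^ n := by exact_mod_cast Nat.lt_two_pow_self
    rw [abs_of_nonneg (Real.log_nonneg (by linarith))]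
    have := Real.log_le_sub_one_of_pos (show (0 : ℝ) < n + 1 / 2 by positivity)
    linarith

lemma expBounded_log_half : ExpBounded fun n => Real.log ((n : ℝ) + 1 / 2) :=
  ⟨1, fun n => by simpa using abs_log_nat_add_half_le n⟩

lemma expBounded_logGammaHalf : ExpBounded logGammaHalf := by
  refine ⟨|logGammaHalf 0| + 1, fun n => ?_⟩
  have h : |logGammaHalf n| ≤ |logGammaHalf 0| + (2 ^ n - 1) := by
    induction n with
    | zero => simp
    | succ n ih =>
      rw [logGammaHalf_succ]
      have := abs_add_le (logGammaHalf n) (Real.log ((n : ℝ) + 1 / 2))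
      have := abs_log_nat_add_half_le n
      rw [pow_succ]
      linarith
  have h1 : (1 : ℝ) ≤ 2 ^ n := one_le_pow₀ (by norm_num)
  nlinarith [abs_nonneg (logGammaHalf 0)]

/-- `μ log μ - μ - E log Γ(z + 1/2)` for `z` Poisson with mean `μ`. -/
def jeffreysPotential (μ : ℝ) : ℝ := μ * Real.log μ - μ - poissonMean μ logGammaHalf

/-- `log μ - E log (z + 1/2)`, the derivative of `jeffreysPotential`. -/
def logGap (μ : ℝ) : ℝ := Real.log μ - poissonMean μ fun n => Real.log ((n : ℝ) + 1 / 2)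

lemma hasDerivAt_jeffreysPotential {μ : ℝ} (hμ : 0 < μ) :
    HasDerivAt jeffreysPotential (logGap μ) μ := by
  have h1 := (Real.hasDerivAt_mul_log hμ.ne').sub (hasDerivAt_id μ)
  have h2 : HasDerivAt jeffreysPotential _ μ :=
    h1.sub (hasDerivAt_poissonMean expBounded_logGammaHalf μ)
  refine h2.congr_deriv ?_
  have : (fun n => logGammaHalf (n + 1) - logGammaHalf n)
      = fun n : ℕ => Real.log ((n : ℝ) + 1 / 2) := by
    ext n
    rw [logGammaHalf_succ]
    ring
  rw [this, logGap]
  ring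

/-- `log ((n + 1/2) / (n - 1/2)) - 1 / n`, shifted to `n + 1`. -/
def logStep (n : ℕ) : ℝ :=
  Real.log (((n + 1 : ℕ) : ℝ) + 1 / 2) - Real.log ((n : ℝ) + 1 / 2) - 1 / ((n : ℝ) + 1)

/-- With x = 1/(2(n+1)) the difference of logarithms is log((1+x)/(1-x)) = 2 ∑ x^(2k+1)/(2k+1), and
subtracting 1/(n+1) removes exactly the term k = 0. The other terms are nonnegative, and replacing
1/(2k+1) by 1/3 bounds them by a geometric series. -/
lemma logStep_bounds (n : ℕ) :
    0 ≤ logStep n ∧ logStep n ≤ 1 / (3 * (n + 1) * (2 * n + 1) * (2 * n + 3)) := by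
  set x : ℝ := 1 / (2 * (n + 1)) with hx
  have hx0 : 0 < x := by positivity
  have hx1 : x ≤ 1 / 2 := by
    rw [hx]
    apply one_div_le_one_div_of_le (by norm_num)
    have : (0 : ℝ) ≤ n := by positivity
    linarith
  have hs := Real.hasSum_log_sub_log_of_abs_lt_one (x := x) (by rw [abs_of_pos hx0]; linarith)
  have hlog : Real.log (1 + x) - Real.log (1 - x)
      = Real.log (((n + 1 : ℕ) : ℝ) + 1 / 2) - Real.log ((n : ℝ) + 1 / 2) := by
    rw [← Real.log_div (by positivity) (by linarith), ← Real.log_div (by positivity) (by positivity)]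
    congr 1
    rw [div_eq_div_iff (by linarith) (by positivity), hx]
    push_cast
    field_simp
    ring
  rw [hlog] at hs
  have hfirst : 2 * (1 / (2 * ((0 : ℕ) : ℝ) + 1)) * x ^ (2 * 0 + 1) = 1 / ((n : ℝ) + 1) := by
    rw [hx]
    simp only [Nat.cast_zero, mul_zero, zero_add, pow_one]
    field_simp
  have htail : HasSum (fun k : ℕ => 2 * (1 / (2 * ((k + 1 : ℕ) : ℝ) + 1)) * x ^ (2 * (k + 1) + 1))
      (logStep n) := by
    have := (hasSum_nat_add_iff' 1).mpr hs
    simp only [Finset.sum_range_one] at this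
    rwa [hfirst] at this
  refine ⟨htail.nonneg fun k => by positivity, ?_⟩
  have hx2 : x ^ 2 < 1 := by nlinarith
  have hgeo := (hasSum_geometric_of_lt_one (by positivity : 0 ≤ x ^ 2) hx2).mul_left
    (2 / 3 * x ^ 3)
  have hle : logStep n ≤ 2 / 3 * x ^ 3 * (1 - x ^ 2)⁻¹ := by
    refine hasSum_le (fun k => ?_) htail hgeo
    have e : x ^ (2 * (k + 1) + 1) = x ^ 3 * (x ^ 2) ^ k := by rw [← pow_mul, ← pow_add]; ring_nf
    rw [e, ← mul_assoc]
    have h13 : 2 * (1 / (2 * ((k + 1 : ℕ) : ℝ) + 1)) ≤ 2 / 3 := by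
      rw [mul_one_div, div_le_div_iff₀ (by positivity) (by norm_num)]
      push_cast
      have : (0 : ℝ) ≤ k := by positivity
      linarith
    gcongr
  refine hle.trans (le_of_eq ?_)
  have h4 : 1 - x ^ 2 = (2 * n + 1) * (2 * n + 3) / (2 * (n + 1)) ^ 2 := by
    rw [hx]
    field_simp
    ring
  rw [h4, hx]
  field_simp

lemma expBounded_logStep : ExpBounded logStep := by
  refine .of_bounded 1 fun n => ?_
  obtain ⟨h0, h1⟩ := logStep_bounds n
  rw [abs_of_nonneg h0]
  refine h1.trans ?_
  rw [div_le_one (by positivity)]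
  have : (0 : ℝ) ≤ n := by positivity
  have h2 : (1 : ℝ) ≤ (2 * n + 1) * (2 * n + 3) := by nlinarith
  nlinarith

lemma expBounded_inv_succ : ExpBounded fun n => 1 / ((n : ℝ) + 1) := by
  refine .of_bounded 1 fun n => ?_
  rw [abs_of_nonneg (by positivity), div_le_one (by positivity)]
  have : (0 : ℝ) ≤ n := by positivity
  linarith

lemma poissonMean_indicator_succ (μ : ℝ) :
    poissonMean μ (fun n => if n = 0 then 0 else 1) = 1 - Real.exp (-μ) := by
  have h : (fun n : ℕ => if n = 0 then (0 : ℝ) else 1) = fun n => 1 - if n = 0 then (1 : ℝ) else 0 := by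
    ext n
    split_ifs <;> simp
  have hb : ExpBounded fun n : ℕ => if n = 0 then (1 : ℝ) else 0 :=
    .of_bounded 1 fun n => by split_ifs <;> simp
  rw [h, poissonMean_sub (expBounded_const 1) hb, poissonMean_const]
  congr 1
  rw [poissonMean, tsum_eq_single 0 (by intro n hn; simp [hn])]
  simp

/-- The factor μ shifts the Poisson index and turns the mean into P(z ≥ 1). -/
lemma mul_poissonMean_inv_succ (μ : ℝ) :
    μ * poissonMean μ (fun n => 1 / ((n : ℝ) + 1)) = 1 - Real.exp (-μ) := by
  rw [← poissonMean_indicator_succ]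
  symm
  refine poissonMean_shift (.of_bounded 1 fun n => by split_ifs <;> simp) μ (by simp) fun n => ?_
  have : (n : ℝ) + 1 ≠ 0 := by positivity
  simp only [Nat.succ_ne_zero, if_false]
  field_simp

/-- The forward difference of log(n + 1/2) is `logStep n` plus 1/(n+1). The second part has the
explicit mean (1 - e^(-μ))/μ, which cancels the derivative 1/μ of log up to e^(-μ)/μ. -/
lemma hasDerivAt_logGap {μ : ℝ} (hμ : 0 < μ) :
    HasDerivAt logGap (Real.exp (-μ) / μ - poissonMean μ logStep) μ := by
  have h : HasDerivAt logGap _ μ :=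
    (Real.hasDerivAt_log hμ.ne').sub (hasDerivAt_poissonMean expBounded_log_half μ)
  refine h.congr_deriv ?_
  have e : (fun n : ℕ => Real.log (((n + 1 : ℕ) : ℝ) + 1 / 2) - Real.log ((n : ℝ) + 1 / 2))
      = fun n : ℕ => logStep n + 1 / ((n : ℝ) + 1) := by
    ext n
    rw [logStep]
    ring
  rw [e, poissonMean_add expBounded_logStep expBounded_inv_succ]
  have := mul_poissonMean_inv_succ μ
  field_simp
  linarith

/-- Jensen's inequality, through the tangent line of log at μ. Together with the equally crude
`logGap_le` it serves to identify the limit at infinity; the sharp bounds come from derivatives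
afterwards. -/
lemma logGap_ge {μ : ℝ} (hμ : 0 < μ) : -(1 / (2 * μ)) ≤ logGap μ := by
  have hb : ExpBounded fun n : ℕ => (Real.log μ + 1 / (2 * μ) - 1) + 1 / μ * (n : ℝ) :=
    (expBounded_const _).add (expBounded_natCast.const_mul _)
  have h := poissonMean_mono expBounded_log_half hb hμ.le fun n => by
    have h1 := Real.log_le_sub_one_of_pos (show 0 < ((n : ℝ) + 1 / 2) / μ by positivity)
    rw [Real.log_div (by positivity) hμ.ne'] at h1
    have : ((n : ℝ) + 1 / 2) / μ = 1 / (2 * μ) + 1 / μ * n := by field_simp; ring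
    linarith
  rw [poissonMean_add (expBounded_const _) (expBounded_natCast.const_mul _), poissonMean_const,
    poissonMean_const_mul, poissonMean_natCast, one_div_mul_cancel hμ.ne'] at h
  rw [logGap]
  linarith

lemma logGap_le {μ : ℝ} (hμ : 0 < μ) : logGap μ ≤ 2 / μ := by
  set k : ℕ → ℝ := fun n => 1 / (((n : ℝ) + 1) * (n + 2)) with hk
  have hkb : ExpBounded k := by
    refine .of_bounded 1 fun n => ?_
    have : (0 : ℝ) ≤ n := by positivity
    rw [hk, abs_of_nonneg (by positivity), div_le_one (by positivity)]
    nlinarith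
  have hk2 : μ * (μ * poissonMean μ k) ≤ 1 := by
    set i1 : ℕ → ℝ := fun n => if n = 0 then 0 else 1 / ((n : ℝ) + 1) with hi1
    have hi1b : ExpBounded i1 := by
      refine .of_bounded 1 fun n => ?_
      rw [hi1]
      dsimp only
      split_ifs
      · simp
      · rw [abs_of_nonneg (by positivity), div_le_one (by positivity)]
        have : (0 : ℝ) ≤ n := by positivity
        linarith
    have e1 : μ * poissonMean μ k = poissonMean μ i1 := by
      symm
      refine poissonMean_shift hi1b μ (by simp [hi1]) fun n => ?_
      have h1 : (n : ℝ) + 1 ≠ 0 := by positivity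
      have h2 : (n : ℝ) + 2 ≠ 0 := by positivity
      simp only [hi1, hk, Nat.succ_ne_zero, if_false]
      push_cast
      rw [add_assoc]
      norm_num
      field_simp
    rw [e1]
    have := poissonMean_mono hi1b expBounded_inv_succ hμ.le fun n => by
      rw [hi1]
      dsimp only
      split_ifs
      · positivity
      · exact le_rfl
    calc μ * poissonMean μ i1 ≤ μ * poissonMean μ (fun n => 1 / ((n : ℝ) + 1)) :=
          mul_le_mul_of_nonneg_left this hμ.le
      _ = 1 - Real.exp (-μ) := mul_poissonMean_inv_succ μ
      _ ≤ 1 := by linarith [Real.exp_pos (-μ)]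
  have hi2 : μ * poissonMean μ (fun n => 1 / ((n : ℝ) + 1)) ≤ 1 := by
    rw [mul_poissonMean_inv_succ]
    linarith [Real.exp_pos (-μ)]
  have hb : ExpBounded fun n : ℕ => (Real.log μ + 1) - μ * (1 / ((n : ℝ) + 1) + 2 * k n) :=
    (expBounded_const _).sub ((expBounded_inv_succ.add (hkb.const_mul 2)).const_mul μ)
  have h := poissonMean_mono hb expBounded_log_half hμ.le fun n => by
    have h1 := Real.log_le_sub_one_of_pos (show 0 < μ / ((n : ℝ) + 1 / 2) by positivity)
    rw [Real.log_div hμ.ne' (by positivity)] at h1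
    -- The half-integer shift costs 1/((n+1)(2n+1)) ≤ 2 `k n`. Unlike 1/(n + 1/2), the functions
    -- 1/(n+1) and `k` have Poisson means controlled by index shifts, at most 1/μ and 1/μ².
    have h2 : 1 / ((n : ℝ) + 1 / 2) ≤ 1 / ((n : ℝ) + 1) + 2 * k n := by
      have e : 1 / ((n : ℝ) + 1) + 2 * k n = (n + 4) / (((n : ℝ) + 1) * (n + 2)) := by
        rw [hk]
        field_simp
        ring
      rw [e, div_le_div_iff₀ (by positivity) (by positivity)]
      have : (0 : ℝ) ≤ n := by positivity
      nlinarith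
    have h3 : μ / ((n : ℝ) + 1 / 2) = μ * (1 / ((n : ℝ) + 1 / 2)) := by ring
    have h4 := mul_le_mul_of_nonneg_left h2 hμ.le
    linarith
  rw [poissonMean_sub (expBounded_const _) ((expBounded_inv_succ.add (hkb.const_mul 2)).const_mul μ),
    poissonMean_const, poissonMean_const_mul,
    poissonMean_add expBounded_inv_succ (hkb.const_mul 2), poissonMean_const_mul] at h
  rw [logGap, le_div_iff₀ hμ]
  nlinarith

lemma tendsto_logGap : Tendsto logGap atTop (𝓝 0) := by
  have h1 : Tendsto (fun μ : ℝ => -(1 / (2 * μ))) atTop (𝓝 0) := by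
    have := (tendsto_const_nhds (x := (-1 / 2 : ℝ))).mul tendsto_inv_atTop_zero
    rw [mul_zero] at this
    refine this.congr fun μ => ?_
    ring
  have h2 : Tendsto (fun μ : ℝ => 2 / μ) atTop (𝓝 0) := tendsto_const_nhds.div_atTop tendsto_id
  refine tendsto_of_tendsto_of_tendsto_of_le_of_le' h1 h2 ?_ ?_
  · filter_upwards [eventually_gt_atTop 0] with μ hμ using logGap_ge hμ
  · filter_upwards [eventually_gt_atTop 0] with μ hμ using logGap_le hμ

/-- Integration from infinity: strict decrease towards the limit 0 forces positivity. This converts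
inequalities for the derivative of `logGap` into inequalities for `logGap` itself. -/
lemma pos_of_deriv_neg_of_tendsto_zero {w w' : ℝ → ℝ}
    (hw : ∀ x, 0 < x → HasDerivAt w (w' x) x) (hneg : ∀ x, 0 < x → w' x < 0)
    (hlim : Tendsto w atTop (𝓝 0)) {x : ℝ} (hx : 0 < x) : 0 < w x := by
  have hanti : StrictAntiOn w (Set.Ioi 0) := by
    refine strictAntiOn_of_deriv_neg (convex_Ioi 0)
      (fun y hy => (hw y hy).continuousAt.continuousWithinAt) fun y hy => ?_
    rw [interior_Ioi] at hy
    rw [(hw y hy).deriv]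
    exact hneg y hy
  have h1 : w (x + 1) < w x := hanti hx (by simp only [Set.mem_Ioi]; linarith) (by linarith)
  refine lt_of_le_of_lt (le_of_tendsto hlim ?_) h1
  filter_upwards [eventually_gt_atTop (x + 1)] with y hy
  exact (hanti (by simp only [Set.mem_Ioi]; linarith) (by simp only [Set.mem_Ioi]; linarith) hy).le

/-- As `logStep` is nonnegative, the derivative of `logGap μ + 1/μ²` is at most e^(-μ)/μ - 2/μ³,
which is negative because e^μ > μ²/2. -/
lemma logGap_gt_neg_inv_sq {μ : ℝ} (hμ : 0 < μ) : -(1 / μ ^ 2) < logGap μ := by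
  have hlim : Tendsto (fun μ : ℝ => logGap μ + 1 / μ ^ 2) atTop (𝓝 0) := by
    have h2 : Tendsto (fun μ : ℝ => 1 / μ ^ 2) atTop (𝓝 0) :=
      tendsto_const_nhds.div_atTop (tendsto_pow_atTop (by norm_num))
    simpa using tendsto_logGap.add h2
  have := pos_of_deriv_neg_of_tendsto_zero (w := fun μ : ℝ => logGap μ + 1 / μ ^ 2)
    (w' := fun μ => (Real.exp (-μ) / μ - poissonMean μ logStep) + -(2 / μ ^ 3))
    (fun x hx => by
      refine (hasDerivAt_logGap hx).add ?_
      have h := (hasDerivAt_pow 2 x).fun_inv (by positivity)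
      simp only [← one_div] at h
      refine h.congr_deriv ?_
      have := hx.ne'
      field_simp
      norm_num
      ring)
    (fun x hx => by
      have h1 := poissonMean_nonneg hx.le fun n => (logStep_bounds n).1
      have h2 : Real.exp (-x) / x < 2 / x ^ 3 := by
        have h3 := Real.quadratic_le_exp_of_nonneg hx.le
        rw [Real.exp_neg, div_lt_div_iff₀ hx (by positivity), inv_mul_lt_iff₀ (Real.exp_pos x)]
        nlinarith [mul_le_mul_of_nonneg_right h3 hx.le]
      linarith) hlim hμ
  linarith

/-- The integrated form of `logGap x > -1/x²`. The loss 1/μ vanishes as μ → ∞, which is what the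
lower bound for the minimax risk needs. -/
lemma jeffreysPotential_sub_ge {μ ν : ℝ} (hμ : 0 < μ) (h : μ ≤ ν) :
    -(1 / μ) ≤ jeffreysPotential ν - jeffreysPotential μ := by
  have hmono : MonotoneOn (fun x => jeffreysPotential x - 1 / x) (Set.Ioi 0) := by
    have hd : ∀ x : ℝ, 0 < x →
        HasDerivAt (fun x => jeffreysPotential x - 1 / x) (logGap x - -(1 / x ^ 2)) x := by
      intro x hx
      refine (hasDerivAt_jeffreysPotential hx).sub ?_
      have h := (hasDerivAt_id x).fun_inv hx.ne'
      simp only [← one_div, id] at h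
      exact h.congr_deriv (by ring)
    refine monotoneOn_of_deriv_nonneg (convex_Ioi 0)
      (fun y hy => (hd y hy).continuousAt.continuousWithinAt)
      (fun y hy => ?_) fun y hy => ?_
    · rw [interior_Ioi] at hy
      exact (hd y hy).differentiableAt.differentiableWithinAt
    · rw [interior_Ioi] at hy
      rw [(hd y hy).deriv]
      linarith [logGap_gt_neg_inv_sq hy]
  have := hmono hμ (lt_of_lt_of_le hμ h : ν ∈ Set.Ioi 0) h
  simp only at this
  have : 0 < 1 / ν := by have := hμ.trans_le h; positivity
  linarith


/-- Lower bound for the Taylor coefficients of `0.02 e^x + x - ∑ logStep n x^(n+2) / n!`. -/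
lemma remainder_poly_pos {x : ℝ} (hx : 0 < x) :
    0 < 0.02 + 1.02 * x + ∑ n ∈ Finset.range 11,
      (0.02 - ((n : ℝ) + 2) / (3 * (2 * n + 1) * (2 * n + 3))) *
        (x ^ (n + 2) / ((n + 2).factorial : ℝ)) := by
  rcases le_total x (13 / 2) with h | h
  -- On [0, 13/2] each term is multiplied by the power of (x + v)·(2/13) = 1 that makes the whole
  -- expression homogeneous of degree 12 in x and v. Its expansion has only nonnegative
  -- coefficients, a Bernstein-type certificate of positivity.
  · obtain ⟨v, hv, hxv⟩ : ∃ v : ℝ, 0 ≤ v ∧ (x + v) * (2 / 13) = 1 :=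
      ⟨13 / 2 - x, by linarith, by ring⟩
    have e : 0.02 + 1.02 * x + ∑ n ∈ Finset.range 11,
        (0.02 - ((n : ℝ) + 2) / (3 * (2 * n + 1) * (2 * n + 3))) *
          (x ^ (n + 2) / ((n + 2).factorial : ℝ))
        = 0.02 * ((x + v) * (2 / 13)) ^ 12 + 1.02 * x * ((x + v) * (2 / 13)) ^ 11 +
          ∑ n ∈ Finset.range 11, (0.02 - ((n : ℝ) + 2) / (3 * (2 * n + 1) * (2 * n + 3))) *
          (x ^ (n + 2) / ((n + 2).factorial : ℝ) * ((x + v) * (2 / 13)) ^ (10 - n)) := by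
      simp only [hxv, one_pow, mul_one]
    rw [e]
    simp only [Finset.sum_range_succ, Finset.sum_range_zero, Nat.factorial]
    norm_num
    ring_nf
    positivity
  -- Beyond 13/2 the expansion in t = x - 13/2 already has nonnegative coefficients.
  · obtain ⟨t, ht, rfl⟩ : ∃ t : ℝ, 0 ≤ t ∧ x = 13 / 2 + t := ⟨x - 13 / 2, by linarith, by ring⟩
    simp only [Finset.sum_range_succ, Finset.sum_range_zero, Nat.factorial]
    norm_num
    ring_nf
    positivity

/-- Multiplication by μ² e^μ turns the claim into a comparison of power series. After `logStep` is
replaced by its upper bound, the coefficient of μ^(n+2)/(n+2)! is 0.02 - (n+2)/(3(2n+1)(2n+3)),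
negative only for n ≤ 4. Eleven of these terms, with the constant and linear ones, form the
polynomial of `remainder_poly_pos`. -/
lemma poissonMean_logStep_lt {μ : ℝ} (hμ : 0 < μ) :
    poissonMean μ logStep < 0.02 / μ ^ 2 + Real.exp (-μ) / μ := by
  set c : ℕ → ℝ := fun n => 0.02 - ((n : ℝ) + 2) / (3 * (2 * n + 1) * (2 * n + 3)) with hc
  have h1 : HasSum (fun n : ℕ => 0.02 * (μ ^ (n + 2) / ((n + 2).factorial : ℝ)))
      (0.02 * (Real.exp μ - 1 - μ)) := by
    refine HasSum.mul_left _ ?_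
    have := (hasSum_nat_add_iff' 2).mpr (hasSum_pow_div_factorial μ)
    simpa [Finset.sum_range_succ, sub_sub] using this
  have h2 := ((summable_expBounded expBounded_logStep μ).hasSum.mul_left (μ ^ 2))
  have h3 := h1.sub h2
  have hterm : ∀ n : ℕ, c n * (μ ^ (n + 2) / ((n + 2).factorial : ℝ)) ≤
      0.02 * (μ ^ (n + 2) / ((n + 2).factorial : ℝ)) -
        μ ^ 2 * (μ ^ n / (n.factorial : ℝ) * logStep n) := by
    intro n
    have e : μ ^ 2 * (μ ^ n / (n.factorial : ℝ) * logStep n)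
        = (n + 2) * (n + 1) * logStep n * (μ ^ (n + 2) / ((n + 2).factorial : ℝ)) := by
      rw [Nat.factorial_succ, Nat.factorial_succ]
      push_cast
      have : (n.factorial : ℝ) ≠ 0 := by positivity
      field_simp
      ring
    rw [e, ← sub_mul]
    refine mul_le_mul_of_nonneg_right ?_ (by positivity)
    rw [hc]
    refine sub_le_sub_left ?_ _
    calc (n + 2) * (n + 1) * logStep n
        ≤ (n + 2) * (n + 1) * (1 / (3 * (n + 1) * (2 * n + 1) * (2 * n + 3))) :=
          mul_le_mul_of_nonneg_left (logStep_bounds n).2 (by positivity)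
      _ = ((n : ℝ) + 2) / (3 * (2 * n + 1) * (2 * n + 3)) := by field_simp
  -- The terms with n ≥ 11 are nonnegative, so discarding them only lowers the sum.
  have hfin := sum_le_hasSum (Finset.range 11) (fun n hn => by
    refine le_trans (mul_nonneg ?_ (by positivity)) (hterm n)
    have hn : (11 : ℝ) ≤ n := by
      have : 11 ≤ n := by simpa using hn
      exact_mod_cast this
    rw [hc]
    dsimp only
    rw [sub_nonneg, div_le_iff₀ (by positivity)]
    nlinarith) h3
  have hpoly := remainder_poly_pos hμ
  have hsum := Finset.sum_le_sum fun n (_ : n ∈ Finset.range 11) => hterm n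
  rw [poissonMean_eq_exp_mul]
  set tot := ∑' n : ℕ, μ ^ n / (n.factorial : ℝ) * logStep n
  have hmain : μ ^ 2 * tot < 0.02 * Real.exp μ + μ := by
    simp only [hc] at hsum
    linarith
  have : 0.02 / μ ^ 2 + Real.exp (-μ) / μ
      = Real.exp (-μ) * ((0.02 * Real.exp μ + μ) / μ ^ 2) := by
    rw [Real.exp_neg]
    have := (Real.exp_pos μ).ne'
    field_simp
  rw [this]
  refine mul_lt_mul_of_pos_left ?_ (Real.exp_pos _)
  rw [lt_div_iff₀ (by positivity)]
  linarith

/-- `poissonMean_logStep_lt` says precisely that `0.02 / μ - logGap μ` has negative derivative. The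
constant 0.02 is the source of 1.04 = 2 · (1/2 + 0.02). -/
lemma logGap_lt {μ : ℝ} (hμ : 0 < μ) : logGap μ < 0.02 / μ := by
  have hlim : Tendsto (fun μ : ℝ => 0.02 / μ - logGap μ) atTop (𝓝 0) := by
    have h2 : Tendsto (fun μ : ℝ => 0.02 / μ) atTop (𝓝 0) :=
      tendsto_const_nhds.div_atTop tendsto_id
    simpa using h2.sub tendsto_logGap
  have := pos_of_deriv_neg_of_tendsto_zero (w := fun μ : ℝ => 0.02 / μ - logGap μ)
    (w' := fun μ => -(0.02 / μ ^ 2) - (Real.exp (-μ) / μ - poissonMean μ logStep))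
    (fun x hx => by
      refine HasDerivAt.sub ?_ (hasDerivAt_logGap hx)
      have h := ((hasDerivAt_id x).fun_inv hx.ne').const_mul 0.02
      simp only [id, ← div_eq_mul_inv] at h
      exact h.congr_deriv (by ring))
    (fun x hx => by linarith [poissonMean_logStep_lt hx]) hlim hμ
  linarith

/-- The integrated form of `logGap x < 0.02/x`. With ν/μ = (r+s)/r it bounds the excess of a
coordinate of the Jeffreys risk over ½ log((r+s)/r). -/
lemma jeffreysPotential_sub_lt {μ ν : ℝ} (hμ : 0 < μ) (h : μ < ν) :
    jeffreysPotential ν - jeffreysPotential μ < 0.02 * Real.log (ν / μ) := by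
  have hmono : StrictMonoOn (fun x => 0.02 * Real.log x - jeffreysPotential x) (Set.Ioi 0) := by
    have hd : ∀ x : ℝ, 0 < x → HasDerivAt (fun x => 0.02 * Real.log x - jeffreysPotential x)
        (0.02 * x⁻¹ - logGap x) x := fun x hx =>
      ((Real.hasDerivAt_log hx.ne').const_mul _).sub (hasDerivAt_jeffreysPotential hx)
    refine strictMonoOn_of_deriv_pos (convex_Ioi 0)
      (fun y hy => (hd y hy).continuousAt.continuousWithinAt) fun y hy => ?_
    rw [interior_Ioi] at hy
    rw [(hd y hy).deriv, ← div_eq_mul_inv]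
    linarith [logGap_lt hy]
  have := hmono hμ (hμ.trans h : ν ∈ Set.Ioi 0) h
  simp only at this
  rw [Real.log_div (hμ.trans h).ne' hμ.ne']
  linarith

/-! ### Kullback–Leibler divergence of mass functions -/

/-- The contribution `p log (p / q) + q - p` of one atom to the Kullback–Leibler divergence. -/
def klTerm (p q : ℝ≥0∞) : ℝ≥0∞ := q * ENNReal.ofReal (InformationTheory.klFun (p / q).toReal)

lemma klTerm_ofReal {a b : ℝ} (ha : 0 < a) (hb : 0 < b) :
    klTerm (ENNReal.ofReal a) (ENNReal.ofReal b) =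
      ENNReal.ofReal (a * Real.log (a / b) + b - a) := by
  rw [klTerm, ← ENNReal.ofReal_div_of_pos hb, ENNReal.toReal_ofReal (by positivity),
    ← ENNReal.ofReal_mul hb.le, InformationTheory.klFun_apply]
  congr 1
  field_simp

lemma mul_log_div_add_sub_nonneg {a b : ℝ} (ha : 0 < a) (hb : 0 < b) :
    0 ≤ a * Real.log (a / b) + b - a := by
  have h := Real.log_le_sub_one_of_pos (div_pos hb ha)
  have h2 : Real.log (a / b) = -Real.log (b / a) := by rw [← Real.log_inv, inv_div]
  have h3 := mul_le_mul_of_nonneg_left h ha.le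
  have h4 : a * (b / a - 1) = b - a := by field_simp
  rw [h2]
  linarith

/-- This is p log(j/f) ≤ p (j/f - 1) with every negative term moved to the other side, since
subtraction in `ℝ≥0∞` truncates. -/
lemma klTerm_add_le {p f j : ℝ≥0∞} (hp : p ≠ 0) (hp' : p ≠ ∞) (hf : f ≠ 0) (hf' : f ≠ ∞)
    (hj : j ≠ 0) (hj' : j ≠ ∞) :
    klTerm p f + (j + p) ≤ klTerm p j + (p * (j / f) + f) := by
  obtain ⟨a, ha, rfl⟩ : ∃ a : ℝ, 0 < a ∧ p = ENNReal.ofReal a :=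
    ⟨p.toReal, ENNReal.toReal_pos hp hp', (ENNReal.ofReal_toReal hp').symm⟩
  obtain ⟨b, hb, rfl⟩ : ∃ b : ℝ, 0 < b ∧ f = ENNReal.ofReal b :=
    ⟨f.toReal, ENNReal.toReal_pos hf hf', (ENNReal.ofReal_toReal hf').symm⟩
  obtain ⟨c, hc, rfl⟩ : ∃ c : ℝ, 0 < c ∧ j = ENNReal.ofReal c :=
    ⟨j.toReal, ENNReal.toReal_pos hj hj', (ENNReal.ofReal_toReal hj').symm⟩
  have n1 := mul_log_div_add_sub_nonneg ha hb
  have n2 := mul_log_div_add_sub_nonneg ha hc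
  rw [klTerm_ofReal ha hb, klTerm_ofReal ha hc, ← ENNReal.ofReal_div_of_pos hb,
    ← ENNReal.ofReal_mul ha.le, ← ENNReal.ofReal_add hc.le ha.le,
    ← ENNReal.ofReal_add n1 (by positivity), ← ENNReal.ofReal_add (by positivity) hb.le,
    ← ENNReal.ofReal_add n2 (by positivity)]
  refine ENNReal.ofReal_le_ofReal ?_
  have h := mul_le_mul_of_nonneg_left (Real.log_le_sub_one_of_pos (div_pos hc hb)) ha.le
  have e : Real.log (c / b) = Real.log (a / b) - Real.log (a / c) := by
    rw [Real.log_div hc.ne' hb.ne', Real.log_div ha.ne' hb.ne', Real.log_div ha.ne' hc.ne']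
    ring
  rw [e] at h
  linarith


/-! ### Mass functions on counts as measures, with their densities and divergences -/

lemma measurable_counts {β : Type*} [MeasurableSpace β] (g : (Fin d → ℕ) → β) : Measurable g :=
  measurable_of_countable g

lemma massMeasure_univ (p : (Fin d → ℕ) → ℝ≥0∞) : massMeasure p Set.univ = ∑' y, p y := by
  rw [massMeasure, withDensity_apply _ MeasurableSet.univ, Measure.restrict_univ, lintegral_count]

lemma massMeasure_singleton (p : (Fin d → ℕ) → ℝ≥0∞) (y : Fin d → ℕ) :
    massMeasure p {y} = p y := by
  rw [massMeasure, withDensity_apply _ (measurableSet_singleton y), lintegral_singleton,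
    Measure.count_singleton, mul_one]

lemma lintegral_massMeasure (p g : (Fin d → ℕ) → ℝ≥0∞) :
    ∫⁻ y, g y ∂massMeasure p = ∑' y, p y * g y := by
  rw [massMeasure, lintegral_withDensity_eq_lintegral_mul _ (measurable_counts p)
    (measurable_counts g), lintegral_count]
  rfl

lemma isProbabilityMeasure_massMeasure {p : (Fin d → ℕ) → ℝ≥0∞} (hp : ∑' y, p y = 1) :
    IsProbabilityMeasure (massMeasure p) := ⟨by rw [massMeasure_univ, hp]⟩

lemma massMeasure_eq_withDensity {p q : (Fin d → ℕ) → ℝ≥0∞} (hq : ∀ y, q y ≠ 0)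
    (hq' : ∀ y, q y ≠ ∞) : massMeasure p = (massMeasure q).withDensity fun y => p y / q y := by
  rw [massMeasure, massMeasure, ← withDensity_mul _ (measurable_counts _) (measurable_counts _)]
  congr 1
  ext y
  exact (ENNReal.mul_div_cancel (hq y) (hq' y)).symm

lemma ne_top_of_tsum_eq_one {q : (Fin d → ℕ) → ℝ≥0∞} (hq : ∑' y, q y = 1) (y : Fin d → ℕ) :
    q y ≠ ∞ := ENNReal.ne_top_of_tsum_ne_top (by simp [hq]) y

lemma massMeasure_absolutelyContinuous {p q : (Fin d → ℕ) → ℝ≥0∞} (hq : ∀ y, q y ≠ 0)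
    (hq1 : ∑' y, q y = 1) : massMeasure p ≪ massMeasure q := by
  rw [massMeasure_eq_withDensity (p := p) hq (ne_top_of_tsum_eq_one hq1)]
  exact withDensity_absolutelyContinuous _ _

lemma rnDeriv_massMeasure {p q : (Fin d → ℕ) → ℝ≥0∞} (hq : ∀ y, q y ≠ 0)
    (hq1 : ∑' y, q y = 1) :
    (massMeasure p).rnDeriv (massMeasure q) =ᵐ[massMeasure q] fun y => p y / q y := by
  have := isProbabilityMeasure_massMeasure hq1
  rw [massMeasure_eq_withDensity (p := p) hq (ne_top_of_tsum_eq_one hq1)]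
  exact Measure.rnDeriv_withDensity _ (measurable_counts _)

lemma klDiv_massMeasure {p q : (Fin d → ℕ) → ℝ≥0∞} (hp1 : ∑' y, p y = 1)
    (hq : ∀ y, q y ≠ 0) (hq1 : ∑' y, q y = 1) :
    InformationTheory.klDiv (massMeasure p) (massMeasure q) = ∑' y, klTerm (p y) (q y) := by
  have := isProbabilityMeasure_massMeasure hq1
  have := isProbabilityMeasure_massMeasure hp1
  rw [InformationTheory.klDiv_eq_lintegral_klFun_of_ac (massMeasure_absolutelyContinuous hq hq1),
    lintegral_congr_ae (g := fun y => ENNReal.ofReal (InformationTheory.klFun (p y / q y).toReal)),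
    lintegral_massMeasure]
  · rfl
  · filter_upwards [rnDeriv_massMeasure (p := p) hq hq1] with y hy
    rw [hy]

/-- The atomwise inequality is summed; the masses of `p`, `f` and `j` are all 1, and after
cancellation a single 1 remains on the left. -/
lemma klDiv_massMeasure_add_le {p f j : (Fin d → ℕ) → ℝ≥0∞} (hp : ∀ y, p y ≠ 0)
    (hp1 : ∑' y, p y = 1) (hf : ∀ y, f y ≠ 0) (hf1 : ∑' y, f y = 1) (hj : ∀ y, j y ≠ 0)
    (hj1 : ∑' y, j y = 1) :
    InformationTheory.klDiv (massMeasure p) (massMeasure f) + 1 ≤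
      InformationTheory.klDiv (massMeasure p) (massMeasure j) + ∑' y, p y * (j y / f y) := by
  rw [klDiv_massMeasure hp1 hf hf1, klDiv_massMeasure hp1 hj hj1]
  have h := ENNReal.tsum_le_tsum fun y => klTerm_add_le (hp y) (ne_top_of_tsum_eq_one hp1 y) (hf y)
    (ne_top_of_tsum_eq_one hf1 y) (hj y) (ne_top_of_tsum_eq_one hj1 y)
  simp only [ENNReal.tsum_add, hp1, hf1, hj1, ← add_assoc] at h
  exact (ENNReal.add_le_add_iff_right ENNReal.one_ne_top).mp h

lemma klDiv_massMeasure_eq_top {p q : (Fin d → ℕ) → ℝ≥0∞} {y : Fin d → ℕ} (hp : p y ≠ 0)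
    (hq : q y = 0) : InformationTheory.klDiv (massMeasure p) (massMeasure q) = ∞ := by
  refine InformationTheory.klDiv_of_not_ac fun h => hp ?_
  rw [← massMeasure_singleton p]
  exact h (by rw [massMeasure_singleton, hq])

/-! ### The Poisson likelihood -/

lemma poissonLik_pos {t lam : Fin d → ℝ} (ht : ∀ i, 0 < t i) (hl : ∀ i, 0 < lam i)
    (x : Fin d → ℕ) : 0 < poissonLik t lam x :=
  Finset.prod_pos fun i _ => by have := ht i; have := hl i; positivity

lemma ofReal_poissonLik_ne_zero {t lam : Fin d → ℝ} (ht : ∀ i, 0 < t i) (hl : ∀ i, 0 < lam i)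
    (x : Fin d → ℕ) : ENNReal.ofReal (poissonLik t lam x) ≠ 0 := by
  simpa using poissonLik_pos ht hl x

lemma measurable_poissonLik (t : Fin d → ℝ) (x : Fin d → ℕ) :
    Measurable fun lam => poissonLik t lam x := by
  unfold poissonLik
  fun_prop

/-- Law of independent Poisson counts. -/
abbrev poissonPi (t lam : Fin d → ℝ) : Measure (Fin d → ℕ) :=
  Measure.pi fun i => poissonMeasure (t i * lam i).toNNReal

lemma massMeasure_poissonLik {t lam : Fin d → ℝ} (ht : ∀ i, 0 < t i) (hl : ∀ i, 0 < lam i) :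
    massMeasure (fun y => ENNReal.ofReal (poissonLik t lam y)) = poissonPi t lam := by
  refine Measure.ext_of_singleton fun y => ?_
  rw [massMeasure_singleton, Measure.pi_singleton, poissonLik, ENNReal.ofReal_prod_of_nonneg]
  · refine Finset.prod_congr rfl fun i _ => ?_
    rw [poissonMeasure_singleton, Real.coe_toNNReal _ (mul_pos (ht i) (hl i)).le]
  · intro i _
    have := ht i
    have := hl i
    positivity

lemma tsum_poissonLik_mul {t lam : Fin d → ℝ} (ht : ∀ i, 0 < t i) (hl : ∀ i, 0 < lam i)
    (g : (Fin d → ℕ) → ℝ≥0∞) :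
    ∑' x, ENNReal.ofReal (poissonLik t lam x) * g x = ∫⁻ x, g x ∂poissonPi t lam := by
  rw [← massMeasure_poissonLik ht hl, lintegral_massMeasure]

lemma tsum_poissonLik {t lam : Fin d → ℝ} (ht : ∀ i, 0 < t i) (hl : ∀ i, 0 < lam i) :
    ∑' x, ENNReal.ofReal (poissonLik t lam x) = 1 := by
  simpa using tsum_poissonLik_mul ht hl fun _ => 1

/-- The comparison behind both main arguments. An expected ratio `j / f` below 1 makes the risk of
`f` smaller; integrated against a prior, the same inequality shows that Bayesian predictive
distributions minimize the integrated risk. -/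
lemma klRisk_add_le {r s lam : Fin d → ℝ} (hr : ∀ i, 0 < r i) (hs : ∀ i, 0 < s i)
    (hl : ∀ i, 0 < lam i) {f j : (Fin d → ℕ) → (Fin d → ℕ) → ℝ≥0∞} (hf : ∀ x y, f x y ≠ 0)
    (hf1 : IsPredictive f) (hj : ∀ x y, j x y ≠ 0) (hj1 : IsPredictive j) :
    klRisk r s f lam + 1 ≤ klRisk r s j lam +
      ∑' x, ∑' y, ENNReal.ofReal (poissonLik r lam x) * ENNReal.ofReal (poissonLik s lam y) *
        (j x y / f x y) := by
  have h := ENNReal.tsum_le_tsum fun x => mul_le_mul_right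
    (klDiv_massMeasure_add_le (ofReal_poissonLik_ne_zero hs hl) (tsum_poissonLik hs hl) (hf x)
      (hf1 x) (hj x) (hj1 x)) (ENNReal.ofReal (poissonLik r lam x))
  simp only [mul_add, ENNReal.tsum_add, mul_one, tsum_poissonLik hr hl] at h
  simpa only [klRisk, klLoss, mul_assoc, ENNReal.tsum_mul_left] using h

/-! ### Bayesian predictive distributions -/

/-- The parameter space. -/
def orthant (d : ℕ) : Set (Fin d → ℝ) := {lam | ∀ i, 0 < lam i}

lemma measurableSet_orthant : MeasurableSet (orthant d) := by
  have : orthant d = ⋂ i, {lam | 0 < lam i} := by ext; simp [orthant]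
  rw [this]
  exact MeasurableSet.iInter fun i => measurableSet_lt measurable_const (measurable_pi_apply i)

/-- Marginal likelihood of the observation. -/
def marginal (r : Fin d → ℝ) (w : (Fin d → ℝ) → ℝ≥0∞) (x : Fin d → ℕ) : ℝ≥0∞ :=
  ∫⁻ lam in orthant d, ENNReal.ofReal (poissonLik r lam x) * w lam

/-- Joint marginal likelihood of observation and target. -/
def jointMarginal (r s : Fin d → ℝ) (w : (Fin d → ℝ) → ℝ≥0∞) (x y : Fin d → ℕ) : ℝ≥0∞ :=
  ∫⁻ lam in orthant d,
    ENNReal.ofReal (poissonLik r lam x) * ENNReal.ofReal (poissonLik s lam y) * w lam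

lemma bayesPredictive_eq (r s : Fin d → ℝ) (w : (Fin d → ℝ) → ℝ≥0∞) (x y : Fin d → ℕ) :
    bayesPredictive r s w x y = jointMarginal r s w x y / marginal r w x := rfl

lemma tsum_jointMarginal {r s : Fin d → ℝ} (hs : ∀ i, 0 < s i) {w : (Fin d → ℝ) → ℝ≥0∞}
    (hw : Measurable w) (x : Fin d → ℕ) : ∑' y, jointMarginal r s w x y = marginal r w x := by
  have hm : ∀ y : Fin d → ℕ, Measurable fun lam : Fin d → ℝ =>
      ENNReal.ofReal (poissonLik r lam x) * ENNReal.ofReal (poissonLik s lam y) * w lam :=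
    fun y => ((measurable_poissonLik r x).ennreal_ofReal.fun_mul
      (measurable_poissonLik s y).ennreal_ofReal).fun_mul hw
  simp only [jointMarginal]
  rw [← lintegral_tsum fun y => (hm y).aemeasurable]
  refine setLIntegral_congr_fun measurableSet_orthant fun lam hl => ?_
  simp only [mul_assoc]
  rw [ENNReal.tsum_mul_left, ENNReal.tsum_mul_right, tsum_poissonLik hs hl, one_mul]

lemma isPredictive_bayesPredictive {r s : Fin d → ℝ} (hs : ∀ i, 0 < s i)
    {w : (Fin d → ℝ) → ℝ≥0∞} (hw : Measurable w) (h0 : ∀ x, marginal r w x ≠ 0)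
    (htop : ∀ x, marginal r w x ≠ ∞) : IsPredictive (bayesPredictive r s w) := by
  intro x
  simp only [bayesPredictive_eq, div_eq_mul_inv]
  rw [ENNReal.tsum_mul_right, tsum_jointMarginal hs hw, ENNReal.mul_inv_cancel (h0 x) (htop x)]

lemma bayesPredictive_ne_zero {r s : Fin d → ℝ} (hr : ∀ i, 0 < r i) (hs : ∀ i, 0 < s i)
    {w : (Fin d → ℝ) → ℝ≥0∞} (hw : Measurable w) (h0 : ∀ x, marginal r w x ≠ 0)
    (htop : ∀ x, marginal r w x ≠ ∞) (x y : Fin d → ℕ) : bayesPredictive r s w x y ≠ 0 := by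
  rw [bayesPredictive_eq]
  refine ENNReal.div_ne_zero.mpr ⟨fun h => h0 x ?_, htop x⟩
  rw [jointMarginal, lintegral_eq_zero_iff (((measurable_poissonLik r x).ennreal_ofReal.fun_mul
      (measurable_poissonLik s y).ennreal_ofReal).fun_mul hw)] at h
  rw [marginal, lintegral_eq_zero_iff ((measurable_poissonLik r x).ennreal_ofReal.fun_mul hw)]
  filter_upwards [h, ae_restrict_mem measurableSet_orthant] with lam h1 hl
  have := ofReal_poissonLik_ne_zero hr hl x
  have := ofReal_poissonLik_ne_zero hs hl y
  simp_all

/-- The Bayesian predictive distribution minimizes the integrated risk. -/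
lemma lintegral_klRisk_bayesPredictive_le {r s : Fin d → ℝ} (hr : ∀ i, 0 < r i)
    (hs : ∀ i, 0 < s i) {w : (Fin d → ℝ) → ℝ≥0∞} (hw : Measurable w)
    (h0 : ∀ x, marginal r w x ≠ 0) (htop : ∀ x, marginal r w x ≠ ∞)
    (hfin : ∫⁻ lam in orthant d, w lam ≠ ∞) {q : (Fin d → ℕ) → (Fin d → ℕ) → ℝ≥0∞}
    (hq : ∀ x y, q x y ≠ 0) (hq1 : IsPredictive q) :
    ∫⁻ lam in orthant d, klRisk r s (bayesPredictive r s w) lam * w lam ≤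
      ∫⁻ lam in orthant d, klRisk r s q lam * w lam := by
  set B := bayesPredictive r s w with hB
  have hB0 := bayesPredictive_ne_zero hr hs hw h0 htop
  have hB1 := isPredictive_bayesPredictive hs hw h0 htop
  have hm : ∀ x y : Fin d → ℕ, Measurable fun lam : Fin d → ℝ =>
      ENNReal.ofReal (poissonLik r lam x) * ENNReal.ofReal (poissonLik s lam y) :=
    fun x y => (measurable_poissonLik r x).ennreal_ofReal.fun_mul
      (measurable_poissonLik s y).ennreal_ofReal
  set E : (Fin d → ℝ) → ℝ≥0∞ := fun lam => ∑' x, ∑' y, ENNReal.ofReal (poissonLik r lam x) *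
    ENNReal.ofReal (poissonLik s lam y) * (q x y / B x y) with hE
  have hEm : Measurable E :=
    Measurable.tsum fun x => Measurable.tsum fun y => (hm x y).mul_const _
  -- Under the prior the expected ratio averages to 1: the joint marginal is `B x y` times the
  -- marginal of x, so the ratio replaces `B x y` by `q x y`, which also sums to 1 over y.
  have hsum : ∫⁻ lam in orthant d, E lam * w lam = ∫⁻ lam in orthant d, w lam := by
    have h1 : ∀ lam, E lam * w lam = ∑' x, ∑' y, (q x y / B x y) *
        (ENNReal.ofReal (poissonLik r lam x) * ENNReal.ofReal (poissonLik s lam y) * w lam) := by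
      intro lam
      simp only [hE, ← ENNReal.tsum_mul_right]
      refine tsum_congr fun x => tsum_congr fun y => ?_
      ring
    simp only [h1]
    rw [lintegral_tsum fun x => (Measurable.tsum fun y =>
      ((hm x y).fun_mul hw).const_mul _).aemeasurable]
    have h2 : ∀ x, ∫⁻ lam in orthant d, ∑' y, (q x y / B x y) *
        (ENNReal.ofReal (poissonLik r lam x) * ENNReal.ofReal (poissonLik s lam y) * w lam)
        = marginal r w x := by
      intro x
      rw [lintegral_tsum fun y => (((hm x y).fun_mul hw).const_mul _).aemeasurable]
      have h3 : ∀ y, ∫⁻ lam in orthant d, (q x y / B x y) *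
          (ENNReal.ofReal (poissonLik r lam x) * ENNReal.ofReal (poissonLik s lam y) * w lam)
          = q x y * marginal r w x := by
        intro y
        rw [lintegral_const_mul _ ((hm x y).fun_mul hw)]
        have : jointMarginal r s w x y = B x y * marginal r w x := by
          rw [hB, bayesPredictive_eq, ENNReal.div_mul_cancel (h0 x) (htop x)]
        rw [jointMarginal] at this
        rw [this, ← mul_assoc, ENNReal.div_mul_cancel (hB0 x y) (ne_top_of_tsum_eq_one (hB1 x) y)]
      simp only [h3]
      rw [ENNReal.tsum_mul_right, hq1 x, one_mul]
    simp only [h2]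
    simp only [marginal]
    rw [← lintegral_tsum fun x =>
      ((measurable_poissonLik r x).ennreal_ofReal.fun_mul hw).aemeasurable]
    refine setLIntegral_congr_fun measurableSet_orthant fun lam hl => ?_
    rw [ENNReal.tsum_mul_right, tsum_poissonLik hr hl, one_mul]
  -- The prior mass appears on both sides and can be cancelled because it is finite; this is where
  -- properness of the prior enters.
  refine (ENNReal.add_le_add_iff_right hfin).mp ?_
  calc (∫⁻ lam in orthant d, klRisk r s B lam * w lam) + ∫⁻ lam in orthant d, w lam
      = ∫⁻ lam in orthant d, (klRisk r s B lam * w lam + w lam) :=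
        (lintegral_add_right _ hw).symm
    _ ≤ ∫⁻ lam in orthant d, (klRisk r s q lam * w lam + E lam * w lam) := by
        refine setLIntegral_mono' measurableSet_orthant fun lam hl => ?_
        calc klRisk r s B lam * w lam + w lam = (klRisk r s B lam + 1) * w lam := by ring
          _ ≤ (klRisk r s q lam + E lam) * w lam :=
            mul_le_mul_left (klRisk_add_le hr hs hl hB0 hB1 hq hq1) _
          _ = _ := by ring
    _ = (∫⁻ lam in orthant d, klRisk r s q lam * w lam) + ∫⁻ lam in orthant d, w lam := by
        rw [lintegral_add_right _ (hEm.fun_mul hw), hsum]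

/-- The supremum of the risk is at least the integrated risk of a Bayesian predictive
distribution divided by the total mass of the prior. -/
lemma lintegral_klRisk_le_iSup_mul {r s : Fin d → ℝ} (hr : ∀ i, 0 < r i)
    (hs : ∀ i, 0 < s i) {w : (Fin d → ℝ) → ℝ≥0∞} (hw : Measurable w)
    (h0 : ∀ x, marginal r w x ≠ 0) (htop : ∀ x, marginal r w x ≠ ∞)
    (hfin : ∫⁻ lam in orthant d, w lam ≠ ∞) {q : (Fin d → ℕ) → (Fin d → ℕ) → ℝ≥0∞}
    (hq : ∀ x y, q x y ≠ 0) (hq1 : IsPredictive q) :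
    ∫⁻ lam in orthant d, klRisk r s (bayesPredictive r s w) lam * w lam ≤
      (⨆ (lam : Fin d → ℝ) (_ : ∀ i, 0 < lam i), klRisk r s q lam) *
        ∫⁻ lam in orthant d, w lam := by
  refine (lintegral_klRisk_bayesPredictive_le hr hs hw h0 htop hfin hq hq1).trans ?_
  rw [← lintegral_const_mul _ hw]
  refine setLIntegral_mono' measurableSet_orthant fun lam hl => mul_le_mul_left ?_ _
  exact le_iSup₂ (f := fun (lam : Fin d → ℝ) (_ : ∀ i, 0 < lam i) => klRisk r s q lam) lam hl

/-- The Poisson laws charge every count vector, so a single vanishing predictive probability makes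
the risk infinite. Hence the minimax argument may assume `q` positive. -/
lemma klRisk_eq_top {r s lam : Fin d → ℝ} (hr : ∀ i, 0 < r i) (hs : ∀ i, 0 < s i)
    (hl : ∀ i, 0 < lam i) {q : (Fin d → ℕ) → (Fin d → ℕ) → ℝ≥0∞} {x y : Fin d → ℕ}
    (hq : q x y = 0) : klRisk r s q lam = ∞ := by
  refine ENNReal.tsum_eq_top_of_eq_top ⟨x, ?_⟩
  rw [klLoss, klDiv_massMeasure_eq_top (ofReal_poissonLik_ne_zero hs hl y) hq]
  exact ENNReal.mul_top (ofReal_poissonLik_ne_zero hr hl x)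

/-! ### Integrals of products -/

lemma lintegral_pi_prod {d : ℕ} {X : Type*} [MeasurableSpace X] (μ : Fin d → Measure X)
    [∀ i, SigmaFinite (μ i)] {f : Fin d → X → ℝ≥0∞} (hf : ∀ i, Measurable (f i)) :
    ∫⁻ x, ∏ i, f i (x i) ∂Measure.pi μ = ∏ i, ∫⁻ x, f i x ∂μ i := by
  induction d with
  | zero => simp
  | succ d ih =>
    have hmp := (measurePreserving_piFinSuccAbove μ 0).symm
    rw [← hmp.lintegral_comp_emb (MeasurableEquiv.measurableEmbedding _), Fin.prod_univ_succ]
    simp only [MeasurableEquiv.piFinSuccAbove_symm_apply, Fin.insertNthEquiv,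
      Fin.prod_univ_succ, Equiv.coe_fn_mk, Fin.insertNth_zero', Fin.cons_zero, Fin.cons_succ]
    rw [← ih (fun i => μ i.succ) fun i => hf i.succ]
    exact lintegral_prod_mul (hf 0).aemeasurable
      (Finset.measurable_fun_prod _ fun (i : Fin d) _ => (hf i.succ).comp (measurable_pi_apply i)).aemeasurable

lemma restrict_orthant {d : ℕ} :
    (volume : Measure (Fin d → ℝ)).restrict (orthant d)
      = Measure.pi fun _ => (volume : Measure ℝ).restrict (Set.Ioi 0) := by
  rw [← Measure.restrict_pi_pi]
  congr 1
  ext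
  simp [orthant]

lemma lintegral_orthant_prod {d : ℕ} {f : Fin d → ℝ → ℝ≥0∞} (hf : ∀ i, Measurable (f i)) :
    ∫⁻ x in orthant d, ∏ i, f i (x i) = ∏ i, ∫⁻ x in Set.Ioi 0, f i x := by
  rw [restrict_orthant]
  exact lintegral_pi_prod _ hf

lemma lintegral_rpow_mul_exp {a c : ℝ} (ha : 0 < a) (hc : 0 < c) :
    ∫⁻ t in Set.Ioi 0, ENNReal.ofReal (t ^ (a - 1) * Real.exp (-(c * t)))
      = ENNReal.ofReal (Real.Gamma a / c ^ a) := by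
  have h := Real.integral_rpow_mul_exp_neg_mul_Ioi ha hc
  have hpos : 0 < (1 / c) ^ a * Real.Gamma a :=
    mul_pos (by positivity) (Real.Gamma_pos_of_pos ha)
  rw [← ofReal_integral_eq_lintegral_ofReal, h]
  · congr 1
    rw [Real.div_rpow zero_le_one hc.le, Real.one_rpow]
    ring
  · exact Integrable.of_integral_ne_zero (by rw [h]; exact hpos.ne')
  · filter_upwards [ae_restrict_mem measurableSet_Ioi] with t ht
    have : (0 : ℝ) < t := ht
    positivity

/-! ### Jeffreys prior with exponential damping -/


/-- The density `∏ lam_i^{-1/2} e^{-b lam_i}`; Jeffreys prior for `b = 0`. -/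
def dampedJeffreys (b : ℝ) (lam : Fin d → ℝ) : ℝ≥0∞ :=
  jeffreysPrior lam * ENNReal.ofReal (∏ i, Real.exp (-(b * lam i)))

lemma dampedJeffreys_zero : dampedJeffreys 0 = (jeffreysPrior : (Fin d → ℝ) → ℝ≥0∞) := by
  ext lam
  simp [dampedJeffreys]

lemma measurable_jeffreysPrior : Measurable (jeffreysPrior : (Fin d → ℝ) → ℝ≥0∞) := by
  unfold jeffreysPrior
  fun_prop

lemma measurable_dampedJeffreys (b : ℝ) :
    Measurable (dampedJeffreys b : (Fin d → ℝ) → ℝ≥0∞) := by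
  unfold dampedJeffreys
  exact measurable_jeffreysPrior.mul (by fun_prop)

lemma lintegral_orthant_monomial {a c : Fin d → ℝ} (ha : ∀ i, 0 < a i) (hc : ∀ i, 0 < c i) :
    ∫⁻ lam in orthant d, ENNReal.ofReal (∏ i, (lam i ^ (a i - 1) * Real.exp (-(c i * lam i))))
      = ENNReal.ofReal (∏ i, (Real.Gamma (a i) / c i ^ a i)) := by
  rw [ENNReal.ofReal_prod_of_nonneg fun i _ =>
    (div_pos (Real.Gamma_pos_of_pos (ha i)) (Real.rpow_pos_of_pos (hc i) _)).le]
  simp only [← lintegral_rpow_mul_exp (ha _) (hc _)]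
  rw [← lintegral_orthant_prod (f := fun i t =>
    ENNReal.ofReal (t ^ (a i - 1) * Real.exp (-(c i * t)))) (by fun_prop)]
  refine setLIntegral_congr_fun measurableSet_orthant fun lam hl => ?_
  refine ENNReal.ofReal_prod_of_nonneg fun i _ => ?_
  have := hl i
  positivity

/-- The constant `t^x / x!`. -/
def countConst (t : Fin d → ℝ) (x : Fin d → ℕ) : ℝ := ∏ i, t i ^ x i / ((x i).factorial : ℝ)

lemma poissonLik_eq_const_mul (t lam : Fin d → ℝ) (x : Fin d → ℕ) :
    poissonLik t lam x = countConst t x *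
      ∏ i, (lam i ^ x i * Real.exp (-(t i * lam i))) := by
  rw [poissonLik, countConst, ← Finset.prod_mul_distrib]
  refine Finset.prod_congr rfl fun i _ => ?_
  rw [mul_pow]
  ring

lemma countConst_pos {t : Fin d → ℝ} (ht : ∀ i, 0 < t i) (x : Fin d → ℕ) : 0 < countConst t x :=
  Finset.prod_pos fun i _ => by have := ht i; positivity

/-- The normalizing constant of the Gamma densities with shapes `z + 1/2` and rates `t`. -/
def gammaConst (t : Fin d → ℝ) (z : Fin d → ℕ) : ℝ :=
  ∏ i, Real.Gamma ((z i : ℝ) + 1 / 2) / t i ^ ((z i : ℝ) + 1 / 2)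

lemma gammaConst_pos {t : Fin d → ℝ} (ht : ∀ i, 0 < t i) (x : Fin d → ℕ) : 0 < gammaConst t x :=
  Finset.prod_pos fun i _ =>
    div_pos (Real.Gamma_pos_of_pos (by positivity)) (Real.rpow_pos_of_pos (ht i) _)

lemma dampedJeffreys_eq {lam : Fin d → ℝ} (hl : ∀ i, 0 < lam i) (b : ℝ) :
    dampedJeffreys b lam
      = ENNReal.ofReal (∏ i, (lam i ^ (-(1 / 2) : ℝ) * Real.exp (-(b * lam i)))) := by
  rw [dampedJeffreys, jeffreysPrior, ← ENNReal.ofReal_mul, Finset.prod_mul_distrib]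
  exact Finset.prod_nonneg fun i _ => Real.rpow_nonneg (hl i).le _

lemma pow_mul_rpow_neg_half {u : ℝ} (hu : 0 < u) (n : ℕ) :
    u ^ n * u ^ (-(1 / 2) : ℝ) = u ^ ((n : ℝ) + 1 / 2 - 1) := by
  rw [← Real.rpow_natCast, ← Real.rpow_add hu]
  congr 1
  ring

/-- Gamma conjugacy: the likelihood times the prior is a monomial in λ_i of exponent x_i - 1/2 times
an exponential of rate r_i + b. -/
lemma marginal_dampedJeffreys {r : Fin d → ℝ} (hr : ∀ i, 0 < r i) {b : ℝ} (hb : 0 ≤ b)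
    (x : Fin d → ℕ) : marginal r (dampedJeffreys b) x
      = ENNReal.ofReal (countConst r x * gammaConst (fun i => r i + b) x) := by
  rw [ENNReal.ofReal_mul (countConst_pos hr x).le, gammaConst,
    ← lintegral_orthant_monomial (fun i => by positivity) (fun i => add_pos_of_pos_of_nonneg (hr i) hb),
    ← lintegral_const_mul _ (by fun_prop), marginal]
  refine setLIntegral_congr_fun measurableSet_orthant fun lam hl => ?_
  rw [dampedJeffreys_eq hl, ← ENNReal.ofReal_mul (poissonLik_pos hr hl x).le,
    ← ENNReal.ofReal_mul (countConst_pos hr x).le, poissonLik_eq_const_mul, mul_assoc,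
    ← Finset.prod_mul_distrib]
  congr 2
  refine Finset.prod_congr rfl fun i _ => ?_
  rw [← pow_mul_rpow_neg_half (hl i), add_mul, neg_add, Real.exp_add]
  ring

lemma jointMarginal_dampedJeffreys {r s : Fin d → ℝ} (hr : ∀ i, 0 < r i) (hs : ∀ i, 0 < s i)
    {b : ℝ} (hb : 0 ≤ b) (x y : Fin d → ℕ) : jointMarginal r s (dampedJeffreys b) x y
      = ENNReal.ofReal (countConst r x * countConst s y *
          gammaConst (fun i => r i + s i + b) (x + y)) := by
  have hc := mul_pos (countConst_pos hr x) (countConst_pos hs y)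
  rw [ENNReal.ofReal_mul hc.le, gammaConst, ← lintegral_orthant_monomial (fun i => by positivity)
      (fun i => add_pos_of_pos_of_nonneg (add_pos (hr i) (hs i)) hb),
    ← lintegral_const_mul _ (by fun_prop), jointMarginal]
  refine setLIntegral_congr_fun measurableSet_orthant fun lam hl => ?_
  rw [dampedJeffreys_eq hl, ← ENNReal.ofReal_mul (poissonLik_pos hr hl x).le,
    ← ENNReal.ofReal_mul (mul_pos (poissonLik_pos hr hl x) (poissonLik_pos hs hl y)).le,
    ← ENNReal.ofReal_mul hc.le, poissonLik_eq_const_mul, poissonLik_eq_const_mul,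
    mul_mul_mul_comm, mul_assoc, ← Finset.prod_mul_distrib, ← Finset.prod_mul_distrib]
  congr 2
  refine Finset.prod_congr rfl fun i _ => ?_
  rw [← pow_mul_rpow_neg_half (hl i), add_mul, add_mul, neg_add, neg_add, Real.exp_add,
    Real.exp_add, Pi.add_apply, pow_add]
  ring

lemma bayesPredictive_dampedJeffreys {r s : Fin d → ℝ} (hr : ∀ i, 0 < r i) (hs : ∀ i, 0 < s i)
    {b : ℝ} (hb : 0 ≤ b) (x y : Fin d → ℕ) : bayesPredictive r s (dampedJeffreys b) x y
      = ENNReal.ofReal (countConst s y * gammaConst (fun i => r i + s i + b) (x + y) /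
          gammaConst (fun i => r i + b) x) := by
  have h1 := countConst_pos hr x
  have h2 := gammaConst_pos (t := fun i => r i + b)
    (fun i => add_pos_of_pos_of_nonneg (hr i) hb) x
  rw [bayesPredictive_eq, jointMarginal_dampedJeffreys hr hs hb, marginal_dampedJeffreys hr hb,
    ← ENNReal.ofReal_div_of_pos (by positivity)]
  congr 1
  field_simp

/-! ### Risk of the predictive distributions based on damped Jeffreys priors -/

lemma integrable_poissonMeasure_of_expBounded {g : ℕ → ℝ} (hg : ExpBounded g) (μ : NNReal) :
    Integrable g (poissonMeasure μ) := by
  rw [integrable_poissonMeasure_iff]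
  have h : ExpBounded fun n => |g n| := by
    obtain ⟨C, hC⟩ := hg
    exact ⟨C, fun n => by rw [abs_abs]; exact hC n⟩
  exact summable_poissonMean h μ

lemma integral_poissonMeasure_toNNReal (g : ℕ → ℝ) {μ : ℝ} (hμ : 0 ≤ μ) :
    ∫ n, g n ∂poissonMeasure μ.toNNReal = poissonMean μ g := by
  rw [integral_poissonMeasure, Real.coe_toNNReal _ hμ]
  rfl

/-- A sum of independent Poisson variables is Poisson. This evaluates the mean of log Γ(x + y +
1/2), the only term of the loss that couples x and y nonlinearly. -/
lemma integrable_conv_poissonMean {g : ℕ → ℝ} (hg : ExpBounded g) {μ ν : ℝ} (hμ : 0 ≤ μ)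
    (hν : 0 ≤ ν) :
    Integrable (fun x => ∫ y, g (x + y) ∂poissonMeasure ν.toNNReal) (poissonMeasure μ.toNNReal) ∧
    ∫ x, ∫ y, g (x + y) ∂poissonMeasure ν.toNNReal ∂poissonMeasure μ.toNNReal
      = poissonMean (μ + ν) g := by
  have h := integrable_poissonMeasure_of_expBounded hg (μ + ν).toNNReal
  have e := poissonMeasure_conv_poissonMeasure μ.toNNReal ν.toNNReal
  rw [← Real.toNNReal_add hμ hν] at e
  rw [← integral_poissonMeasure_toNNReal g (add_nonneg hμ hν), ← e]
  rw [← e] at h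
  refine ⟨?_, (integral_conv h).symm⟩
  rw [Measure.conv, integrable_map_measure (measurable_of_countable _).aestronglyMeasurable
    (by fun_prop)] at h
  exact h.integral_prod_left


/-- Coordinate contribution to `log (p(y ∣ lam) / q(y ∣ x))`. -/
def logRatio (r s b lam : ℝ) (x y : ℕ) : ℝ :=
  -(s * lam) + y * Real.log lam - logGammaHalf (x + y) + logGammaHalf x
    - ((x : ℝ) + 1 / 2) * Real.log (r + b) + ((x : ℝ) + y + 1 / 2) * Real.log (r + s + b)

/-- Coordinate contribution to the Kullback–Leibler loss. -/
def coordLoss (r s b lam : ℝ) (x : ℕ) : ℝ :=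
  ∫ y, logRatio r s b lam x y ∂poissonMeasure (s * lam).toNNReal

/-- Coordinate contribution to the Kullback–Leibler risk. -/
def coordRisk (r s b lam : ℝ) : ℝ :=
  (jeffreysPotential ((r + s) * lam) - jeffreysPotential (r * lam))
    + 1 / 2 * Real.log ((r + s + b) / (r + b))
    + (r + s) * lam * Real.log ((r + s + b) / (r + s)) - r * lam * Real.log ((r + b) / r)

lemma integrable_logRatio (r s b lam : ℝ) (x : ℕ) (μ : NNReal) :
    Integrable (logRatio r s b lam x) (poissonMeasure μ) := by
  refine integrable_poissonMeasure_of_expBounded ?_ μ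
  have h1 : ExpBounded fun y => logGammaHalf (x + y) := by
    simpa only [add_comm] using expBounded_logGammaHalf.comp_add x
  have h2 := ((expBounded_const (-(s * lam) + logGammaHalf x
    - ((x : ℝ) + 1 / 2) * Real.log (r + b) + ((x : ℝ) + 1 / 2) * Real.log (r + s + b))).add
    (expBounded_natCast.const_mul (Real.log lam + Real.log (r + s + b)))).sub h1
  convert h2 using 2 with y
  rw [logRatio]
  ring

/-- Apart from the two log Γ terms, the averaged loss is affine in x. The means of log Γ at (r+s)λ
and rλ combine with the μ log μ - μ contributions into a difference of `jeffreysPotential`; the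
terms involving `b` measure the departure from the Jeffreys prior. -/
lemma coordLoss_integral {r s b lam : ℝ} (hr : 0 < r) (hs : 0 < s) (hb : 0 ≤ b) (hl : 0 < lam) :
    Integrable (coordLoss r s b lam) (poissonMeasure (r * lam).toNNReal) ∧
      ∫ x, coordLoss r s b lam x ∂poissonMeasure (r * lam).toNNReal = coordRisk r s b lam := by
  have hrl := (mul_pos hr hl).le
  have hsl := (mul_pos hs hl).le
  obtain ⟨hI, hV⟩ := integrable_conv_poissonMean expBounded_logGammaHalf hrl hsl
  set L1 := Real.log (r + b)
  set L2 := Real.log (r + s + b)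
  have e : ∀ x : ℕ, coordLoss r s b lam x =
      (-(s * lam) + s * lam * (Real.log lam + L2) - 1 / 2 * L1 + 1 / 2 * L2)
        + (L2 - L1) * (x : ℝ) + logGammaHalf x
        - ∫ y, logGammaHalf (x + y) ∂poissonMeasure (s * lam).toNNReal := by
    intro x
    have hg : ExpBounded fun y => logGammaHalf (x + y) := by
      simpa only [add_comm] using expBounded_logGammaHalf.comp_add x
    have i1 := integrable_poissonMeasure_of_expBounded (expBounded_const (-(s * lam) + logGammaHalf x
      - ((x : ℝ) + 1 / 2) * L1 + ((x : ℝ) + 1 / 2) * L2)) (s * lam).toNNReal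
    have i2 := integrable_poissonMeasure_of_expBounded
      (expBounded_natCast.const_mul (Real.log lam + L2)) (s * lam).toNNReal
    have i3 := integrable_poissonMeasure_of_expBounded hg (s * lam).toNNReal
    have : ∀ y : ℕ, logRatio r s b lam x y = (-(s * lam) + logGammaHalf x
      - ((x : ℝ) + 1 / 2) * L1 + ((x : ℝ) + 1 / 2) * L2) + (Real.log lam + L2) * (y : ℝ)
      - logGammaHalf (x + y) := by
      intro y
      rw [logRatio]
      ring
    simp only [coordLoss, this]
    rw [integral_sub (i1.fun_add i2) i3, integral_add i1 i2,
      integral_poissonMeasure_toNNReal _ hsl, integral_poissonMeasure_toNNReal _ hsl,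
      poissonMean_const, poissonMean_const_mul, poissonMean_natCast]
    ring
  have j1 := integrable_poissonMeasure_of_expBounded (expBounded_const
    (-(s * lam) + s * lam * (Real.log lam + L2) - 1 / 2 * L1 + 1 / 2 * L2)) (r * lam).toNNReal
  have j2 := integrable_poissonMeasure_of_expBounded
      (expBounded_natCast.const_mul (L2 - L1)) (r * lam).toNNReal
  have j3 := integrable_poissonMeasure_of_expBounded expBounded_logGammaHalf (r * lam).toNNReal
  have ef : coordLoss r s b lam = fun x => _ := funext e
  rw [ef]
  refine ⟨((j1.add j2).add j3).sub hI, ?_⟩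
  simp only
  rw [integral_sub ((j1.fun_add j2).fun_add j3) hI, hV, integral_add (j1.fun_add j2) j3, integral_add j1 j2,
    integral_poissonMeasure_toNNReal _ hrl, integral_poissonMeasure_toNNReal _ hrl,
    integral_poissonMeasure_toNNReal _ hrl, poissonMean_const, poissonMean_const_mul,
    poissonMean_natCast, coordRisk, jeffreysPotential, jeffreysPotential,
    Real.log_div (by positivity) (by positivity), Real.log_div (by positivity) (by positivity),
    Real.log_div (by positivity) (by positivity), Real.log_mul (by positivity) hl.ne',
    Real.log_mul hr.ne' hl.ne', ← add_mul]
  ring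

lemma log_poissonLik_div {r s lam : Fin d → ℝ} (hr : ∀ i, 0 < r i) (hs : ∀ i, 0 < s i) {b : ℝ}
    (hb : 0 ≤ b) (hl : ∀ i, 0 < lam i) (x y : Fin d → ℕ) :
    Real.log (poissonLik s lam y / (countConst s y * gammaConst (fun i => r i + s i + b) (x + y) /
      gammaConst (fun i => r i + b) x)) = ∑ i, logRatio (r i) (s i) b (lam i) (x i) (y i) := by
  have hG : ∀ n : ℕ, 0 < Real.Gamma ((n : ℝ) + 1 / 2) := fun n =>
    Real.Gamma_pos_of_pos (by positivity)
  rw [poissonLik, countConst, gammaConst, gammaConst, ← Finset.prod_mul_distrib,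
    ← Finset.prod_div_distrib, ← Finset.prod_div_distrib, Real.log_prod]
  · refine Finset.sum_congr rfl fun i _ => ?_
    have h1 := hr i
    have h2 := hs i
    have h3 := hl i
    have g1 := hG (x i)
    have g2 := hG ((x + y) i)
    have c1 : 0 < r i + b := by positivity
    have c2 : 0 < r i + s i + b := by positivity
    rw [Real.log_div (by positivity) (by positivity), Real.log_div (by positivity) (by positivity),
      Real.log_mul (by positivity) (by positivity), Real.log_div (by positivity) (by positivity),
      Real.log_mul (by positivity) (by positivity), Real.log_div (by positivity) (by positivity),
      Real.log_div (by positivity) (by positivity), Real.log_div (by positivity) (by positivity),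
      Real.log_exp, Real.log_pow, Real.log_pow, Real.log_mul h2.ne' h3.ne', Real.log_rpow c1,
      Real.log_rpow c2, logRatio, logGammaHalf, logGammaHalf, Pi.add_apply, Nat.cast_add]
    ring
  · intro i _
    have h1 := hr i
    have h2 := hs i
    have h3 := hl i
    have g1 := hG (x i)
    have g2 := hG ((x + y) i)
    have c1 : 0 < r i + b := by positivity
    have c2 : 0 < r i + s i + b := by positivity
    positivity

lemma klLoss_dampedJeffreys {r s lam : Fin d → ℝ} (hr : ∀ i, 0 < r i) (hs : ∀ i, 0 < s i) {b : ℝ}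
    (hb : 0 ≤ b) (hl : ∀ i, 0 < lam i)
    (h1 : IsPredictive (bayesPredictive r s (dampedJeffreys b))) (x : Fin d → ℕ) :
    0 ≤ ∑ i, coordLoss (r i) (s i) b (lam i) (x i) ∧
    klLoss s (bayesPredictive r s (dampedJeffreys b)) lam x
      = ENNReal.ofReal (∑ i, coordLoss (r i) (s i) b (lam i) (x i)) := by
  set q := bayesPredictive r s (dampedJeffreys b) x with hq
  have hqpos : ∀ y, 0 < countConst s y * gammaConst (fun i => r i + s i + b) (x + y) /
      gammaConst (fun i => r i + b) x := fun y => by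
    have := countConst_pos hs y
    have := gammaConst_pos (t := fun i => r i + s i + b)
      (fun i => add_pos_of_pos_of_nonneg (add_pos (hr i) (hs i)) hb) (x + y)
    have := gammaConst_pos (t := fun i => r i + b)
      (fun i => add_pos_of_pos_of_nonneg (hr i) hb) x
    positivity
  have hqv : ∀ y, q y = ENNReal.ofReal (countConst s y *
      gammaConst (fun i => r i + s i + b) (x + y) / gammaConst (fun i => r i + b) x) :=
    bayesPredictive_dampedJeffreys hr hs hb x
  have hq0 : ∀ y, q y ≠ 0 := fun y => by rw [hqv]; simpa using hqpos y
  set p : (Fin d → ℕ) → ℝ≥0∞ := fun y => ENNReal.ofReal (poissonLik s lam y) with hp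
  have hp1 : ∑' y, p y = 1 := tsum_poissonLik hs hl
  have := isProbabilityMeasure_massMeasure hp1
  have := isProbabilityMeasure_massMeasure (h1 x)
  have hac : massMeasure p ≪ massMeasure q := massMeasure_absolutelyContinuous hq0 (h1 x)
  have hpi : massMeasure p = poissonPi s lam := massMeasure_poissonLik hs hl
  have hllr : llr (massMeasure p) (massMeasure q) =ᵐ[massMeasure p]
      fun y => ∑ i, logRatio (r i) (s i) b (lam i) (x i) (y i) := by
    filter_upwards [hac.ae_le (rnDeriv_massMeasure (p := p) hq0 (h1 x))] with y hy
    rw [llr_def]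
    simp only
    rw [hy, hqv, hp, ← ENNReal.ofReal_div_of_pos (hqpos y),
      ENNReal.toReal_ofReal (div_pos (poissonLik_pos hs hl y) (hqpos y)).le,
      log_poissonLik_div hr hs hb hl]
  have hint : ∀ i, Integrable (fun y : Fin d → ℕ => logRatio (r i) (s i) b (lam i) (x i) (y i))
      (poissonPi s lam) := fun i =>
    integrable_comp_eval (integrable_logRatio (r i) (s i) b (lam i) (x i) _)
  have hintllr : Integrable (llr (massMeasure p) (massMeasure q)) (massMeasure p) := by
    rw [integrable_congr hllr, hpi]
    exact integrable_finsetSum _ fun i _ => hint i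
  have hval : ∫ y, llr (massMeasure p) (massMeasure q) y ∂massMeasure p
      = ∑ i, coordLoss (r i) (s i) b (lam i) (x i) := by
    rw [integral_congr_ae hllr, hpi, integral_finsetSum _ fun i _ => hint i]
    refine Finset.sum_congr rfl fun i _ => ?_
    exact integral_comp_eval (μ := fun i => poissonMeasure (s i * lam i).toNNReal)
      (integrable_logRatio (r i) (s i) b (lam i) (x i) _).aestronglyMeasurable
  have hn := InformationTheory.integral_llr_add_sub_measure_univ_nonneg hac hintllr
  have hk := InformationTheory.klDiv_of_ac_of_integrable hac hintllr
  simp only [probReal_univ, add_sub_cancel_right, hval] at hn hk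
  exact ⟨hn, hk⟩

lemma isPredictive_dampedJeffreys {r s : Fin d → ℝ} (hr : ∀ i, 0 < r i) (hs : ∀ i, 0 < s i)
    {b : ℝ} (hb : 0 ≤ b) : IsPredictive (bayesPredictive r s (dampedJeffreys b)) := by
  refine isPredictive_bayesPredictive hs (measurable_dampedJeffreys b) (fun x => ?_) fun x => ?_
  · rw [marginal_dampedJeffreys hr hb]
    have := mul_pos (countConst_pos hr x) (gammaConst_pos (t := fun i => r i + b)
      (fun i => add_pos_of_pos_of_nonneg (hr i) hb) x)
    simpa using this
  · rw [marginal_dampedJeffreys hr hb]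
    exact ENNReal.ofReal_ne_top

lemma klRisk_dampedJeffreys {r s lam : Fin d → ℝ} (hr : ∀ i, 0 < r i) (hs : ∀ i, 0 < s i) {b : ℝ}
    (hb : 0 ≤ b) (hl : ∀ i, 0 < lam i) :
    klRisk r s (bayesPredictive r s (dampedJeffreys b)) lam
      = ENNReal.ofReal (∑ i, coordRisk (r i) (s i) b (lam i)) := by
  have h := klLoss_dampedJeffreys hr hs hb hl (isPredictive_dampedJeffreys hr hs hb)
  have hc := fun i => coordLoss_integral (hr i) (hs i) hb (hl i)
  have hint : ∀ i, Integrable (fun x : Fin d → ℕ => coordLoss (r i) (s i) b (lam i) (x i))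
      (poissonPi r lam) := fun i => integrable_comp_eval (hc i).1
  simp only [klRisk, (h _).2]
  rw [tsum_poissonLik_mul hr hl, ← ofReal_integral_eq_lintegral_ofReal
    (integrable_finsetSum _ fun i _ => hint i) (Eventually.of_forall fun x => (h x).1),
    integral_finsetSum _ fun i _ => hint i]
  congr 1
  refine Finset.sum_congr rfl fun i _ => ?_
  rw [← (hc i).2]
  exact integral_comp_eval (μ := fun i => poissonMeasure (r i * lam i).toNNReal)
    (hc i).1.aestronglyMeasurable

/-- The risk under the Jeffreys prior is everywhere below `1.04` times the lower bound. -/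
lemma klRisk_jeffreysPrior_lt {r s lam : Fin d → ℝ} (hd : 0 < d) (hr : ∀ i, 0 < r i)
    (hs : ∀ i, 0 < s i) (hl : ∀ i, 0 < lam i) :
    klRisk r s (bayesPredictive r s jeffreysPrior) lam
      < ENNReal.ofReal (1.04 * minimaxLowerBound r s) := by
  rw [← dampedJeffreys_zero, klRisk_dampedJeffreys hr hs le_rfl hl]
  have := Fin.pos_iff_nonempty.mp hd
  have hlog : ∀ i, 0 < Real.log ((r i + s i) / r i) := fun i => by
    refine Real.log_pos ?_
    rw [one_lt_div (hr i)]
    linarith [hs i]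
  have hpos : 0 < ∑ i, Real.log ((r i + s i) / r i) :=
    Finset.sum_pos (fun i _ => hlog i) Finset.univ_nonempty
  refine (ENNReal.ofReal_lt_ofReal_iff (by rw [minimaxLowerBound]; positivity)).mpr ?_
  rw [minimaxLowerBound, ← mul_assoc, Finset.mul_sum]
  refine Finset.sum_lt_sum_of_nonempty Finset.univ_nonempty fun i _ => ?_
  have h1 := hr i
  have h2 := hs i
  have h3 := hl i
  have h := jeffreysPotential_sub_lt (mul_pos h1 h3)
    (show r i * lam i < (r i + s i) * lam i by nlinarith)
  rw [mul_div_mul_right _ _ h3.ne'] at h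
  rw [coordRisk]
  simp only [add_zero, div_self (by positivity : r i + s i ≠ 0), div_self h1.ne', Real.log_one]
  linarith

/-! ### Lower bound for the minimax risk -/

/-- Scaling all durations by c is the same as scaling the intensities by c. One fixed prior of rate
1 under durations multiplied by c thus plays the role of a Gamma prior of rate 1/c under the
original durations. -/
lemma poissonLik_smul (c : ℝ) (t lam : Fin d → ℝ) (x : Fin d → ℕ) :
    poissonLik (c • t) lam x = poissonLik t (c • lam) x := by
  simp only [poissonLik, Pi.smul_apply, smul_eq_mul]
  refine Finset.prod_congr rfl fun i _ => ?_
  rw [mul_comm c (t i), mul_assoc]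

lemma klRisk_smul (c : ℝ) (r s lam : Fin d → ℝ) (q : (Fin d → ℕ) → (Fin d → ℕ) → ℝ≥0∞) :
    klRisk (c • r) (c • s) q lam = klRisk r s q (c • lam) := by
  simp only [klRisk, klLoss, poissonLik_smul]

lemma iSup_klRisk_smul_le {c : ℝ} (hc : 0 < c) (r s : Fin d → ℝ)
    (q : (Fin d → ℕ) → (Fin d → ℕ) → ℝ≥0∞) :
    (⨆ (lam : Fin d → ℝ) (_ : ∀ i, 0 < lam i), klRisk (c • r) (c • s) q lam) ≤
      ⨆ (lam : Fin d → ℝ) (_ : ∀ i, 0 < lam i), klRisk r s q lam := by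
  refine iSup₂_le fun lam hl => ?_
  rw [klRisk_smul]
  exact le_iSup₂ (f := fun (lam : Fin d → ℝ) (_ : ∀ i, 0 < lam i) => klRisk r s q lam) (c • lam)
    fun i => mul_pos hc (hl i)

/-- A lower bound for `coordRisk (c r) (c s) 1 u`, converging to the minimax bound. -/
def coordLower (r s c u : ℝ) : ℝ :=
  1 / 2 * Real.log ((r + s + 1 / c) / (r + 1 / c)) - 1 / (c * (r * u))
    + 2 * u / (2 + 1 / (c * (r + s))) - u

/-- Three estimates are combined: `jeffreysPotential_sub_ge`, log(1+x) ≥ 2x/(x+2) for the increasing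
damping term, and log(1+x) ≤ x for the other. The last two contributions tend to u and -u, so they
cancel as c → ∞. -/
lemma coordLower_le {r s c u : ℝ} (hr : 0 < r) (hs : 0 < s) (hc : 0 < c) (hu : 0 < u) :
    coordLower r s c u ≤ coordRisk (c * r) (c * s) 1 u := by
  have h1 := jeffreysPotential_sub_ge (μ := c * r * u) (ν := (c * r + c * s) * u) (by positivity)
    (by nlinarith [mul_pos (mul_pos hc hs) hu])
  have e1 : (c * r + c * s + 1) / (c * r + 1) = (r + s + 1 / c) / (r + 1 / c) := by
    field_simp
  have h2 : 2 * u / (2 + 1 / (c * (r + s))) ≤ (c * r + c * s) * u *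
      Real.log ((c * r + c * s + 1) / (c * r + c * s)) := by
    have hx : 0 ≤ 1 / (c * (r + s)) := by positivity
    have hlog := Real.le_log_one_add_of_nonneg hx
    have e2 : (c * r + c * s + 1) / (c * r + c * s) = 1 + 1 / (c * (r + s)) := by
      field_simp
    rw [e2]
    refine le_trans (le_of_eq ?_) (mul_le_mul_of_nonneg_left hlog (by positivity))
    field_simp
    ring
  have h3 : c * r * u * Real.log ((c * r + 1) / (c * r)) ≤ u := by
    have hlog := Real.log_le_sub_one_of_pos (show 0 < (c * r + 1) / (c * r) by positivity)
    refine (mul_le_mul_of_nonneg_left hlog (by positivity)).trans (le_of_eq ?_)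
    field_simp
    ring
  rw [coordLower, coordRisk, ← e1]
  rw [mul_assoc c r u] at h1 h3
  rw [mul_assoc c r u]
  linarith

lemma tendsto_coordLower {r s : ℝ} (hr : 0 < r) (hs : 0 < s) (u : ℝ) :
    Tendsto (fun n : ℕ => coordLower r s ((n : ℝ) + 1) u) atTop
      (𝓝 (1 / 2 * Real.log ((r + s) / r))) := by
  have hinv : Tendsto (fun n : ℕ => 1 / ((n : ℝ) + 1)) atTop (𝓝 0) :=
    tendsto_one_div_add_atTop_nhds_zero_nat
  have t1 : Tendsto (fun n : ℕ => 1 / 2 * Real.log ((r + s + 1 / ((n : ℝ) + 1)) /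
      (r + 1 / ((n : ℝ) + 1)))) atTop (𝓝 (1 / 2 * Real.log ((r + s + 0) / (r + 0)))) := by
    refine Tendsto.const_mul _ (Tendsto.log ?_ (by positivity))
    exact (tendsto_const_nhds.add hinv).div (tendsto_const_nhds.add hinv) (by positivity)
  have t2 : Tendsto (fun n : ℕ => 1 / (((n : ℝ) + 1) * (r * u))) atTop (𝓝 (0 * (1 / (r * u)))) := by
    refine (hinv.mul_const _).congr fun n => ?_
    rw [one_div_mul_one_div]
  have t3 : Tendsto (fun n : ℕ => 2 * u / (2 + 1 / (((n : ℝ) + 1) * (r + s)))) atTop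
      (𝓝 (2 * u / (2 + 0 * (1 / (r + s))))) := by
    refine tendsto_const_nhds.div (tendsto_const_nhds.add ?_) (by norm_num)
    refine (hinv.mul_const _).congr fun n => ?_
    rw [one_div_mul_one_div]
  have t := ((t1.sub t2).add t3).sub_const u
  have e : 1 / 2 * Real.log ((r + s + 0) / (r + 0)) - 0 * (1 / (r * u))
      + 2 * u / (2 + 0 * (1 / (r + s))) - u = 1 / 2 * Real.log ((r + s) / r) := by
    simp
  rwa [e] at t

lemma minimaxLowerBound_le_minimaxRisk {r s : Fin d → ℝ} (hr : ∀ i, 0 < r i)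
    (hs : ∀ i, 0 < s i) : ENNReal.ofReal (minimaxLowerBound r s) ≤ minimaxRisk r s := by
  refine le_iInf₂ fun q hq1 => ?_
  set M := ⨆ (lam : Fin d → ℝ) (_ : ∀ i, 0 < lam i), klRisk r s q lam with hM
  by_cases hq : ∀ x y, q x y ≠ 0
  swap
  · push Not at hq
    obtain ⟨x, y, hxy⟩ := hq
    have h1 : klRisk r s q (fun _ => 1) ≤ M := le_iSup₂
      (f := fun (lam : Fin d → ℝ) (_ : ∀ i, 0 < lam i) => klRisk r s q lam) (fun _ => 1)
      fun _ => one_pos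
    rw [klRisk_eq_top hr hs (fun _ => one_pos) hxy, top_le_iff] at h1
    rw [h1]
    exact le_top
  -- An unnormalized product of Gamma laws of shape 1/2 and rate 1, of finite mass `Z`. Under
  -- durations scaled by n + 1 it approaches the Jeffreys prior while staying proper.
  set w : (Fin d → ℝ) → ℝ≥0∞ := dampedJeffreys 1 with hw
  have hwm : Measurable w := measurable_dampedJeffreys 1
  set Z := ∫⁻ lam in orthant d, w lam with hZ
  have hZval : Z = ENNReal.ofReal
      (∏ _i : Fin d, Real.Gamma (1 / 2) / (1 : ℝ) ^ (1 / 2 : ℝ)) := by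
    rw [← lintegral_orthant_monomial (fun _ => by norm_num) (fun _ => one_pos)]
    refine setLIntegral_congr_fun measurableSet_orthant fun lam hl => ?_
    rw [hw, dampedJeffreys_eq hl]
    norm_num
  have hZtop : Z ≠ ∞ := by rw [hZval]; exact ENNReal.ofReal_ne_top
  have hZ0 : Z ≠ 0 := by
    rw [hZval]
    have := Real.Gamma_pos_of_pos (show (0 : ℝ) < 1 / 2 by norm_num)
    refine (ENNReal.ofReal_pos.mpr (Finset.prod_pos fun _ _ => ?_)).ne'
    positivity
  have hbound : ∀ n : ℕ, ∫⁻ u in orthant d,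
      ENNReal.ofReal (∑ i, coordLower (r i) (s i) ((n : ℝ) + 1) (u i)) * w u ≤ M * Z := by
    intro n
    have hc : (0 : ℝ) < (n : ℝ) + 1 := by positivity
    set c : ℝ := (n : ℝ) + 1
    have hr' : ∀ i, 0 < (c • r) i := fun i => mul_pos hc (hr i)
    have hs' : ∀ i, 0 < (c • s) i := fun i => mul_pos hc (hs i)
    have hmpos : ∀ x, 0 < countConst (c • r) x * gammaConst (fun i => (c • r) i + 1) x := fun x =>
      mul_pos (countConst_pos hr' x) (gammaConst_pos (fun i => by have := hr' i; positivity) x)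
    have h0 : ∀ x, marginal (c • r) w x ≠ 0 := fun x => by
      rw [hw, marginal_dampedJeffreys hr' zero_le_one]
      simpa using hmpos x
    have htop : ∀ x, marginal (c • r) w x ≠ ∞ := fun x => by
      rw [hw, marginal_dampedJeffreys hr' zero_le_one]
      exact ENNReal.ofReal_ne_top
    calc ∫⁻ u in orthant d, ENNReal.ofReal (∑ i, coordLower (r i) (s i) c (u i)) * w u
        ≤ ∫⁻ u in orthant d, klRisk (c • r) (c • s) (bayesPredictive (c • r) (c • s) w) u * w u := by
          refine setLIntegral_mono' measurableSet_orthant fun u hu => mul_le_mul_left ?_ _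
          rw [hw, klRisk_dampedJeffreys hr' hs' zero_le_one hu]
          exact ENNReal.ofReal_le_ofReal (Finset.sum_le_sum fun i _ =>
            coordLower_le (hr i) (hs i) hc (hu i))
      _ ≤ _ := lintegral_klRisk_le_iSup_mul hr' hs' hwm h0 htop hZtop hq hq1
      _ ≤ M * Z := mul_le_mul_left (iSup_klRisk_smul_le hc r s q) _
  have hmeas : ∀ n : ℕ, Measurable fun u : Fin d → ℝ =>
      ENNReal.ofReal (∑ i, coordLower (r i) (s i) ((n : ℝ) + 1) (u i)) * w u := fun n => by
    refine Measurable.fun_mul (Measurable.ennreal_ofReal ?_) hwm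
    unfold coordLower
    fun_prop
  have hlim : ∀ u ∈ orthant d, ENNReal.ofReal (minimaxLowerBound r s) * w u
      = liminf (fun n : ℕ => ENNReal.ofReal
          (∑ i, coordLower (r i) (s i) ((n : ℝ) + 1) (u i)) * w u) atTop := by
    intro u hu
    symm
    refine Tendsto.liminf_eq (ENNReal.Tendsto.mul_const (ENNReal.tendsto_ofReal ?_) (Or.inr ?_))
    · rw [minimaxLowerBound, Finset.mul_sum]
      exact tendsto_finsetSum _ fun i _ => tendsto_coordLower (hr i) (hs i) (u i)
    · rw [hw, dampedJeffreys_eq hu]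
      exact ENNReal.ofReal_ne_top
  -- `coordLower` may be negative for small u; truncation by `ENNReal.ofReal` gives the
  -- nonnegativity required by Fatou's lemma, and the limit is unaffected.
  have hfatou : ENNReal.ofReal (minimaxLowerBound r s) * Z ≤ M * Z := by
    rw [hZ, ← lintegral_const_mul _ hwm, setLIntegral_congr_fun measurableSet_orthant hlim]
    refine (lintegral_liminf_le hmeas).trans ?_
    exact liminf_le_of_frequently_le' (Frequently.of_forall hbound)
  exact (ENNReal.mul_le_mul_iff_left hZ0 hZtop).mp hfatou

/-! ### The distance to a subspace in adapted coordinates -/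

/-- Sign change of coordinates as an isometry. -/
def signFlipIsometry (a : Fin d → ℤˣ) :
    EuclideanSpace ℝ (Fin d) ≃ₗᵢ[ℝ] EuclideanSpace ℝ (Fin d) :=
  LinearIsometry.toLinearIsometryEquiv
    { toFun := signFlip a
      map_add' := fun x y => by ext i; simp [signFlip, mul_add]
      map_smul' := fun c x => by ext i; simp [signFlip, mul_left_comm]
      norm_map' := fun x => by
        rw [EuclideanSpace.norm_eq, EuclideanSpace.norm_eq]
        congr 1
        refine Finset.sum_congr rfl fun i _ => ?_
        rcases Int.units_eq_one_or (a i) with h | h <;> simp [signFlip, h] } rfl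

lemma signFlipIsometry_apply (a : Fin d → ℤˣ) (θ : EuclideanSpace ℝ (Fin d)) :
    signFlipIsometry a θ = signFlip a θ := rfl

lemma sqDist_eq_norm_sq (V : Submodule ℝ (EuclideanSpace ℝ (Fin d)))
    (θ : EuclideanSpace ℝ (Fin d)) : sqDist V θ = ‖Vᗮ.orthogonalProjectionOnto θ‖ ^ 2 := by
  have h1 : Metric.infDist θ (V : Set (EuclideanSpace ℝ (Fin d))) = ‖θ - V.starProjection θ‖ := by
    rw [Submodule.starProjection_minimal, Metric.infDist_eq_iInf]
    simp only [dist_eq_norm]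
    rfl
  rw [sqDist, h1, Submodule.coe_norm]
  congr 2
  exact (Submodule.starProjection_orthogonal_val θ).symm

/-- An orthonormal basis of `Vᗮ` is extended to the whole space; `S` indexes the vectors spanning
`Vᗮ`, so |S| = d - k is the effective dimension for superharmonicity. -/
lemma exists_isometry_sqDist (V : Submodule ℝ (EuclideanSpace ℝ (Fin d))) :
    ∃ (e : EuclideanSpace ℝ (Fin d) ≃ₗᵢ[ℝ] EuclideanSpace ℝ (Fin d)) (S : Finset (Fin d)),
      S.card + Module.finrank ℝ V = d ∧ ∀ θ, sqDist V θ = ∑ i ∈ S, (e θ i) ^ 2 := by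
  have hdim : Module.finrank ℝ V + Module.finrank ℝ Vᗮ = d := by
    rw [Submodule.finrank_add_finrank_orthogonal]
    simp
  set n := Module.finrank ℝ Vᗮ with hn
  set u := stdOrthonormalBasis ℝ Vᗮ
  have hnd : n ≤ d := by omega
  set ι : Fin n ↪ Fin d := Fin.castLEEmb hnd
  set v : Fin d → EuclideanSpace ℝ (Fin d) := Function.extend ι (fun j => (u j : _)) 0
  have hv : ∀ j, v (ι j) = u j := fun j => ι.injective.extend_apply _ _ _
  have hu : Orthonormal ℝ fun j => (u j : EuclideanSpace ℝ (Fin d)) :=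
    u.orthonormal.comp_linearIsometry Vᗮ.subtypeₗᵢ
  have hort : Orthonormal ℝ ((Set.range ι).domRestrict v) := by
    have h := hu.comp _ (Equiv.ofInjective ι ι.injective).symm.injective
    convert h using 1
    ext1 ⟨i, j, hj⟩
    subst hj
    have : (Equiv.ofInjective ι ι.injective).symm ⟨ι j, ⟨j, rfl⟩⟩ = j :=
      Equiv.ofInjective_symm_apply ι.injective j
    simp only [Function.comp_apply, this]
    exact hv j
  obtain ⟨b, hb⟩ := hort.exists_orthonormalBasis_extension_of_card_eq (by simp)
  refine ⟨b.repr, Finset.univ.map ι, by simp; omega, fun θ => ?_⟩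
  rw [sqDist_eq_norm_sq, ← u.sum_sq_norm_inner_right, Finset.sum_map]
  refine Finset.sum_congr rfl fun j _ => ?_
  rw [b.repr_apply_apply, hb _ ⟨j, rfl⟩, hv, Real.norm_eq_abs, sq_abs]
  congr 1
  exact Submodule.inner_orthogonalProjectionOnto_eq_of_mem_left (u j) θ

/-! ### Gaussian averages -/

/-- Density of independent centred Gaussian variables with variance `1 / (2 c)`. -/
def heatKernel (c : ℝ) (φ θ : Fin d → ℝ) : ℝ :=
  ∏ i, (√(c / Real.pi) * Real.exp (-(c * (φ i - θ i) ^ 2)))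

lemma heatKernel_eq (c : ℝ) (φ θ : EuclideanSpace ℝ (Fin d)) :
    heatKernel c φ.ofLp θ.ofLp = √(c / Real.pi) ^ d * Real.exp (-(c * ‖φ - θ‖ ^ 2)) := by
  rw [heatKernel, Finset.prod_mul_distrib, Finset.prod_const, Finset.card_univ, Fintype.card_fin,
    ← Real.exp_sum, EuclideanSpace.norm_sq_eq, Finset.mul_sum, Finset.sum_neg_distrib]
  simp

lemma lintegral_gaussian {k : ℝ} (hk : 0 < k) (m : ℝ) :
    ∫⁻ v, ENNReal.ofReal (Real.exp (-(k * (v - m) ^ 2))) = ENNReal.ofReal √(Real.pi / k) := by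
  have h := lintegral_sub_right_eq_self (μ := volume)
    (fun v : ℝ => ENNReal.ofReal (Real.exp (-(k * v ^ 2)))) m
  rw [h, ← integral_gaussian k, ofReal_integral_eq_lintegral_ofReal (integrable_exp_neg_mul_sq hk)
    (Eventually.of_forall fun _ => (Real.exp_pos _).le)]
  simp

lemma lintegral_gaussian_mul_exp {c t : ℝ} (hc : 0 < c) (ht : 0 ≤ t) (u : ℝ) :
    ∫⁻ v, ENNReal.ofReal (√(c / Real.pi) * Real.exp (-(c * (v - u) ^ 2)) * Real.exp (-(t * v ^ 2)))
      = ENNReal.ofReal (√(c / (c + t)) * Real.exp (-(c * t / (c + t) * u ^ 2))) := by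
  have hct : 0 < c + t := by positivity
  have e : ∀ v : ℝ, √(c / Real.pi) * Real.exp (-(c * (v - u) ^ 2)) * Real.exp (-(t * v ^ 2))
      = (√(c / Real.pi) * Real.exp (-(c * t / (c + t) * u ^ 2))) *
        Real.exp (-((c + t) * (v - c * u / (c + t)) ^ 2)) := by
    intro v
    rw [mul_assoc, mul_assoc, ← Real.exp_add, ← Real.exp_add]
    congr 2
    field_simp
    ring
  simp only [e]
  simp only [ENNReal.ofReal_mul (show 0 ≤ √(c / Real.pi) * Real.exp (-(c * t / (c + t) * u ^ 2)) by
    positivity)]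
  rw [lintegral_const_mul _ (by fun_prop), lintegral_gaussian hct,
    ← ENNReal.ofReal_mul (by positivity), mul_right_comm, ← Real.sqrt_mul (by positivity)]
  congr 3
  have := Real.pi_pos
  field_simp

lemma lintegral_isometry (e : EuclideanSpace ℝ (Fin d) ≃ₗᵢ[ℝ] EuclideanSpace ℝ (Fin d))
    (F : (Fin d → ℝ) → ℝ≥0∞) :
    ∫⁻ φ, F φ = ∫⁻ ψ : Fin d → ℝ, F (e.symm (WithLp.toLp 2 ψ)).ofLp := by
  have m1 : MeasurableEmbedding (WithLp.ofLp : EuclideanSpace ℝ (Fin d) → Fin d → ℝ) :=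
    (MeasurableEquiv.toLp 2 (Fin d → ℝ)).symm.measurableEmbedding
  have m2 : MeasurableEmbedding (WithLp.toLp 2 : (Fin d → ℝ) → EuclideanSpace ℝ (Fin d)) :=
    (MeasurableEquiv.toLp 2 (Fin d → ℝ)).measurableEmbedding
  rw [← (PiLp.volume_preserving_ofLp (Fin d)).lintegral_comp_emb m1,
    ← e.symm.measurePreserving.lintegral_comp_emb e.symm.toHomeomorph.measurableEmbedding,
    ← (PiLp.volume_preserving_toLp (Fin d)).lintegral_comp_emb m2]

/-- The Gaussian kernel is rotation invariant, so in the coordinates given by `e` the integral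
factors. A coordinate in `S` contributes √(c/(c+t)) and an exponential, every other coordinate
contributes 1. -/
lemma lintegral_exp_quadratic_mul_heatKernel
    (e : EuclideanSpace ℝ (Fin d) ≃ₗᵢ[ℝ] EuclideanSpace ℝ (Fin d)) (S : Finset (Fin d))
    {c t : ℝ} (hc : 0 < c) (ht : 0 ≤ t) (θ : Fin d → ℝ) :
    ∫⁻ φ : Fin d → ℝ, ENNReal.ofReal
        (Real.exp (-(t * ∑ i ∈ S, (e (WithLp.toLp 2 φ) i) ^ 2)) * heatKernel c φ θ)
      = ENNReal.ofReal ((c / (c + t)) ^ ((S.card : ℝ) / 2) *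
          Real.exp (-(c * t / (c + t) * ∑ i ∈ S, (e (WithLp.toLp 2 θ) i) ^ 2))) := by
  rw [lintegral_isometry e]
  set v := e (WithLp.toLp 2 θ) with hv
  set T : Fin d → ℝ := fun i => if i ∈ S then t else 0 with hT
  have hT0 : ∀ i, 0 ≤ T i := fun i => by rw [hT]; dsimp only; split_ifs <;> simp [ht]
  have hct : 0 < c + t := by positivity
  have hfac : ∀ ψ : Fin d → ℝ, ENNReal.ofReal
      (Real.exp (-(t * ∑ i ∈ S, (e (WithLp.toLp 2 (e.symm (WithLp.toLp 2 ψ)).ofLp) i) ^ 2)) *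
        heatKernel c (e.symm (WithLp.toLp 2 ψ)).ofLp θ)
      = ∏ i, ENNReal.ofReal (√(c / Real.pi) * Real.exp (-(c * (ψ i - v i) ^ 2)) *
          Real.exp (-(T i * ψ i ^ 2))) := by
    intro ψ
    rw [← ENNReal.ofReal_prod_of_nonneg fun i _ => by positivity]
    congr 1
    have h1 : heatKernel c (e.symm (WithLp.toLp 2 ψ)).ofLp θ
        = heatKernel c ψ v.ofLp := by
      have h2 := heatKernel_eq c (e.symm (WithLp.toLp 2 ψ)) (WithLp.toLp 2 θ)
      have h3 := heatKernel_eq c (WithLp.toLp 2 ψ) v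
      have h4 : ‖e.symm (WithLp.toLp 2 ψ) - WithLp.toLp 2 θ‖ = ‖WithLp.toLp 2 ψ - v‖ := by
        rw [← e.norm_map, map_sub, e.apply_symm_apply]
      rw [h4, ← h3] at h2
      exact h2
    rw [h1, heatKernel, Finset.prod_mul_distrib (f := fun i => √(c / Real.pi) * _), mul_comm,
      ← Real.exp_sum]
    congr 2
    simp only [hT, ite_mul, zero_mul, Finset.sum_neg_distrib, Finset.sum_ite_mem,
      Finset.univ_inter, Finset.mul_sum, WithLp.toLp_ofLp, e.apply_symm_apply]
  simp only [hfac]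
  rw [volume_pi, lintegral_pi_prod (fun _ => volume) (f := fun i x => ENNReal.ofReal
    (√(c / Real.pi) * Real.exp (-(c * (x - v i) ^ 2)) * Real.exp (-(T i * x ^ 2))))
    (by fun_prop)]
  simp only [lintegral_gaussian_mul_exp hc (hT0 _)]
  rw [← ENNReal.ofReal_prod_of_nonneg fun i _ => by positivity]
  congr 1
  rw [Finset.prod_mul_distrib, ← Real.exp_sum]
  congr 1
  · have : ∀ i, √(c / (c + T i)) = if i ∈ S then √(c / (c + t)) else 1 := by
      intro i
      rw [hT]
      dsimp only
      split_ifs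
      · rfl
      · rw [add_zero, div_self hc.ne', Real.sqrt_one]
    simp only [this]
    rw [Finset.prod_ite_mem, Finset.univ_inter, Finset.prod_const, Real.sqrt_eq_rpow,
      ← Real.rpow_natCast, ← Real.rpow_mul (by positivity)]
    congr 1
    ring
  · congr 1
    rw [Finset.sum_neg_distrib, Finset.mul_sum]
    congr 1
    rw [← Finset.sum_subset (Finset.subset_univ S)]
    · refine Finset.sum_congr rfl fun i hi => ?_
      simp [hT, hi]
    · intro i _ hi
      simp [hT, hi]

/-! ### Gaussian averages of inverse powers of a quadratic form -/

/-- The Laplace representation of q^(-α), including q = 0, where both sides are infinite. That case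
is needed because the squared distance vanishes on the subspace. -/
lemma lintegral_rpow_mul_exp_eq {α : ℝ} (hα : 0 < α) {q : ℝ} (hq : 0 ≤ q) :
    ∫⁻ t in Set.Ioi 0, ENNReal.ofReal (t ^ (α - 1) * Real.exp (-(q * t)))
      = ENNReal.ofReal (Real.Gamma α) * ENNReal.ofReal q ^ (-α) := by
  have hpos : ∀ {q : ℝ}, 0 < q → ∫⁻ t in Set.Ioi 0, ENNReal.ofReal (t ^ (α - 1) *
      Real.exp (-(q * t))) = ENNReal.ofReal (Real.Gamma α) * ENNReal.ofReal q ^ (-α) := by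
    intro q hq
    rw [lintegral_rpow_mul_exp hα hq, ENNReal.ofReal_rpow_of_pos hq,
      ← ENNReal.ofReal_mul (Real.Gamma_pos_of_pos hα).le, Real.rpow_neg hq.le, div_eq_mul_inv]
  have hG := Real.Gamma_pos_of_pos hα
  rcases hq.eq_or_lt with rfl | hq
  · rw [ENNReal.ofReal_zero, ENNReal.zero_rpow_of_neg (by linarith), ENNReal.mul_top (by simpa)]
    refine ENNReal.eq_top_of_forall_nnreal_le fun N => ?_
    set M : ℝ := (N : ℝ) + 1
    have hM : 0 < M := by positivity
    -- The rate for which Γ(α)/q^α equals the prescribed large number `M`.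
    set q : ℝ := (M / Real.Gamma α) ^ (-α⁻¹)
    have hq : 0 < q := by positivity
    calc (N : ℝ≥0∞) ≤ ENNReal.ofReal M := by
          rw [← ENNReal.ofReal_coe_nnreal]
          exact ENNReal.ofReal_le_ofReal (by simp [M])
      _ = ∫⁻ t in Set.Ioi 0, ENNReal.ofReal (t ^ (α - 1) * Real.exp (-(q * t))) := by
          rw [lintegral_rpow_mul_exp hα hq]
          congr 1
          rw [← Real.rpow_mul (by positivity), neg_mul, inv_mul_cancel₀ hα.ne',
            Real.rpow_neg_one]
          field_simp
      _ ≤ _ := by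
          refine setLIntegral_mono' measurableSet_Ioi fun t ht => ENNReal.ofReal_le_ofReal ?_
          have ht : (0 : ℝ) < t := ht
          gcongr
  · exact hpos hq

/-- Gaussian averaging sends exp(-tQ) to a multiple of exp(-sQ) with s = ct/(c+t). As t runs over
the half-line, s covers only (0, c), with ds = (c/(c+t))² dt. -/
lemma lintegral_substitution {c : ℝ} (hc : 0 < c) (g : ℝ → ℝ≥0∞) :
    ∫⁻ s in Set.Ioo 0 c, g s
      = ∫⁻ t in Set.Ioi 0, ENNReal.ofReal ((c / (c + t)) ^ 2) * g (c * t / (c + t)) := by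
  have himg : (fun t : ℝ => c * t / (c + t)) '' Set.Ioi 0 = Set.Ioo 0 c := by
    ext s
    constructor
    · rintro ⟨t, ht, rfl⟩
      have ht : (0 : ℝ) < t := ht
      refine ⟨by positivity, ?_⟩
      rw [div_lt_iff₀ (by positivity)]
      nlinarith
    · rintro ⟨h0, h1⟩
      have : 0 < c - s := by linarith
      refine ⟨c * s / (c - s), by simp only [Set.mem_Ioi]; positivity, ?_⟩
      have : c * (c - s) + c * s ≠ 0 := by nlinarith
      simp only
      field_simp
      ring
  rw [← himg, lintegral_image_eq_lintegral_abs_deriv_mul measurableSet_Ioi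
    (f' := fun t => (c / (c + t)) ^ 2)]
  · simp only [abs_sq]
  · intro t ht
    have ht : (0 : ℝ) < t := ht
    have h := ((hasDerivAt_id t).const_mul c).fun_div ((hasDerivAt_id t).const_add c)
      (by simp only [id]; positivity)
    refine (h.congr_deriv ?_).hasDerivWithinAt
    simp only [id]
    field_simp
    ring
  · intro t ht t' ht' h
    have ht : (0 : ℝ) < t := ht
    have ht' : (0 : ℝ) < t' := ht'
    simp only at h
    rw [div_eq_div_iff (by positivity) (by positivity)] at h
    have : c * c * (t - t') = 0 := by linarith
    have hcc : c * c ≠ 0 := by positivity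
    have := (mul_eq_zero.mp this).resolve_left hcc
    linarith

/-- A bound, uniform in `q ≥ 0`, for the truncated Laplace integral. -/
lemma setLIntegral_Ioo_le {α c : ℝ} (hα : 0 < α) {q : ℝ} (hq : 0 ≤ q) :
    ∫⁻ s in Set.Ioo 0 c, ENNReal.ofReal (s ^ (α - 1) * Real.exp (-(q * s)))
      ≤ ENNReal.ofReal (Real.exp c) * ENNReal.ofReal (Real.Gamma α) := by
  calc ∫⁻ s in Set.Ioo 0 c, ENNReal.ofReal (s ^ (α - 1) * Real.exp (-(q * s)))
      ≤ ∫⁻ s in Set.Ioo 0 c, ENNReal.ofReal (Real.exp c) *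
          ENNReal.ofReal (s ^ (α - 1) * Real.exp (-(1 * s))) := by
        refine setLIntegral_mono' measurableSet_Ioo fun s hs => ?_
        rw [← ENNReal.ofReal_mul (Real.exp_pos c).le]
        refine ENNReal.ofReal_le_ofReal ?_
        have h0 : 0 ≤ s ^ (α - 1) := Real.rpow_nonneg hs.1.le _
        rw [mul_left_comm, ← Real.exp_add]
        refine mul_le_mul_of_nonneg_left (Real.exp_le_exp.mpr ?_) h0
        nlinarith [hs.1, hs.2, mul_nonneg hq hs.1.le]
    _ ≤ ∫⁻ s in Set.Ioi 0, ENNReal.ofReal (Real.exp c) *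
          ENNReal.ofReal (s ^ (α - 1) * Real.exp (-(1 * s))) :=
        lintegral_mono_set fun s hs => hs.1
    _ = _ := by
        rw [lintegral_const_mul _ (by fun_prop), lintegral_rpow_mul_exp_eq hα zero_le_one]
        simp

/-- Write Γ(α) Q^(-α) as ∫ t^(α-1) exp(-tQ) dt, average under the integral and substitute s =
ct/(c+t). The dimension condition absorbs the powers of c/(c+t), leaving at most the same integral
truncated to (0, c). The missing piece over [c, ∞) gives the strict inequality, and the truncated
integral is bounded uniformly in θ, even where Q vanishes. -/
lemma heatAverage_inv_quadratic
    (e : EuclideanSpace ℝ (Fin d) ≃ₗᵢ[ℝ] EuclideanSpace ℝ (Fin d)) (S : Finset (Fin d))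
    {c α : ℝ} (hc : 0 < c) (hα : 0 < α) (hS : α + 1 ≤ (S.card : ℝ) / 2) (θ : Fin d → ℝ) :
    ∫⁻ φ : Fin d → ℝ, ENNReal.ofReal (∑ i ∈ S, (e (WithLp.toLp 2 φ) i) ^ 2) ^ (-α) *
        ENNReal.ofReal (heatKernel c φ θ)
      < ENNReal.ofReal (∑ i ∈ S, (e (WithLp.toLp 2 θ) i) ^ 2) ^ (-α) ∧
    ∫⁻ φ : Fin d → ℝ, ENNReal.ofReal (∑ i ∈ S, (e (WithLp.toLp 2 φ) i) ^ 2) ^ (-α) *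
        ENNReal.ofReal (heatKernel c φ θ) ≤ ENNReal.ofReal (Real.exp c) := by
  set Q : (Fin d → ℝ) → ℝ := fun φ => ∑ i ∈ S, (e (WithLp.toLp 2 φ) i) ^ 2 with hQ
  have hQ0 : ∀ φ, 0 ≤ Q φ := fun φ => Finset.sum_nonneg fun i _ => sq_nonneg _
  have hQm : Measurable Q := by
    have : Continuous Q := by
      refine continuous_finsetSum _ fun i _ => Continuous.pow ?_ 2
      exact (EuclideanSpace.proj i).continuous.comp
        (e.continuous.comp (PiLp.continuous_toLp 2 _))
    exact this.measurable
  have hKm : Measurable fun φ : Fin d → ℝ => heatKernel c φ θ := by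
    unfold heatKernel
    fun_prop
  set G := ENNReal.ofReal (Real.Gamma α) with hG
  have hG0 : G ≠ 0 := by simpa [hG] using Real.Gamma_pos_of_pos hα
  have hGt : G ≠ ∞ := ENNReal.ofReal_ne_top
  set H := ∫⁻ φ : Fin d → ℝ, ENNReal.ofReal (Q φ) ^ (-α) * ENNReal.ofReal (heatKernel c φ θ)
  set A := ∫⁻ s in Set.Ioo 0 c, ENNReal.ofReal (s ^ (α - 1) * Real.exp (-(Q θ * s))) with hA
  have hGH : G * H ≤ A := by
    calc G * H = ∫⁻ φ : Fin d → ℝ, ∫⁻ t in Set.Ioi 0,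
          ENNReal.ofReal (t ^ (α - 1) * Real.exp (-(Q φ * t))) *
            ENNReal.ofReal (heatKernel c φ θ) := by
          rw [← lintegral_const_mul _
            ((hQm.ennreal_ofReal.pow_const _).fun_mul hKm.ennreal_ofReal)]
          refine lintegral_congr fun φ => ?_
          rw [lintegral_mul_const _ (by fun_prop), lintegral_rpow_mul_exp_eq hα (hQ0 φ), mul_assoc]
      _ = ∫⁻ t in Set.Ioi 0, ∫⁻ φ : Fin d → ℝ,
          ENNReal.ofReal (t ^ (α - 1) * Real.exp (-(Q φ * t))) *
            ENNReal.ofReal (heatKernel c φ θ) := by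
          refine lintegral_lintegral_swap ?_
          refine Measurable.aemeasurable (Measurable.fun_mul (Measurable.ennreal_ofReal ?_) ?_)
          · exact (measurable_snd.pow_const _).fun_mul
              ((hQm.comp measurable_fst).fun_mul measurable_snd).neg.exp
          · exact (hKm.comp measurable_fst).ennreal_ofReal
      _ ≤ ∫⁻ t in Set.Ioi 0, ENNReal.ofReal ((c / (c + t)) ^ 2) * ENNReal.ofReal
          ((c * t / (c + t)) ^ (α - 1) * Real.exp (-(Q θ * (c * t / (c + t))))) := by
          refine setLIntegral_mono' measurableSet_Ioi fun t ht => ?_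
          have ht : (0 : ℝ) < t := ht
          have e1 : ∀ φ, ENNReal.ofReal (t ^ (α - 1) * Real.exp (-(Q φ * t))) *
              ENNReal.ofReal (heatKernel c φ θ) = ENNReal.ofReal (t ^ (α - 1)) *
              ENNReal.ofReal (Real.exp (-(t * Q φ)) * heatKernel c φ θ) := by
            intro φ
            rw [← ENNReal.ofReal_mul (by positivity), ← ENNReal.ofReal_mul (by positivity),
              mul_comm t, mul_assoc]
          simp only [e1]
          rw [lintegral_const_mul _
            ((hQm.const_mul t).fun_neg.exp.fun_mul hKm).ennreal_ofReal,
            lintegral_exp_quadratic_mul_heatKernel e S hc ht.le,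
            ← ENNReal.ofReal_mul (by positivity), ← ENNReal.ofReal_mul (by positivity)]
          refine ENNReal.ofReal_le_ofReal ?_
          set ρ := c / (c + t) with hρ
          have hρ0 : 0 < ρ := by positivity
          have hρ1 : ρ ≤ 1 := by
            rw [hρ, div_le_one (by positivity)]
            linarith
          have e2 : c * t / (c + t) = ρ * t := by rw [hρ]; ring
          have e3 : ρ ^ 2 * ρ ^ (α - 1) = ρ ^ (α + 1) := by
            rw [← Real.rpow_natCast, ← Real.rpow_add hρ0]
            congr 1
            push_cast
            ring
          rw [e2, Real.mul_rpow hρ0.le ht.le]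
          calc t ^ (α - 1) * (ρ ^ ((S.card : ℝ) / 2) * Real.exp (-(ρ * t * Q θ)))
              ≤ t ^ (α - 1) * (ρ ^ (α + 1) * Real.exp (-(ρ * t * Q θ))) := by
                -- Here ρ ≤ 1 and α + 1 ≤ |S|/2 are used: ρ^(α+1) is exactly the Jacobian ρ² times
                -- the factor ρ^(α-1) from s^(α-1).
                gcongr t ^ (α - 1) * (?_ * _)
                exact Real.rpow_le_rpow_of_exponent_ge hρ0 hρ1 hS
            _ = _ := by
                rw [← e3, mul_comm (Q θ)]
                ring
      _ = A := (lintegral_substitution hc fun s =>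
          ENNReal.ofReal (s ^ (α - 1) * Real.exp (-(Q θ * s)))).symm
  have hA1 : A ≤ ENNReal.ofReal (Real.exp c) * G := setLIntegral_Ioo_le hα (hQ0 θ)
  have hAt : A ≠ ∞ := ne_top_of_le_ne_top (ENNReal.mul_ne_top ENNReal.ofReal_ne_top hGt) hA1
  -- The full Laplace integral exceeds the finite truncated one by the integral of a positive
  -- function over [c, ∞).
  have hlt : A < G * ENNReal.ofReal (Q θ) ^ (-α) := by
    rw [hG, ← lintegral_rpow_mul_exp_eq hα (hQ0 θ), ← Set.Ioo_union_Ici_eq_Ioi hc,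
      lintegral_union measurableSet_Ici
        (Set.disjoint_left.mpr fun s hs hs' => absurd hs.2 (not_lt.mpr hs'))]
    refine ENNReal.lt_add_right hAt fun h0 => ?_
    rw [lintegral_eq_zero_iff (by fun_prop), Filter.EventuallyEq, ae_restrict_iff' measurableSet_Ici]
      at h0
    have hsub : Set.Ici c ⊆ {s | ¬(s ∈ Set.Ici c → ENNReal.ofReal (s ^ (α - 1) *
        Real.exp (-(Q θ * s))) = (0 : ℝ → ℝ≥0∞) s)} := by
      intro s hs
      have hs0 : 0 < s := hc.trans_le hs
      simp only [Set.mem_ofPred_eq, hs, true_imp_iff, Pi.zero_apply, ENNReal.ofReal_eq_zero, not_le]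
      positivity
    have := measure_mono_null hsub h0
    simp at this
  refine ⟨?_, ?_⟩
  · exact (ENNReal.mul_lt_mul_iff_right hG0 hGt).mp (hGH.trans_lt hlt)
  · refine (ENNReal.mul_le_mul_iff_right hG0 hGt).mp ((hGH.trans hA1).trans_eq (mul_comm _ _))

/-! ### The shrinkage function -/

/-- `subspaceShrinkage` on plain coordinates. -/
def shrinkage (V : Submodule ℝ (EuclideanSpace ℝ (Fin d))) (α : ℝ) (φ : Fin d → ℝ) : ℝ≥0∞ :=
  subspaceShrinkage V α (WithLp.toLp 2 φ)

/-- Average of the shrinkage function under a Gaussian perturbation. -/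
def heatAverage (V : Submodule ℝ (EuclideanSpace ℝ (Fin d))) (α c : ℝ) (θ : Fin d → ℝ) : ℝ≥0∞ :=
  ∫⁻ φ : Fin d → ℝ, shrinkage V α φ * ENNReal.ofReal (heatKernel c φ θ)

lemma continuous_signFlip_toLp (a : Fin d → ℤˣ) :
    Continuous fun φ : Fin d → ℝ => signFlip a (WithLp.toLp 2 φ) :=
  (signFlipIsometry a).continuous.comp (PiLp.continuous_toLp 2 _)

lemma measurable_inv_sqDist (V : Submodule ℝ (EuclideanSpace ℝ (Fin d))) (α : ℝ)
    (a : Fin d → ℤˣ) : Measurable fun φ : Fin d → ℝ =>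
      ENNReal.ofReal (sqDist V (signFlip a (WithLp.toLp 2 φ))) ^ (-α) := by
  refine Measurable.pow_const (Measurable.ennreal_ofReal ?_) _
  exact (((Metric.continuous_infDist_pt _).comp (continuous_signFlip_toLp a)).pow 2).measurable

lemma measurable_shrinkage (V : Submodule ℝ (EuclideanSpace ℝ (Fin d))) (α : ℝ) :
    Measurable (shrinkage V α) :=
  Finset.measurable_fun_sum _ fun a _ => measurable_inv_sqDist V α a

lemma heatAverage_lt_and_le (V : Submodule ℝ (EuclideanSpace ℝ (Fin d))) {α c : ℝ}
    (hα : 0 < α) (hαV : α ≤ ((d : ℝ) - (Module.finrank ℝ V : ℝ) - 2) / 2) (hc : 0 < c)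
    (θ : Fin d → ℝ) :
    heatAverage V α c θ < shrinkage V α θ ∧
      heatAverage V α c θ ≤ ∑ _a : Fin d → ℤˣ, ENNReal.ofReal (Real.exp c) := by
  have hKm : Measurable fun φ : Fin d → ℝ => heatKernel c φ θ := by
    unfold heatKernel
    fun_prop
  have hsum : heatAverage V α c θ = ∑ a : Fin d → ℤˣ, ∫⁻ φ : Fin d → ℝ,
      ENNReal.ofReal (sqDist V (signFlip a (WithLp.toLp 2 φ))) ^ (-α) *
        ENNReal.ofReal (heatKernel c φ θ) := by
    simp only [heatAverage, shrinkage, subspaceShrinkage, Finset.sum_mul]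
    exact lintegral_finsetSum _ fun a _ =>
      (measurable_inv_sqDist V α a).fun_mul hKm.ennreal_ofReal
  obtain ⟨e, S, hcard, he⟩ := exists_isometry_sqDist V
  have hS : α + 1 ≤ (S.card : ℝ) / 2 := by
    have : (S.card : ℝ) + Module.finrank ℝ V = d := by exact_mod_cast hcard
    linarith
  have h := fun a : Fin d → ℤˣ =>
    heatAverage_inv_quadratic ((signFlipIsometry a).trans e) S hc hα hS θ
  simp only [LinearIsometryEquiv.trans_apply, signFlipIsometry_apply, ← he] at h
  rw [hsum]
  exact ⟨ENNReal.sum_lt_sum_of_nonempty Finset.univ_nonempty fun a _ => (h a).1,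
    Finset.sum_le_sum fun a _ => (h a).2⟩

/-! ### From intensities to signed square roots -/

lemma lintegral_even {g : ℝ → ℝ≥0∞} (hg : ∀ x, g (-x) = g x) :
    ∫⁻ x, g x = 2 * ∫⁻ x in Set.Ioi 0, g x := by
  have h : ∫⁻ x in Set.Iio (0 : ℝ), g x = ∫⁻ x in Set.Ioi 0, g x := by
    have h1 := (Measure.measurePreserving_neg (volume : Measure ℝ)).setLIntegral_comp_emb
      (MeasurableEquiv.neg ℝ).measurableEmbedding g (Set.Iio 0)
    rw [Set.image_neg_eq_neg, Set.neg_Iio, neg_zero] at h1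
    rw [← h1]
    simp only [hg]
  rw [← lintegral_add_compl g measurableSet_Iio (A := Set.Iio (0 : ℝ)), Set.compl_Iio, h,
    setLIntegral_congr Ioi_ae_eq_Ici.symm, two_mul]

lemma rpow_nat_add_half {u : ℝ} (hu : 0 ≤ u) (n : ℕ) : u ^ ((n : ℝ) + 1 / 2) = u ^ n * √u := by
  rw [Real.rpow_add_of_nonneg hu (by positivity) (by norm_num), Real.rpow_natCast, Real.sqrt_eq_rpow]

/-- For u = γθ² the Jacobian 2γθ turns u^(z-1/2) into 2 γ^(z+1/2) θ^(2z); the factor 2 is what the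
two signs of θ account for, so the whole line matches the half-line. -/
lemma lintegral_square_substitution {γ : ℝ} (hγ : 0 < γ) (t : ℝ) (z : ℕ) (g : ℝ → ℝ≥0∞) :
    ∫⁻ θ, ENNReal.ofReal (γ ^ ((z : ℝ) + 1 / 2) * θ ^ (2 * z) * Real.exp (-(t * (γ * θ ^ 2)))) *
        g (γ * θ ^ 2)
      = ∫⁻ u in Set.Ioi 0, ENNReal.ofReal (u ^ ((z : ℝ) + 1 / 2 - 1) * Real.exp (-(t * u))) * g u := by
  rw [lintegral_even (by intro x; simp [pow_mul])]
  have himg : (fun θ : ℝ => γ * θ ^ 2) '' Set.Ioi 0 = Set.Ioi 0 := by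
    ext u
    constructor
    · rintro ⟨θ, hθ, rfl⟩
      have hθ : (0 : ℝ) < θ := hθ
      simp only [Set.mem_Ioi]
      positivity
    · intro hu
      have hu : (0 : ℝ) < u := hu
      refine ⟨√(u / γ), by simp only [Set.mem_Ioi]; positivity, ?_⟩
      simp only
      rw [Real.sq_sqrt (by positivity)]
      field_simp
  conv_rhs => rw [← himg]
  rw [lintegral_image_eq_lintegral_abs_deriv_mul measurableSet_Ioi (f' := fun θ => γ * (2 * θ)),
    ← lintegral_const_mul' _ _ (by norm_num)]
  · refine setLIntegral_congr_fun measurableSet_Ioi fun θ hθ => ?_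
    have hθ : (0 : ℝ) < θ := hθ
    rw [← mul_assoc, ← mul_assoc (ENNReal.ofReal |γ * (2 * θ)|)]
    congr 1
    rw [← ENNReal.ofReal_mul (abs_nonneg _), abs_of_pos (by positivity),
      show (2 : ℝ≥0∞) = ENNReal.ofReal 2 by simp, ← ENNReal.ofReal_mul (by norm_num)]
    congr 1
    have hu : 0 < γ * θ ^ 2 := by positivity
    rw [Real.rpow_sub_one hu.ne', rpow_nat_add_half hγ.le, rpow_nat_add_half hu.le,
      Real.sqrt_mul hγ.le, Real.sqrt_sq hθ.le, mul_pow, ← pow_mul]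
    field_simp
  · intro θ _
    have := ((hasDerivAt_pow 2 θ).const_mul γ).hasDerivWithinAt (s := Set.Ioi 0)
    simpa using this
  · intro θ hθ θ' hθ' h
    have hθ : (0 : ℝ) < θ := hθ
    have hθ' : (0 : ℝ) < θ' := hθ'
    exact (pow_left_inj₀ hθ.le hθ'.le two_ne_zero).mp (mul_left_cancel₀ hγ.ne' h)

lemma pi_withDensity {μ : Fin d → Measure ℝ} [∀ i, SigmaFinite (μ i)] {f : Fin d → ℝ → ℝ}
    (hf : ∀ i, Measurable (f i)) :
    Measure.pi (fun i => (μ i).withDensity fun x => ENNReal.ofReal (f i x))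
      = (Measure.pi μ).withDensity fun x => ∏ i, ENNReal.ofReal (f i (x i)) := by
  have hs : ∀ i, SigmaFinite ((μ i).withDensity fun x => ENNReal.ofReal (f i x)) := fun i =>
    SigmaFinite.withDensity_ofReal _
  refine Measure.pi_eq fun s hs => ?_
  rw [withDensity_apply _ (MeasurableSet.univ_pi hs), Measure.restrict_pi_pi,
    lintegral_pi_prod (fun i => (μ i).restrict (s i)) fun i => (hf i).ennreal_ofReal]
  exact Finset.prod_congr rfl fun i _ => (withDensity_apply _ (hs i)).symm

/-- Change of variables `lam_i = γ_i θ_i²` from all of `ℝ^d` to the orthant. -/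
lemma lintegral_orthant_substitution {γ : Fin d → ℝ} (hγ : ∀ i, 0 < γ i) (t : Fin d → ℝ)
    (z : Fin d → ℕ) {g : (Fin d → ℝ) → ℝ≥0∞} (hg : Measurable g) :
    ∫⁻ lam in orthant d, (∏ i, ENNReal.ofReal
        (lam i ^ ((z i : ℝ) + 1 / 2 - 1) * Real.exp (-(t i * lam i)))) * g lam
      = ∫⁻ θ : Fin d → ℝ, (∏ i, ENNReal.ofReal (γ i ^ ((z i : ℝ) + 1 / 2) * θ i ^ (2 * z i) *
          Real.exp (-(t i * (γ i * θ i ^ 2))))) * g fun i => γ i * θ i ^ 2 := by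
  set f : Fin d → ℝ → ℝ := fun i u => u ^ ((z i : ℝ) + 1 / 2 - 1) * Real.exp (-(t i * u)) with hf
  set k : Fin d → ℝ → ℝ := fun i θ => γ i ^ ((z i : ℝ) + 1 / 2) * θ ^ (2 * z i) *
          Real.exp (-(t i * (γ i * θ ^ 2))) with hk
  have hfm : ∀ i, Measurable (f i) := fun i => by rw [hf]; fun_prop
  have hkm : ∀ i, Measurable (k i) := fun i => by rw [hk]; fun_prop
  have hsq : ∀ i, Measurable fun θ : ℝ => γ i * θ ^ 2 := fun i => by fun_prop
  -- The one-dimensional substitution is stated as an equality of image measures, so that it passes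
  -- to products and then to integrands `g` that do not factor.
  have hmap : ∀ i, Measure.map (fun θ : ℝ => γ i * θ ^ 2)
      ((volume : Measure ℝ).withDensity fun x => ENNReal.ofReal (k i x))
      = (volume.restrict (Set.Ioi 0)).withDensity fun x => ENNReal.ofReal (f i x) := by
    intro i
    refine Measure.ext_of_lintegral _ fun g hg => ?_
    have hgc : Measurable fun θ : ℝ => g (γ i * θ ^ 2) := hg.comp (hsq i)
    rw [lintegral_map hg (hsq i), lintegral_withDensity_eq_lintegral_mul _
      (hkm i).ennreal_ofReal hgc, lintegral_withDensity_eq_lintegral_mul _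
      (hfm i).ennreal_ofReal hg]
    exact lintegral_square_substitution (hγ i) (t i) (z i) g
  have hsf : ∀ i, SigmaFinite (Measure.map (fun θ : ℝ => γ i * θ ^ 2)
      ((volume : Measure ℝ).withDensity fun x => ENNReal.ofReal (k i x))) := fun i => by
    rw [hmap i]
    exact SigmaFinite.withDensity_ofReal _
  have hpi := Measure.pi_map_pi (fun i => (hsq i).aemeasurable)
    (μ := fun i => (volume : Measure ℝ).withDensity fun x => ENNReal.ofReal (k i x))
  simp only [hmap] at hpi
  rw [pi_withDensity hfm, pi_withDensity hkm, ← volume_pi, ← restrict_orthant] at hpi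
  have hP : Measurable fun x : Fin d → ℝ => ∏ i, ENNReal.ofReal (f i (x i)) :=
    Finset.measurable_fun_prod _ fun i _ => ((hfm i).comp (measurable_pi_apply i)).ennreal_ofReal
  have hQ : Measurable fun x : Fin d → ℝ => ∏ i, ENNReal.ofReal (k i (x i)) :=
    Finset.measurable_fun_prod _ fun i _ => ((hkm i).comp (measurable_pi_apply i)).ennreal_ofReal
  have hT : Measurable fun (θ : Fin d → ℝ) i => γ i * θ i ^ 2 :=
    measurable_pi_lambda _ fun i => (hsq i).comp (measurable_pi_apply i)
  have h1 := lintegral_withDensity_eq_lintegral_mul (volume.restrict (orthant d)) hP hg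
  have h2 := lintegral_withDensity_eq_lintegral_mul volume hQ (hg.comp hT)
  rw [← hpi, lintegral_map hg hT] at h1
  exact h1.symm.trans h2

/-! ### Posterior means of the shrinkage function -/

/-- Density of a signed square root of a Gamma variable with shape `z + 1/2` and rate `τ`. -/
def signedGammaDensity (z : ℕ) (τ x : ℝ) : ℝ :=
  τ ^ ((z : ℝ) + 1 / 2) / Real.Gamma ((z : ℝ) + 1 / 2) * x ^ (2 * z) * Real.exp (-(τ * x ^ 2))

lemma gamma_half_pos (z : ℕ) : 0 < Real.Gamma ((z : ℝ) + 1 / 2) :=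
  Real.Gamma_pos_of_pos (by positivity)

lemma signedGammaDensity_nonneg (z : ℕ) {τ : ℝ} (hτ : 0 < τ) (x : ℝ) :
    0 ≤ signedGammaDensity z τ x := by
  have := gamma_half_pos z
  rw [signedGammaDensity, pow_mul]
  positivity

lemma signedGammaDensity_pos (z : ℕ) {τ x : ℝ} (hτ : 0 < τ) (hx : x ≠ 0) :
    0 < signedGammaDensity z τ x := by
  have := gamma_half_pos z
  rw [signedGammaDensity, pow_mul]
  positivity

@[fun_prop]
lemma measurable_signedGammaDensity (z : ℕ) (τ : ℝ) : Measurable (signedGammaDensity z τ) := by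
  unfold signedGammaDensity
  fun_prop

lemma lintegral_even_moment {k : ℝ} (hk : 0 < k) (z : ℕ) :
    ∫⁻ θ, ENNReal.ofReal (θ ^ (2 * z) * Real.exp (-(k * θ ^ 2)))
      = ENNReal.ofReal (Real.Gamma ((z : ℝ) + 1 / 2) / k ^ ((z : ℝ) + 1 / 2)) := by
  have h := lintegral_square_substitution one_pos k z fun _ => 1
  simp only [Real.one_rpow, one_mul, mul_one] at h
  rw [h, lintegral_rpow_mul_exp (by positivity) hk]

lemma lintegral_signedGammaDensity (z : ℕ) {τ : ℝ} (hτ : 0 < τ) :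
    ∫⁻ x, ENNReal.ofReal (signedGammaDensity z τ x) = 1 := by
  have hG := gamma_half_pos z
  have hp : 0 < τ ^ ((z : ℝ) + 1 / 2) := by positivity
  simp only [signedGammaDensity, mul_assoc]
  simp only [ENNReal.ofReal_mul (div_pos hp hG).le]
  rw [lintegral_const_mul _ (by fun_prop), lintegral_even_moment hτ,
    ← ENNReal.ofReal_mul (div_pos hp hG).le]
  rw [show τ ^ ((z : ℝ) + 1 / 2) / Real.Gamma ((z : ℝ) + 1 / 2) *
    (Real.Gamma ((z : ℝ) + 1 / 2) / τ ^ ((z : ℝ) + 1 / 2)) = 1 by field_simp, ENNReal.ofReal_one]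

/-- Mean of the shrinkage function when the `θ_i` have densities `signedGammaDensity`. -/
def posteriorMean (V : Submodule ℝ (EuclideanSpace ℝ (Fin d))) (α : ℝ) (τ : Fin d → ℝ)
    (z : Fin d → ℕ) : ℝ≥0∞ :=
  ∫⁻ θ : Fin d → ℝ, shrinkage V α θ * ∏ i, ENNReal.ofReal (signedGammaDensity (z i) (τ i) (θ i))

lemma signFlip_signFlip (a b : Fin d → ℤˣ) (θ : EuclideanSpace ℝ (Fin d)) :
    signFlip a (signFlip b θ) = signFlip (a * b) θ := by
  ext i
  simp [signFlip, mul_assoc]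

lemma subspaceShrinkage_signFlip (V : Submodule ℝ (EuclideanSpace ℝ (Fin d))) (α : ℝ)
    (b : Fin d → ℤˣ) (θ : EuclideanSpace ℝ (Fin d)) :
    subspaceShrinkage V α (signFlip b θ) = subspaceShrinkage V α θ := by
  simp only [subspaceShrinkage, signFlip_signFlip]
  exact Fintype.sum_equiv (Equiv.mulRight b) _ _ fun a => rfl

/-- The sum over all sign vectors makes the shrinkage function even in each coordinate, so its value
at √(λ/γ) = |θ| can be replaced by its value at the signed θ. -/
lemma shrinkage_abs (V : Submodule ℝ (EuclideanSpace ℝ (Fin d))) (α : ℝ) (θ : Fin d → ℝ) :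
    shrinkage V α (fun i => |θ i|) = shrinkage V α θ := by
  have : (WithLp.toLp 2 fun i => |θ i|)
      = signFlip (fun i => if 0 ≤ θ i then 1 else -1) (WithLp.toLp 2 θ) := by
    ext i
    simp only [signFlip]
    split_ifs with h
    · simp [abs_of_nonneg h]
    · simp [abs_of_neg (not_le.mp h)]
  rw [shrinkage, this, subspaceShrinkage_signFlip, shrinkage]

lemma weightedJeffreysPrior_eq (c : Fin d → ℝ) (V : Submodule ℝ (EuclideanSpace ℝ (Fin d)))
    (α : ℝ) (lam : Fin d → ℝ) :
    weightedJeffreysPrior c (subspaceShrinkage V α) lam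
      = shrinkage V α (fun i => √(lam i / c i)) * jeffreysPrior lam := rfl

lemma measurable_weightedJeffreysPrior (c : Fin d → ℝ)
    (V : Submodule ℝ (EuclideanSpace ℝ (Fin d))) (α : ℝ) :
    Measurable (weightedJeffreysPrior c (subspaceShrinkage V α)) := by
  have : Measurable fun lam : Fin d → ℝ => fun i => √(lam i / c i) := by fun_prop
  exact ((measurable_shrinkage V α).comp this).mul measurable_jeffreysPrior

/-- Integrals of a monomial times the shrinkage prior in terms of posterior means. -/
lemma lintegral_monomial_mul_shrinkage (V : Submodule ℝ (EuclideanSpace ℝ (Fin d))) (α : ℝ)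
    {γ t : Fin d → ℝ} (hγ : ∀ i, 0 < γ i) (ht : ∀ i, 0 < t i) (z : Fin d → ℕ) :
    ∫⁻ lam in orthant d, ENNReal.ofReal (∏ i, (lam i ^ z i * Real.exp (-(t i * lam i)))) *
        weightedJeffreysPrior γ (subspaceShrinkage V α) lam
      = ENNReal.ofReal (gammaConst t z) * posteriorMean V α (fun i => t i * γ i) z := by
  have hgm : Measurable fun lam : Fin d → ℝ => shrinkage V α fun i => √(lam i / γ i) :=
    (measurable_shrinkage V α).comp (by fun_prop)
  have h := lintegral_orthant_substitution hγ t z hgm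
  rw [posteriorMean, ← lintegral_const_mul _ ((measurable_shrinkage V α).fun_mul
    (Finset.measurable_fun_prod _ fun i _ => by fun_prop))]
  refine Eq.trans (setLIntegral_congr_fun measurableSet_orthant fun lam hl => ?_)
    (h.trans (lintegral_congr fun θ => ?_))
  · have hl : ∀ i, 0 < lam i := hl
    rw [weightedJeffreysPrior_eq, mul_left_comm, jeffreysPrior, mul_comm (ENNReal.ofReal _),
      ← mul_comm (ENNReal.ofReal _), ← ENNReal.ofReal_mul (Finset.prod_nonneg fun i _ => by
        have := hl i
        positivity), ← ENNReal.ofReal_prod_of_nonneg fun i _ => by have := hl i; positivity,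
      mul_comm, ← Finset.prod_mul_distrib]
    congr 2
    refine Finset.prod_congr rfl fun i _ => ?_
    rw [← pow_mul_rpow_neg_half (hl i)]
    ring
  · have h1 : (fun i => √(γ i * θ i ^ 2 / γ i)) = fun i => |θ i| := by
      ext i
      rw [mul_div_cancel_left₀ _ (hγ i).ne', Real.sqrt_sq_eq_abs]
    rw [h1, shrinkage_abs, mul_left_comm, mul_comm]
    congr 1
    have h2 : ∀ i, 0 ≤ Real.Gamma ((z i : ℝ) + 1 / 2) / t i ^ ((z i : ℝ) + 1 / 2) := fun i =>
      (div_pos (gamma_half_pos _) (Real.rpow_pos_of_pos (ht i) _)).le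
    rw [gammaConst, ENNReal.ofReal_prod_of_nonneg fun i _ => h2 i, ← Finset.prod_mul_distrib]
    refine Finset.prod_congr rfl fun i _ => ?_
    rw [← ENNReal.ofReal_mul (h2 i)]
    congr 1
    have h3 := gamma_half_pos (z i)
    have h4 : 0 < t i ^ ((z i : ℝ) + 1 / 2) := Real.rpow_pos_of_pos (ht i) _
    rw [signedGammaDensity, Real.mul_rpow (ht i).le (hγ i).le, ← mul_assoc (t i)]
    generalize t i ^ ((z i : ℝ) + 1 / 2) = A at h4
    generalize γ i ^ ((z i : ℝ) + 1 / 2) = B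
    generalize Real.Gamma ((z i : ℝ) + 1 / 2) = C at h3
    field_simp

lemma marginal_weightedJeffreysPrior (V : Submodule ℝ (EuclideanSpace ℝ (Fin d))) (α : ℝ)
    {γ r : Fin d → ℝ} (hγ : ∀ i, 0 < γ i) (hr : ∀ i, 0 < r i) (x : Fin d → ℕ) :
    marginal r (weightedJeffreysPrior γ (subspaceShrinkage V α)) x
      = marginal r jeffreysPrior x * posteriorMean V α (fun i => r i * γ i) x := by
  have hc := countConst_pos hr x
  rw [← dampedJeffreys_zero, marginal_dampedJeffreys hr le_rfl, ENNReal.ofReal_mul hc.le, mul_assoc]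
  simp only [add_zero]
  rw [← lintegral_monomial_mul_shrinkage V α hγ hr, ← lintegral_const_mul _
    ((by fun_prop : Measurable _).fun_mul (measurable_weightedJeffreysPrior γ V α)), marginal]
  refine lintegral_congr fun lam => ?_
  rw [poissonLik_eq_const_mul, ENNReal.ofReal_mul hc.le, mul_assoc]

lemma jointMarginal_weightedJeffreysPrior (V : Submodule ℝ (EuclideanSpace ℝ (Fin d))) (α : ℝ)
    {γ r s : Fin d → ℝ} (hγ : ∀ i, 0 < γ i) (hr : ∀ i, 0 < r i) (hs : ∀ i, 0 < s i)
    (x y : Fin d → ℕ) :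
    jointMarginal r s (weightedJeffreysPrior γ (subspaceShrinkage V α)) x y
      = jointMarginal r s jeffreysPrior x y *
          posteriorMean V α (fun i => (r i + s i) * γ i) (x + y) := by
  have hc := mul_pos (countConst_pos hr x) (countConst_pos hs y)
  rw [← dampedJeffreys_zero, jointMarginal_dampedJeffreys hr hs le_rfl, ENNReal.ofReal_mul hc.le,
    mul_assoc]
  simp only [add_zero]
  rw [← lintegral_monomial_mul_shrinkage V α hγ (fun i => add_pos (hr i) (hs i)),
    ← lintegral_const_mul _
    ((by fun_prop : Measurable _).fun_mul (measurable_weightedJeffreysPrior γ V α)), jointMarginal]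
  refine setLIntegral_congr_fun measurableSet_orthant fun lam hl => ?_
  rw [← ENNReal.ofReal_mul (poissonLik_pos hr hl x).le, poissonLik_eq_const_mul,
    poissonLik_eq_const_mul, mul_mul_mul_comm, ENNReal.ofReal_mul hc.le, mul_assoc,
    ← Finset.prod_mul_distrib]
  congr 3
  refine Finset.prod_congr rfl fun i _ => ?_
  rw [add_mul, neg_add, Real.exp_add, Pi.add_apply, pow_add]
  ring

/-! ### Binomial mixtures and Gaussian perturbations -/

lemma sum_range_even (a : ℕ → ℝ) (h : ∀ j, a (2 * j + 1) = 0) (w : ℕ) :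
    ∑ m ∈ Finset.range (2 * w + 1), a m = ∑ j ∈ Finset.range (w + 1), a (2 * j) := by
  induction w with
  | zero => simp
  | succ w ih =>
    rw [show 2 * (w + 1) + 1 = 2 * w + 1 + 1 + 1 by ring, Finset.sum_range_succ,
      Finset.sum_range_succ, ih, h, Finset.sum_range_succ _ (w + 1)]
    simp [mul_add]

lemma add_pow_add_sub_pow (m v : ℝ) (w : ℕ) :
    (v + m) ^ (2 * w) + (-v + m) ^ (2 * w) = 2 * ∑ x ∈ Finset.range (w + 1),
      ((2 * w).choose (2 * x) : ℝ) * m ^ (2 * x) * v ^ (2 * (w - x)) := by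
  rw [add_comm v, add_comm (-v), add_pow, add_pow, ← Finset.sum_add_distrib, Finset.mul_sum,
    sum_range_even]
  · refine Finset.sum_congr rfl fun x _ => ?_
    rw [← Nat.mul_sub, Even.neg_pow (even_two_mul _)]
    ring
  · intro j
    rcases lt_or_ge (2 * w) (2 * j + 1) with h | h
    · simp [Nat.choose_eq_zero_of_lt h]
    · rw [Odd.neg_pow ⟨w - j - 1, by omega⟩]
      ring

lemma gamma_nat_add_half_eq (n : ℕ) :
    Real.Gamma ((n : ℝ) + 1 / 2) * (4 ^ n * n.factorial) = (2 * n).factorial * √Real.pi := by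
  induction n with
  | zero => simpa [one_div] using Real.Gamma_one_half_eq
  | succ n ih =>
    have h : ((n + 1 : ℕ) : ℝ) + 1 / 2 = ((n : ℝ) + 1 / 2) + 1 := by push_cast; ring
    rw [h, Real.Gamma_add_one (by positivity), show 2 * (n + 1) = 2 * n + 1 + 1 by ring,
      Nat.factorial_succ, Nat.factorial_succ, Nat.factorial_succ, pow_succ]
    push_cast
    linear_combination (4 * ((n : ℝ) + 1 / 2) * (n + 1)) * ih

/-- Follows from Γ(n + 1/2) = (2n)! √π / (4^n n!), the powers of 4 cancelling. It converts the even
binomial coefficients produced by Gaussian smoothing into the ordinary ones of binomial thinning. -/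
lemma choose_mul_gamma (x y : ℕ) :
    ((2 * (x + y)).choose (2 * x) : ℝ) * Real.Gamma ((y : ℝ) + 1 / 2) *
        Real.Gamma ((x : ℝ) + 1 / 2)
      = ((x + y).choose x : ℝ) * Real.Gamma (((x + y : ℕ) : ℝ) + 1 / 2) * √Real.pi := by
  have hG : ∀ n : ℕ, Real.Gamma ((n : ℝ) + 1 / 2)
      = (2 * n).factorial * √Real.pi / (4 ^ n * n.factorial) := fun n =>
    eq_div_of_mul_eq (by positivity) (gamma_nat_add_half_eq n)
  rw [hG, hG, hG, Nat.cast_choose ℝ (by omega : 2 * x ≤ 2 * (x + y)),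
    Nat.cast_choose ℝ (by omega : x ≤ x + y), show 2 * (x + y) - 2 * x = 2 * y by omega,
    Nat.add_sub_cancel_left]
  field_simp
  ring

lemma lintegral_shifted_moment {k : ℝ} (hk : 0 < k) (m : ℝ) (w : ℕ) :
    ∫⁻ v, ENNReal.ofReal ((v + m) ^ (2 * w) * Real.exp (-(k * v ^ 2)))
      = ∑ x ∈ Finset.range (w + 1), ENNReal.ofReal (((2 * w).choose (2 * x) : ℝ) * m ^ (2 * x) *
          (Real.Gamma (((w - x : ℕ) : ℝ) + 1 / 2) / k ^ (((w - x : ℕ) : ℝ) + 1 / 2))) := by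
  -- Symmetrizing in v removes the odd powers before integration; the remaining terms are
  -- nonnegative, so the integral splits termwise.
  have hneg : ∫⁻ v, ENNReal.ofReal ((-v + m) ^ (2 * w) * Real.exp (-(k * v ^ 2)))
      = ∫⁻ v, ENNReal.ofReal ((v + m) ^ (2 * w) * Real.exp (-(k * v ^ 2))) := by
    have := lintegral_neg_eq_self (μ := (volume : Measure ℝ))
      fun v : ℝ => ENNReal.ofReal ((v + m) ^ (2 * w) * Real.exp (-(k * v ^ 2)))
    simpa only [neg_sq] using this
  have hev : ∀ (x : ℕ) (u : ℝ), 0 ≤ u ^ (2 * x) := fun x u => (even_two_mul x).pow_nonneg u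
  have h2 : 2 * ∫⁻ v, ENNReal.ofReal ((v + m) ^ (2 * w) * Real.exp (-(k * v ^ 2)))
      = 2 * ∑ x ∈ Finset.range (w + 1), ENNReal.ofReal (((2 * w).choose (2 * x) : ℝ) * m ^ (2 * x) *
          (Real.Gamma (((w - x : ℕ) : ℝ) + 1 / 2) / k ^ (((w - x : ℕ) : ℝ) + 1 / 2))) := by
    rw [two_mul]
    nth_rewrite 2 [← hneg]
    rw [← lintegral_add_left (by fun_prop)]
    have hpt : ∀ v : ℝ, ENNReal.ofReal ((v + m) ^ (2 * w) * Real.exp (-(k * v ^ 2))) +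
        ENNReal.ofReal ((-v + m) ^ (2 * w) * Real.exp (-(k * v ^ 2)))
        = 2 * ∑ x ∈ Finset.range (w + 1), ENNReal.ofReal (((2 * w).choose (2 * x) : ℝ) *
            m ^ (2 * x)) * ENNReal.ofReal (v ^ (2 * (w - x)) * Real.exp (-(k * v ^ 2))) := by
      intro v
      rw [← ENNReal.ofReal_add (mul_nonneg (hev _ _) (Real.exp_pos _).le)
        (mul_nonneg (hev _ _) (Real.exp_pos _).le), ← add_mul, add_pow_add_sub_pow, mul_assoc,
        ENNReal.ofReal_mul zero_le_two, ENNReal.ofReal_ofNat, Finset.sum_mul,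
        ENNReal.ofReal_sum_of_nonneg fun x _ => mul_nonneg (mul_nonneg (mul_nonneg
          (Nat.cast_nonneg _) (hev _ _)) (hev _ _)) (Real.exp_pos _).le]
      congr 1
      refine Finset.sum_congr rfl fun x _ => ?_
      rw [mul_assoc, ENNReal.ofReal_mul (mul_nonneg (Nat.cast_nonneg _) (hev _ _))]
    simp only [hpt]
    rw [lintegral_const_mul _ (Finset.measurable_fun_sum _ fun x _ => by fun_prop),
      lintegral_finsetSum _ fun x _ => by fun_prop]
    congr 1
    refine Finset.sum_congr rfl fun x _ => ?_
    rw [lintegral_const_mul _ (by fun_prop), lintegral_even_moment hk,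
      ← ENNReal.ofReal_mul (mul_nonneg (Nat.cast_nonneg _) (hev _ _))]
  exact (ENNReal.mul_right_inj two_ne_zero (by norm_num)).mp h2

/-- Smoothing a signed root Gamma density by a Gaussian gives a binomial mixture of such
densities. -/
lemma lintegral_signedGammaDensity_mul_gaussian {τ : ℝ} (hτ : 0 < τ) (w : ℕ) (φ : ℝ) :
    ∫⁻ θ, ENNReal.ofReal (signedGammaDensity w τ θ) *
        ENNReal.ofReal (√(1 / Real.pi) * Real.exp (-(1 * (φ - θ) ^ 2)))
      = ∑ x ∈ Finset.range (w + 1), ENNReal.ofReal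
          ((w.choose x : ℝ) * (1 / (1 + τ)) ^ x * (τ / (1 + τ)) ^ (w - x)) *
          ENNReal.ofReal (signedGammaDensity x (τ / (1 + τ)) φ) := by
  set k := 1 + τ with hk
  have hk0 : 0 < k := by positivity
  set K := τ ^ ((w : ℝ) + 1 / 2) / Real.Gamma ((w : ℝ) + 1 / 2) * √(1 / Real.pi) *
    Real.exp (-(τ / k * φ ^ 2)) with hK
  have hGw := gamma_half_pos w
  have hK0 : 0 ≤ K := by positivity
  have hpt : ∀ θ : ℝ, ENNReal.ofReal (signedGammaDensity w τ θ) *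
      ENNReal.ofReal (√(1 / Real.pi) * Real.exp (-(1 * (φ - θ) ^ 2)))
      = ENNReal.ofReal K * ENNReal.ofReal
        ((θ - φ / k + φ / k) ^ (2 * w) * Real.exp (-(k * (θ - φ / k) ^ 2))) := by
    intro θ
    rw [← ENNReal.ofReal_mul (signedGammaDensity_nonneg w hτ θ), ← ENNReal.ofReal_mul hK0,
      signedGammaDensity, hK, sub_add_cancel]
    -- Completing the square: τθ² + (φ-θ)² = (τ/k)φ² + k(θ - φ/k)² with k = 1 + τ.
    have : Real.exp (-(τ * θ ^ 2)) * Real.exp (-(1 * (φ - θ) ^ 2))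
        = Real.exp (-(τ / k * φ ^ 2)) * Real.exp (-(k * (θ - φ / k) ^ 2)) := by
      rw [← Real.exp_add, ← Real.exp_add]
      congr 1
      field_simp
      rw [hk]
      ring
    congr 1
    linear_combination (τ ^ ((w : ℝ) + 1 / 2) / Real.Gamma ((w : ℝ) + 1 / 2) * √(1 / Real.pi) *
      θ ^ (2 * w)) * this
  simp only [hpt]
  rw [lintegral_sub_right_eq_self (fun v : ℝ => ENNReal.ofReal K * ENNReal.ofReal
    ((v + φ / k) ^ (2 * w) * Real.exp (-(k * v ^ 2)))) (φ / k),
    lintegral_const_mul _ (by fun_prop), lintegral_shifted_moment hk0, Finset.mul_sum]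
  refine Finset.sum_congr rfl fun x hx => ?_
  obtain ⟨y, rfl⟩ := Nat.exists_eq_add_of_le (Nat.lt_succ_iff.mp (Finset.mem_range.mp hx))
  rw [← ENNReal.ofReal_mul hK0, ← ENNReal.ofReal_mul (by positivity), hK, signedGammaDensity,
    Nat.add_sub_cancel_left]
  congr 1
  have h := choose_mul_gamma x y
  have hGx := gamma_half_pos x
  have hGy := gamma_half_pos y
  rw [rpow_nat_add_half hτ.le, rpow_nat_add_half hk0.le, rpow_nat_add_half (by positivity),
    Real.sqrt_div hτ.le, Real.sqrt_div zero_le_one, Real.sqrt_one]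
  generalize Real.Gamma (((x + y : ℕ) : ℝ) + 1 / 2) = G at *
  generalize Real.Gamma ((x : ℝ) + 1 / 2) = G1 at *
  generalize Real.Gamma ((y : ℝ) + 1 / 2) = G2 at *
  have hkx : 0 < √k := Real.sqrt_pos.mpr hk0
  have hpi : 0 < √Real.pi := Real.sqrt_pos.mpr Real.pi_pos
  generalize √k = k2 at *
  generalize √τ = t2
  generalize √Real.pi = p2 at *
  generalize Real.exp (-(τ / k * φ ^ 2)) = e
  generalize ((2 * (x + y)).choose (2 * x) : ℝ) = c1 at *
  generalize ((x + y).choose x : ℝ) = c2 at *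
  have hc : c1 * G2 / (G * p2) = c2 / G1 := by
    rw [div_eq_div_iff (by positivity) (by positivity)]
    linear_combination h
  have hl : τ ^ (x + y) * t2 / G * (1 / p2) * e * (c1 * (φ / k) ^ (2 * x) * (G2 / (k ^ y * k2)))
      = (c1 * G2 / (G * p2)) * (τ ^ (x + y) * t2 * e * (φ / k) ^ (2 * x) / (k ^ y * k2)) := by
    field_simp
  rw [hl, hc]
  simp only [div_pow, pow_add, pow_mul, one_pow]
  field_simp
  ring_nf

/-! ### Strict improvement under binomial thinning -/

/-- Product of binomial mass functions with `w i` trials and success probability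
`1 / (1 + τ i)`. -/
def thinning (τ : Fin d → ℝ) (w x : Fin d → ℕ) : ℝ :=
  ∏ i, (((w i).choose (x i) : ℝ) * (1 / (1 + τ i)) ^ x i * (τ i / (1 + τ i)) ^ (w i - x i))

/-- The counts below `w`. -/
def countsBelow (w : Fin d → ℕ) : Finset (Fin d → ℕ) :=
  Fintype.piFinset fun i => Finset.range (w i + 1)

lemma mem_countsBelow {w x : Fin d → ℕ} : x ∈ countsBelow w ↔ x ≤ w := by
  simp [countsBelow, Pi.le_def]

lemma thinning_pos {τ : Fin d → ℝ} (hτ : ∀ i, 0 < τ i) {w x : Fin d → ℕ} (h : x ≤ w) :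
    0 < thinning τ w x :=
  Finset.prod_pos fun i _ => by
    have h1 := hτ i
    have h2 : 0 < (w i).choose (x i) := Nat.choose_pos (h i)
    positivity

lemma lintegral_prod_signedGammaDensity_mul_heatKernel {τ : Fin d → ℝ} (hτ : ∀ i, 0 < τ i)
    (w : Fin d → ℕ) (φ : Fin d → ℝ) :
    ∫⁻ θ : Fin d → ℝ, (∏ i, ENNReal.ofReal (signedGammaDensity (w i) (τ i) (θ i))) *
        ENNReal.ofReal (heatKernel 1 φ θ)
      = ∑ x ∈ countsBelow w, ENNReal.ofReal (thinning τ w x) *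
          ∏ i, ENNReal.ofReal (signedGammaDensity (x i) (τ i / (1 + τ i)) (φ i)) := by
  have h1 : ∀ θ : Fin d → ℝ,
      (∏ i, ENNReal.ofReal (signedGammaDensity (w i) (τ i) (θ i))) *
        ENNReal.ofReal (heatKernel 1 φ θ)
      = ∏ i, (ENNReal.ofReal (signedGammaDensity (w i) (τ i) (θ i)) *
        ENNReal.ofReal (√(1 / Real.pi) * Real.exp (-(1 * (φ i - θ i) ^ 2)))) := by
    intro θ
    rw [heatKernel, ENNReal.ofReal_prod_of_nonneg fun i _ => by positivity,
      Finset.prod_mul_distrib]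
  rw [lintegral_congr h1, volume_pi, lintegral_pi_prod (fun _ => (volume : Measure ℝ))
    (f := fun i θ => ENNReal.ofReal (signedGammaDensity (w i) (τ i) θ) *
        ENNReal.ofReal (√(1 / Real.pi) * Real.exp (-(1 * (φ i - θ) ^ 2))))
    fun i => by fun_prop]
  rw [Finset.prod_congr rfl fun i _ => lintegral_signedGammaDensity_mul_gaussian (hτ i) (w i) (φ i),
    Finset.prod_univ_sum]
  refine Finset.sum_congr rfl fun x _ => ?_
  rw [Finset.prod_mul_distrib, thinning, ENNReal.ofReal_prod_of_nonneg fun i _ => by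
    have := hτ i
    positivity]

lemma measurable_heatKernel : Measurable fun p : (Fin d → ℝ) × (Fin d → ℝ) =>
    ENNReal.ofReal (heatKernel 1 p.2 p.1) := by
  unfold heatKernel
  exact Measurable.ennreal_ofReal (Finset.measurable_fun_prod _ fun i _ => by fun_prop)

/-- By Tonelli the Gaussian kernel is moved from the shrinkage function to the density, where
smoothing produces the binomial mixture. Thus averaging A over the thinned counts equals averaging
the smoothed function under the posterior given `w`. -/
lemma lintegral_mul_heatAverage (V : Submodule ℝ (EuclideanSpace ℝ (Fin d))) (α : ℝ)
    {τ : Fin d → ℝ} (hτ : ∀ i, 0 < τ i) (w : Fin d → ℕ) :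
    ∫⁻ θ : Fin d → ℝ, heatAverage V α 1 θ *
        ∏ i, ENNReal.ofReal (signedGammaDensity (w i) (τ i) (θ i))
      = ∑ x ∈ countsBelow w, ENNReal.ofReal (thinning τ w x) *
          posteriorMean V α (fun i => τ i / (1 + τ i)) x := by
  have hsm := measurable_shrinkage V α
  have hD : ∀ (z : Fin d → ℕ) (τ : Fin d → ℝ), Measurable fun θ : Fin d → ℝ =>
      ∏ i, ENNReal.ofReal (signedGammaDensity (z i) (τ i) (θ i)) := fun z τ =>
    Finset.measurable_fun_prod _ fun i _ => by fun_prop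
  have hK := measurable_heatKernel (d := d)
  have hK2 : ∀ θ, Measurable fun φ : Fin d → ℝ => ENNReal.ofReal (heatKernel 1 φ θ) :=
    fun θ => Measurable.of_uncurry_left (f := fun θ φ => ENNReal.ofReal (heatKernel 1 φ θ)) hK
  have hK1 : ∀ φ, Measurable fun θ : Fin d → ℝ => ENNReal.ofReal (heatKernel 1 φ θ) :=
    fun φ => Measurable.of_uncurry_right (f := fun θ φ => ENNReal.ofReal (heatKernel 1 φ θ)) hK
  have h1 : ∫⁻ θ : Fin d → ℝ, heatAverage V α 1 θ *
        ∏ i, ENNReal.ofReal (signedGammaDensity (w i) (τ i) (θ i))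
      = ∫⁻ θ : Fin d → ℝ, ∫⁻ φ : Fin d → ℝ, shrinkage V α φ *
        ((∏ i, ENNReal.ofReal (signedGammaDensity (w i) (τ i) (θ i))) *
          ENNReal.ofReal (heatKernel 1 φ θ)) := by
    refine lintegral_congr fun θ => ?_
    rw [heatAverage, ← lintegral_mul_const _ (hsm.fun_mul (hK2 θ))]
    refine lintegral_congr fun φ => ?_
    rw [mul_assoc, mul_comm (ENNReal.ofReal _)]
  have hJ : Measurable (Function.uncurry fun θ φ : Fin d → ℝ => shrinkage V α φ *
      ((∏ i, ENNReal.ofReal (signedGammaDensity (w i) (τ i) (θ i))) *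
        ENNReal.ofReal (heatKernel 1 φ θ))) :=
    (hsm.comp measurable_snd).mul (((hD w τ).comp measurable_fst).mul hK)
  rw [h1, lintegral_lintegral_swap hJ.aemeasurable]
  simp only [posteriorMean]
  have h2 : ∀ φ : Fin d → ℝ, ∫⁻ θ : Fin d → ℝ, shrinkage V α φ *
        ((∏ i, ENNReal.ofReal (signedGammaDensity (w i) (τ i) (θ i))) *
          ENNReal.ofReal (heatKernel 1 φ θ))
      = ∑ x ∈ countsBelow w, ENNReal.ofReal (thinning τ w x) * (shrinkage V α φ *
          ∏ i, ENNReal.ofReal (signedGammaDensity (x i) (τ i / (1 + τ i)) (φ i))) := by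
    intro φ
    rw [lintegral_const_mul _ ((hD w τ).fun_mul (hK1 φ)),
      lintegral_prod_signedGammaDensity_mul_heatKernel hτ, Finset.mul_sum]
    exact Finset.sum_congr rfl fun x _ => mul_left_comm _ _ _
  rw [lintegral_congr h2, lintegral_finsetSum _ fun x _ => (hsm.fun_mul (hD x _)).const_mul _]
  exact Finset.sum_congr rfl fun x _ => lintegral_const_mul _ (hsm.fun_mul (hD x _))

lemma lintegral_prod_signedGammaDensity {τ : Fin d → ℝ} (hτ : ∀ i, 0 < τ i) (w : Fin d → ℕ) :
    ∫⁻ θ : Fin d → ℝ, ∏ i, ENNReal.ofReal (signedGammaDensity (w i) (τ i) (θ i)) = 1 := by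
  rw [volume_pi, lintegral_pi_prod (fun _ => (volume : Measure ℝ)) (f := fun i θ =>
    ENNReal.ofReal (signedGammaDensity (w i) (τ i) θ)) fun i => by fun_prop]
  simp only [lintegral_signedGammaDensity _ (hτ _), Finset.prod_const_one]

lemma sum_thinning_posteriorMean_ne_top (V : Submodule ℝ (EuclideanSpace ℝ (Fin d))) {α : ℝ} (hα : 0 < α)
    (hαV : α ≤ ((d : ℝ) - (Module.finrank ℝ V : ℝ) - 2) / 2) {τ : Fin d → ℝ} (hτ : ∀ i, 0 < τ i)
    (w : Fin d → ℕ) :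
    ∑ x ∈ countsBelow w, ENNReal.ofReal (thinning τ w x) *
      posteriorMean V α (fun i => τ i / (1 + τ i)) x ≠ ∞ := by
  rw [← lintegral_mul_heatAverage V α hτ w]
  refine ne_top_of_le_ne_top (b := (∑ _a : Fin d → ℤˣ, ENNReal.ofReal (Real.exp 1)) *
    ∫⁻ θ : Fin d → ℝ, ∏ i, ENNReal.ofReal (signedGammaDensity (w i) (τ i) (θ i))) ?_ ?_
  · rw [lintegral_prod_signedGammaDensity hτ, mul_one]
    exact ENNReal.sum_ne_top.mpr fun _ _ => ENNReal.ofReal_ne_top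
  · rw [← lintegral_const_mul _ (Finset.measurable_fun_prod _ fun i _ => by fun_prop)]
    exact lintegral_mono fun θ => mul_le_mul_left (heatAverage_lt_and_le V hα hαV one_pos θ).2 _

/-- The heat average lies strictly below the shrinkage function at every point. Its mean is finite,
so strictness survives integration. -/
lemma sum_thinning_posteriorMean_lt (V : Submodule ℝ (EuclideanSpace ℝ (Fin d))) {α : ℝ} (hα : 0 < α)
    (hαV : α ≤ ((d : ℝ) - (Module.finrank ℝ V : ℝ) - 2) / 2) {τ : Fin d → ℝ} (hτ : ∀ i, 0 < τ i)
    (w : Fin d → ℕ) :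
    ∑ x ∈ countsBelow w, ENNReal.ofReal (thinning τ w x) *
      posteriorMean V α (fun i => τ i / (1 + τ i)) x < posteriorMean V α τ w := by
  have hfin := sum_thinning_posteriorMean_ne_top V hα hαV hτ w
  rw [← lintegral_mul_heatAverage V α hτ w] at hfin ⊢
  refine lintegral_strict_mono (NeZero.ne _) ((measurable_shrinkage V α).mul
    (Finset.measurable_fun_prod _ fun i _ => by fun_prop)).aemeasurable hfin ?_
  -- The density vanishes on coordinate hyperplanes when a count is positive; they form a null set.
  have hne : ∀ᵐ θ : Fin d → ℝ, ∀ i, θ i ≠ 0 :=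
    ae_all_iff.mpr fun i => Measure.ae_eval_ne (fun _ => (volume : Measure ℝ)) i 0
  filter_upwards [hne] with θ hθ
  simp only [mul_comm _ (∏ i, ENNReal.ofReal _)]
  refine ENNReal.mul_lt_mul_right (Finset.prod_ne_zero_iff.mpr fun i _ => ?_)
    (ENNReal.prod_ne_top fun i _ => ENNReal.ofReal_ne_top)
    (heatAverage_lt_and_le V hα hαV one_pos θ).1
  simpa using signedGammaDensity_pos (w i) (hτ i) (hθ i)

lemma posteriorMean_ne_zero (V : Submodule ℝ (EuclideanSpace ℝ (Fin d))) {α : ℝ} (hα : 0 < α)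
    (hαV : α ≤ ((d : ℝ) - (Module.finrank ℝ V : ℝ) - 2) / 2) {τ : Fin d → ℝ} (hτ : ∀ i, 0 < τ i)
    (w : Fin d → ℕ) : posteriorMean V α τ w ≠ 0 :=
  (zero_le.trans_lt (sum_thinning_posteriorMean_lt V hα hαV hτ w)).ne'

/-- The term x = w of a finite mixture has positive weight, so its posterior mean is finite. This
makes the shrinkage prior yield a well-defined predictive distribution. -/
lemma posteriorMean_div_ne_top (V : Submodule ℝ (EuclideanSpace ℝ (Fin d))) {α : ℝ} (hα : 0 < α)
    (hαV : α ≤ ((d : ℝ) - (Module.finrank ℝ V : ℝ) - 2) / 2) {τ : Fin d → ℝ} (hτ : ∀ i, 0 < τ i)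
    (x : Fin d → ℕ) :
    posteriorMean V α (fun i => τ i / (1 + τ i)) x ≠ ∞ := by
  have h := ENNReal.sum_ne_top.mp (sum_thinning_posteriorMean_ne_top V hα hαV hτ x) x
    (mem_countsBelow.mpr le_rfl)
  intro htop
  rw [htop, ENNReal.mul_top (by simpa using thinning_pos hτ le_rfl)] at h
  exact h rfl

/-! ### Domination -/

/-- Given the total w = x + y, the law of x is binomial and free of λ; hence an inequality for each
`w` gives one for every λ. -/
lemma poissonLik_mul_poissonLik {r s : Fin d → ℝ} (hr : ∀ i, 0 < r i) (hs : ∀ i, 0 < s i)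
    (lam : Fin d → ℝ) (x y : Fin d → ℕ) :
    poissonLik r lam x * poissonLik s lam y
      = poissonLik (r + s) lam (x + y) * thinning (fun i => s i / r i) (x + y) x := by
  rw [poissonLik, poissonLik, poissonLik, thinning, ← Finset.prod_mul_distrib,
    ← Finset.prod_mul_distrib]
  refine Finset.prod_congr rfl fun i _ => ?_
  have h1 := hr i
  have h2 := hs i
  have h3 : 1 + s i / r i = (r i + s i) / r i := by field_simp
  simp only [Pi.add_apply]
  rw [h3, Nat.add_sub_cancel_left, Nat.cast_choose ℝ (Nat.le_add_right _ _),
    Nat.add_sub_cancel_left, add_mul, neg_add, Real.exp_add, ← add_mul,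
    show 1 / ((r i + s i) / r i) = r i / (r i + s i) by field_simp,
    show s i / r i / ((r i + s i) / r i) = s i / (r i + s i) by field_simp]
  simp only [mul_pow, div_pow, pow_add]
  field_simp

open Classical in
lemma tsum_tsum_add (F : (Fin d → ℕ) → (Fin d → ℕ) → ℝ≥0∞) :
    ∑' x, ∑' y, F x (x + y) = ∑' w, ∑ x ∈ countsBelow w, F x w := by
  have h1 : ∀ x, ∑' y, F x (x + y) = ∑' w, if x ≤ w then F x w else 0 := by
    intro x
    rw [← (add_right_injective x).tsum_eq (f := fun w => if x ≤ w then F x w else 0)]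
    · simp
    · intro w hw
      by_cases h : x ≤ w
      · exact ⟨w - x, add_tsub_cancel_of_le h⟩
      · simp [h] at hw
  simp only [h1]
  rw [ENNReal.tsum_comm]
  refine tsum_congr fun w => ?_
  rw [tsum_eq_sum (s := countsBelow w) fun x hx => if_neg fun h => hx (mem_countsBelow.mpr h)]
  exact Finset.sum_congr rfl fun x hx => if_pos (mem_countsBelow.mp hx)

lemma tsum_thinning_ratio_lt_one {r s lam : Fin d → ℝ} (hr : ∀ i, 0 < r i) (hs : ∀ i, 0 < s i)
    (hl : ∀ i, 0 < lam i) {A B : (Fin d → ℕ) → ℝ≥0∞}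
    (hAB : ∀ w, ∑ x ∈ countsBelow w,
      ENNReal.ofReal (thinning (fun i => s i / r i) w x) * A x < B w) :
    ∑' x, ∑' y, ENNReal.ofReal (poissonLik r lam x) * ENNReal.ofReal (poissonLik s lam y) *
      (A x / B (x + y)) < 1 := by
  have hrs : ∀ i, 0 < (r + s) i := fun i => add_pos (hr i) (hs i)
  have h1 : ∀ x y, ENNReal.ofReal (poissonLik r lam x) * ENNReal.ofReal (poissonLik s lam y) *
      (A x / B (x + y)) = ENNReal.ofReal (poissonLik (r + s) lam (x + y)) *
        (ENNReal.ofReal (thinning (fun i => s i / r i) (x + y) x) * A x / B (x + y)) := by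
    intro x y
    rw [← ENNReal.ofReal_mul (poissonLik_pos hr hl x).le, poissonLik_mul_poissonLik hr hs,
      ENNReal.ofReal_mul (poissonLik_pos hrs hl _).le, mul_assoc, mul_div_assoc]
  simp only [h1]
  rw [tsum_tsum_add fun x w => ENNReal.ofReal (poissonLik (r + s) lam w) *
        (ENNReal.ofReal (thinning (fun i => s i / r i) w x) * A x / B w)]
  have h2 : ∀ w, ∑ x ∈ countsBelow w, ENNReal.ofReal (poissonLik (r + s) lam w) *
      (ENNReal.ofReal (thinning (fun i => s i / r i) w x) * A x / B w)
      < ENNReal.ofReal (poissonLik (r + s) lam w) := by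
    intro w
    simp only [← Finset.mul_sum, div_eq_mul_inv, ← Finset.sum_mul]
    rw [← div_eq_mul_inv]
    conv_rhs => rw [← mul_one (ENNReal.ofReal _)]
    refine ENNReal.mul_lt_mul_right (ofReal_poissonLik_ne_zero hrs hl w) ENNReal.ofReal_ne_top ?_
    exact ENNReal.div_lt_of_lt_mul (by rw [one_mul]; exact hAB w)
  rw [← tsum_poissonLik hrs hl]
  -- Each conditional expectation is strictly below 1; one strict term, here w = 0, is enough for
  -- the convergent series.
  refine ENNReal.tsum_lt_tsum (i := 0) ?_ (fun w => (h2 w).le) (h2 0)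
  refine ne_top_of_le_ne_top ?_ (ENNReal.tsum_le_tsum fun w => (h2 w).le)
  rw [tsum_poissonLik hrs hl]
  exact ENNReal.one_ne_top

/-! ### Gamma rates of the two posteriors and the domination theorem -/

lemma durationScale_pos {r s : Fin d → ℝ} (hr : ∀ i, 0 < r i) (hs : ∀ i, 0 < s i) (i : Fin d) :
    0 < durationScale r s i := by
  have h1 := hr i
  have h2 := hs i
  rw [durationScale, sub_pos]
  exact one_div_lt_one_div_of_lt h1 (by linarith)

/-- With τ = s/r, the scale γ makes the rates in θ equal to τ/(1+τ) given x and τ given (x, y).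
Their reciprocals differ by exactly 1 in every coordinate, so one isotropic Gaussian kernel with c =
1 links the two posteriors even when durations differ. -/
lemma observed_rate {r s : Fin d → ℝ} (hr : ∀ i, 0 < r i) (hs : ∀ i, 0 < s i) (i : Fin d) :
    r i * durationScale r s i = s i / r i / (1 + s i / r i) := by
  have h1 := hr i
  have h2 := hs i
  rw [durationScale]
  field_simp
  ring

lemma total_rate {r s : Fin d → ℝ} (hr : ∀ i, 0 < r i) (hs : ∀ i, 0 < s i) (i : Fin d) :
    (r i + s i) * durationScale r s i = s i / r i := by
  have h1 := hr i
  have h2 := hs i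
  rw [durationScale]
  field_simp
  ring

lemma marginal_jeffreysPrior_ne_zero_ne_top {r : Fin d → ℝ} (hr : ∀ i, 0 < r i) (x : Fin d → ℕ) :
    marginal r jeffreysPrior x ≠ 0 ∧ marginal r jeffreysPrior x ≠ ∞ := by
  rw [← dampedJeffreys_zero, marginal_dampedJeffreys hr le_rfl]
  refine ⟨?_, ENNReal.ofReal_ne_top⟩
  have := mul_pos (countConst_pos hr x) (gammaConst_pos (t := fun i => r i + 0)
    (fun i => add_pos_of_pos_of_nonneg (hr i) le_rfl) x)
  simpa using this

/-- Ratio of two predictive probabilities in terms of the weights of the marginals. -/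
lemma ennreal_div_div_div_mul {J M A B : ℝ≥0∞} (hJ : J ≠ 0) (hJ' : J ≠ ∞) (hM : M ≠ 0)
    (hM' : M ≠ ∞) (hA : A ≠ 0) (hA' : A ≠ ∞) : J / M / (J * B / (M * A)) = A / B := by
  rw [ENNReal.mul_div_mul_comm (Or.inl hM) (Or.inl hM'), ENNReal.div_eq_inv_mul, ENNReal.mul_inv
    (Or.inl (ENNReal.div_ne_zero.mpr ⟨hJ, hM'⟩)) (Or.inl (ENNReal.div_ne_top hJ' hM)), mul_right_comm,
    ENNReal.inv_mul_cancel (ENNReal.div_ne_zero.mpr ⟨hJ, hM'⟩) (ENNReal.div_ne_top hJ' hM), one_mul,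
    ENNReal.inv_div (Or.inl hA') (Or.inl hA)]

lemma dominatesNearlyMinimax_durationScale (V : Submodule ℝ (EuclideanSpace ℝ (Fin d))) {α : ℝ}
    (hα : 0 < α) (hαV : α ≤ ((d : ℝ) - (Module.finrank ℝ V : ℝ) - 2) / 2) {r s : Fin d → ℝ}
    (hr : ∀ i, 0 < r i) (hs : ∀ i, 0 < s i) :
    DominatesNearlyMinimax r s
      (bayesPredictive r s (weightedJeffreysPrior (durationScale r s) (subspaceShrinkage V α)))
      (bayesPredictive r s jeffreysPrior) := by
  -- In dimension 0 the condition 0 < α ≤ (d - k - 2)/2 is impossible.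
  have hd : 0 < d := by
    rcases Nat.eq_zero_or_pos d with rfl | h
    · have : (0 : ℝ) ≤ Module.finrank ℝ V := Nat.cast_nonneg _
      norm_num at hαV
      linarith
    · exact h
  have hγ := durationScale_pos hr hs
  have hτ : ∀ i, 0 < s i / r i := fun i => div_pos (hs i) (hr i)
  have hτ' : ∀ i, 0 < s i / r i / (1 + s i / r i) := fun i => by have := hτ i; positivity
  have hwm := measurable_weightedJeffreysPrior (durationScale r s) V α
  have hJm := measurable_jeffreysPrior (d := d)
  set A : (Fin d → ℕ) → ℝ≥0∞ := posteriorMean V α fun i => s i / r i / (1 + s i / r i) with hA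
  set B : (Fin d → ℕ) → ℝ≥0∞ := posteriorMean V α fun i => s i / r i with hB
  have hA0 : ∀ x, A x ≠ 0 := posteriorMean_ne_zero V hα hαV hτ'
  have hAt : ∀ x, A x ≠ ∞ := posteriorMean_div_ne_top V hα hαV hτ
  have hm : ∀ x, marginal r (weightedJeffreysPrior (durationScale r s) (subspaceShrinkage V α)) x
      = marginal r jeffreysPrior x * A x := fun x => by
    rw [marginal_weightedJeffreysPrior V α hγ hr]
    simp only [observed_rate hr hs, hA]
  have hjm : ∀ x y, jointMarginal r s
        (weightedJeffreysPrior (durationScale r s) (subspaceShrinkage V α)) x y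
      = jointMarginal r s jeffreysPrior x y * B (x + y) := fun x y => by
    rw [jointMarginal_weightedJeffreysPrior V α hγ hr hs]
    simp only [total_rate hr hs, hB]
  have hM := marginal_jeffreysPrior_ne_zero_ne_top hr
  have hm0 : ∀ x, marginal r (weightedJeffreysPrior (durationScale r s)
      (subspaceShrinkage V α)) x ≠ 0 := fun x => by
    rw [hm]
    exact mul_ne_zero (hM x).1 (hA0 x)
  have hmt : ∀ x, marginal r (weightedJeffreysPrior (durationScale r s)
      (subspaceShrinkage V α)) x ≠ ∞ := fun x => by
    rw [hm]
    exact ENNReal.mul_ne_top (hM x).2 (hAt x)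
  have hf1 := isPredictive_bayesPredictive hs hwm hm0 hmt
  have hj1 := isPredictive_bayesPredictive hs hJm (fun x => (hM x).1) fun x => (hM x).2
  have hf0 := bayesPredictive_ne_zero hr hs hwm hm0 hmt
  have hj0 := bayesPredictive_ne_zero hr hs hJm (fun x => (hM x).1) fun x => (hM x).2
  have hratio : ∀ x y, bayesPredictive r s jeffreysPrior x y / bayesPredictive r s
      (weightedJeffreysPrior (durationScale r s) (subspaceShrinkage V α)) x y
      = A x / B (x + y) := by
    intro x y
    have h0 := hj0 x y
    have h1 := ne_top_of_tsum_eq_one (hj1 x) y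
    rw [bayesPredictive_eq] at h0 h1
    rw [bayesPredictive_eq, bayesPredictive_eq, hm, hjm]
    refine ennreal_div_div_div_mul (ENNReal.div_ne_zero.mp h0).1 ?_ (hM x).1 (hM x).2 (hA0 x) (hAt x)
    intro h
    rw [h, ENNReal.top_div_of_ne_top (hM x).2] at h1
    exact h1 rfl
  have hlt : ∀ lam : Fin d → ℝ, (∀ i, 0 < lam i) → klRisk r s (bayesPredictive r s
      (weightedJeffreysPrior (durationScale r s) (subspaceShrinkage V α))) lam
      < klRisk r s (bayesPredictive r s jeffreysPrior) lam := by
    intro lam hl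
    have h := klRisk_add_le hr hs hl hf0 hf1 hj0 hj1
    simp only [hratio] at h
    have hE := tsum_thinning_ratio_lt_one hr hs hl
      (sum_thinning_posteriorMean_lt V hα hαV hτ)
    -- Finiteness of the Jeffreys risk keeps the inequality strict when it is added to the expected
    -- ratio.
    exact lt_of_add_lt_add_right (h.trans_lt
      (ENNReal.add_lt_add_left (klRisk_jeffreysPrior_lt hd hr hs hl).ne_top hE))
  exact ⟨hf1, hj1, ⟨fun lam hl => (hlt lam hl).le, fun _ => 1, fun _ => one_pos,
    hlt _ fun _ => one_pos⟩, minimaxLowerBound_le_minimaxRisk hr hs,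
    fun lam hl => (hlt lam hl).trans (klRisk_jeffreysPrior_lt hd hr hs hl)⟩

/-! ### Rescaling the square roots -/

lemma sqDist_smul (V : Submodule ℝ (EuclideanSpace ℝ (Fin d))) (c : ℝ)
    (θ : EuclideanSpace ℝ (Fin d)) : sqDist V (c • θ) = c ^ 2 * sqDist V θ := by
  rw [sqDist_eq_norm_sq, sqDist_eq_norm_sq, map_smul, norm_smul, mul_pow, Real.norm_eq_abs, sq_abs]

/-- Homogeneity of degree -2α: a common rescaling of the θ_i multiplies the prior by a constant,
which cancels in the predictive distribution. -/
lemma subspaceShrinkage_smul (V : Submodule ℝ (EuclideanSpace ℝ (Fin d))) {α : ℝ}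
    (hα : 0 ≤ α) {c : ℝ} (hc : c ≠ 0) (θ : EuclideanSpace ℝ (Fin d)) :
    subspaceShrinkage V α (c • θ)
      = ENNReal.ofReal ((c ^ 2) ^ (-α)) * subspaceShrinkage V α θ := by
  have hc2 : 0 < c ^ 2 := by positivity
  have hpow : ENNReal.ofReal (c ^ 2) ^ α ≠ 0 := by
    rw [ENNReal.ofReal_rpow_of_pos hc2]
    simpa using Real.rpow_pos_of_pos hc2 α
  have hpow' : ENNReal.ofReal (c ^ 2) ^ α ≠ ∞ := ENNReal.rpow_ne_top_of_nonneg hα ENNReal.ofReal_ne_top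
  rw [subspaceShrinkage, subspaceShrinkage, Finset.mul_sum]
  refine Finset.sum_congr rfl fun a _ => ?_
  rw [← signFlipIsometry_apply, map_smul, sqDist_smul, ENNReal.ofReal_mul (sq_nonneg c),
    signFlipIsometry_apply, ENNReal.rpow_neg, ENNReal.mul_rpow_of_nonneg _ _ hα,
    ENNReal.mul_inv (Or.inl hpow) (Or.inl hpow'), ← ENNReal.rpow_neg, ← ENNReal.rpow_neg,
    ENNReal.ofReal_rpow_of_pos hc2]

lemma bayesPredictive_const_mul (r s : Fin d → ℝ) {w w' : (Fin d → ℝ) → ℝ≥0∞} {k : ℝ≥0∞}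
    (hk : k ≠ 0) (hk' : k ≠ ∞) (h : ∀ lam, (∀ i, 0 < lam i) → w' lam = k * w lam) :
    bayesPredictive r s w' = bayesPredictive r s w := by
  ext x y
  have h1 : marginal r w' x = k * marginal r w x := by
    rw [marginal, marginal, ← lintegral_const_mul' _ _ hk']
    refine setLIntegral_congr_fun measurableSet_orthant fun lam hl => ?_
    simp only [h lam hl]
    rw [mul_left_comm]
  have h2 : jointMarginal r s w' x y = k * jointMarginal r s w x y := by
    rw [jointMarginal, jointMarginal, ← lintegral_const_mul' _ _ hk']
    refine setLIntegral_congr_fun measurableSet_orthant fun lam hl => ?_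
    simp only [h lam hl]
    rw [mul_left_comm]
  rw [bayesPredictive_eq, bayesPredictive_eq, h1, h2, ENNReal.mul_div_mul_left _ _ hk hk']

lemma bayesPredictive_weightedJeffreysPrior_const (V : Submodule ℝ (EuclideanSpace ℝ (Fin d)))
    {α : ℝ} (hα : 0 ≤ α) (r s : Fin d → ℝ) {c : ℝ} (hc : 0 < c) :
    bayesPredictive r s (weightedJeffreysPrior (fun _ => c) (subspaceShrinkage V α))
      = bayesPredictive r s (weightedJeffreysPrior (fun _ => 1) (subspaceShrinkage V α)) := by
  have hc2 : 0 < (√c)⁻¹ := by positivity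
  refine bayesPredictive_const_mul r s (k := ENNReal.ofReal (((√c)⁻¹ ^ 2) ^ (-α)))
    (ENNReal.ofReal_pos.mpr (Real.rpow_pos_of_pos (pow_pos hc2 2) _)).ne' ENNReal.ofReal_ne_top
    fun lam hl => ?_
  rw [weightedJeffreysPrior, weightedJeffreysPrior, ← mul_assoc,
    ← subspaceShrinkage_smul V hα hc2.ne']
  congr 2
  ext i
  simp only [PiLp.smul_apply, smul_eq_mul, div_one]
  rw [Real.sqrt_div (hl i).le, div_eq_inv_mul]

end

end PoissonShrinkage

theorem mainTheorem8 {d : ℕ} (V : Submodule ℝ (EuclideanSpace ℝ (Fin d))) (α : ℝ)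
    (hα : 0 < α) (hαV : α ≤ ((d : ℝ) - (Module.finrank ℝ V : ℝ) - 2) / 2) :
    -- same durations, with `θ_i = √lam_i`
    (∀ r s : ℝ, 0 < r → 0 < s →
      DominatesNearlyMinimax (fun _ : Fin d => r) (fun _ : Fin d => s)
        (bayesPredictive (fun _ => r) (fun _ => s)
          (weightedJeffreysPrior (fun _ => 1) (subspaceShrinkage V α)))
        (bayesPredictive (fun _ => r) (fun _ => s) jeffreysPrior)) ∧
    -- possibly different durations, with `θ_i = √(lam_i / γ_i)`
    (∀ r s : Fin d → ℝ, (∀ i, 0 < r i) → (∀ i, 0 < s i) →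
      DominatesNearlyMinimax r s
        (bayesPredictive r s
          (weightedJeffreysPrior (durationScale r s) (subspaceShrinkage V α)))
        (bayesPredictive r s jeffreysPrior)) := by
  refine ⟨fun r s hr hs => ?_, fun r s hr hs =>
    PoissonShrinkage.dominatesNearlyMinimax_durationScale V hα hαV hr hs⟩
  have h := PoissonShrinkage.dominatesNearlyMinimax_durationScale V hα hαV
    (r := fun _ => r) (s := fun _ => s) (fun _ => hr) fun _ => hs
  have hc : 0 < 1 / r - 1 / (r + s) := sub_pos.mpr (one_div_lt_one_div_of_lt hr (by linarith))
  rwa [show durationScale (fun _ : Fin d => r) (fun _ => s) = fun _ => 1 / r - 1 / (r + s) from rfl,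
    PoissonShrinkage.bayesPredictive_weightedJeffreysPrior_const V hα.le _ _ hc] at h
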